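/- Let $A=(a_{ij})$ be a complex $n\times n$ matrix, $I=\{1,\dots,n\}$, and let $p:I\to\mathbb Z/2$ be a parity function. Let $\mathfrak h$ be a complex vector space of dimension $2n-\operatorname{rk}A$ with linearly independent $h_1,\dots,h_n\in\mathfrak h$ and linearly independent $\alpha_1,\dots,\alpha_n\in\mathfrak h^*$ such that $\alpha_j(h_i)=a_{ij}$. Let $\tilde{\mathfrak g}(A)$ be the Lie superalgebra generated by $\mathfrak h$ (even) and $X_i,Y_i$ (of parity $p(i)$), $i\in I$, with relations $[h,h']=0$, $[X_i,Y_j]=\delta_{ij}h_i$, $[h,X_i]=\alpha_i(h)X_i$, $[h,Y_i]=-\alpha_i(h)Y_i$ for $h,h'\in\mathfrak h$, and let $\mathfrak g(A)=\tilde{\mathfrak g}(A)/r(A)$, where $r(A)$ is the maximal ideal of $\tilde{\mathfrak g}(A)$ intersecting $\mathfrak h$ trivially. For $m\in\mathbb Z$ let $\mathfrak g_m$ be the sum of the root spaces $\mathfrak g_\alpha=\{x\in\mathfrak g(A):[h,x]=\alpha(h)x\ \forall h\in\mathfrak h\}$ over $\alpha=\sum_i c_i\alpha_i$ with $c_i\in\mathbb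 Z$ and $\sum_i c_i=m$. The superalgebra $\mathfrak g(A)$ has finite growth if $\dim\mathfrak g_m$ is bounded by a polynomial in $|m|$. $A$ is indecomposable if $I$ is not a disjoint union of non-empty subsets $J,K$ with $a_{jk}=a_{kj}=0$ for all $j\in J$, $k\in K$. Odd reflections. If $a_{kk}=0$ and $p(k)=1$, call $i\neq k$ linked to $k$ if $a_{ik}\ne0$ or $a_{ki}\neq 0$, and put $\alpha'_k=-\alpha_k$, $h'_k=h_k$; $\alpha'_i=\alpha_i+\alpha_k$, $h'_i=(-1)^{p(i)}(a_{ik}h_k+a_{ki}h_i)$ if $i$ is linked to $k$; and $\alpha'_i=\alpha_i$, $h'_i=h_i$ otherwise. The odd reflection of $(A,p)$ at $\alpha_k$ is $(A',p')$ with $a'_{ij}=\alpha'_j(h'_i)$, and $p'(i)=p(i)+p(k)$ if $i$ is linked to $k$, $p'(i)=p(i)$ otherwise. This applies both when $\alpha_k$ is regular (for all $j\ne k$, $a_{kj}=0$ implies $a_{jk}=0$) and when it is singular (not regular). Matrices are considered up to rescaling of rows, i.e. up to $A\mapsto DA$ with $D$ an invertible diagonal matrix. **Theorem.** Suppose that $A$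 is indecomposable with no zero rows and that $\mathfrak g(A)$ has finite growth. Then $A$ is admissible, that is: for $(A,p)$ itself and for every $(A',p')$ obtained from $(A,p)$ by a sequence of odd reflections (singular or regular), there is an invertible diagonal matrix $D$ such that $B=DA'$ (respectively $B=DA$), together with the parity function $p'$ (respectively $p$), satisfies the following conditions, stated with $q$ for that parity function: 1. for every $i\in I$, either $b_{ii}=0$ or $b_{ii}=2$; 2. if $b_{ii}=0$, then $q(i)=1$; 3. if $b_{ii}=2$, then $b_{ij}\in 2^{q(i)}\mathbb Z_{\le 0}$ for all $j\ne i$ (where $2^{q(i)}$ is $1$ for $q(i)=0$ and $2$ for $q(i)=1$); 4. if $b_{ij}=0$ and $b_{ji}\neq0$, then $b_{ii}=0$. -/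

import Mathlib

/-! Contragredient Lie superalgebras `𝔤(A)` over `ℂ`, their growth, and odd reflections of
Cartan matrices. -/

noncomputable section

namespace Contragredient

/-! ### Superalgebras and Lie superalgebras -/

/-- The Koszul sign `(-1)^{ij}` for parities `i, j ∈ ℤ/2`. -/
def koszul (i j : ZMod 2) : ℂ := (-1) ^ (i.val * j.val)

/-- A complex (not necessarily associative or unital) superalgebra: a vector space
`L = L₀ ⊕ L₁` with a bilinear product, written `bracket`, respecting parities. -/
class Superalgebra (L : Type*) [AddCommGroup L] [Module ℂ L] where
  bracket : L →ₗ[ℂ] L →ₗ[ℂ] L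
  part : ZMod 2 → Submodule ℂ L
  isCompl_part : IsCompl (part 0) (part 1)
  bracket_mem : ∀ (i j : ZMod 2) (x y : L), x ∈ part i → y ∈ part j → bracket x y ∈ part (i + j)

open Superalgebra

/-- A complex Lie superalgebra: a superalgebra with super skew-symmetry and the super Jacobi
identity on homogeneous elements. -/
class LieSuperalgebra (L : Type*) [AddCommGroup L] [Module ℂ L] extends Superalgebra L where
  skew : ∀ (i j : ZMod 2) (x y : L), x ∈ part i → y ∈ part j →
    bracket x y = -(koszul i j • bracket y x)
  jacobi : ∀ (i j k : ZMod 2) (x y z : L), x ∈ part i → y ∈ part j → z ∈ part k →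
    bracket x (bracket y z) = bracket (bracket x y) z + koszul i j • bracket y (bracket x z)

section Ideals

variable {L : Type*} [AddCommGroup L] [Module ℂ L] [Superalgebra L]

/-- (Graded, two-sided) ideals of a superalgebra. -/
structure IsIdeal (I : Submodule ℂ L) : Prop where
  graded : I ≤ (I ⊓ part 0) ⊔ (I ⊓ part 1)
  left : ∀ x y : L, y ∈ I → bracket x y ∈ I
  right : ∀ x y : L, x ∈ I → bracket x y ∈ I

theorem IsIdeal.mem_of_add_mem {I : Submodule ℂ L} (hI : IsIdeal I) {a b : L}
    (ha : a ∈ part (L := L) 0) (hb : b ∈ part (L := L) 1) (h : a + b ∈ I) : a ∈ I ∧ b ∈ I := by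
  obtain ⟨a', ha', b', hb', e⟩ := Submodule.mem_sup.1 (hI.graded h)
  have h0 : a - a' = b' - b := by
    rw [sub_eq_sub_iff_add_eq_add, ← e, add_comm]
  have h1 : a - a' = 0 := by
    have := (Submodule.disjoint_def.1 (isCompl_part (L := L)).disjoint) (a - a')
      (sub_mem ha ha'.2) (h0 ▸ sub_mem hb'.2 hb)
    exact this
  have h2 : b' - b = 0 := h0 ▸ h1
  rw [sub_eq_zero] at h1 h2
  exact ⟨h1 ▸ ha'.1, h2 ▸ hb'.1⟩

theorem IsIdeal.sInf {S : Set (Submodule ℂ L)} (hS : ∀ I ∈ S, IsIdeal I) : IsIdeal (sInf S) where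
  graded := by
    intro x hx
    rw [Submodule.mem_sInf] at hx
    obtain ⟨a, ha, b, hb, rfl⟩ := Submodule.mem_sup.1
      ((isCompl_part (L := L)).sup_eq_top ▸ Submodule.mem_top (x := x))
    refine Submodule.add_mem_sup ⟨?_, ha⟩ ⟨?_, hb⟩
    · exact Submodule.mem_sInf.2 fun I hI => ((hS I hI).mem_of_add_mem ha hb (hx I hI)).1
    · exact Submodule.mem_sInf.2 fun I hI => ((hS I hI).mem_of_add_mem ha hb (hx I hI)).2
  left x y hy := Submodule.mem_sInf.2 fun I hI =>
    (hS I hI).left x y (Submodule.mem_sInf.1 hy I hI)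
  right x y hx := Submodule.mem_sInf.2 fun I hI =>
    (hS I hI).right x y (Submodule.mem_sInf.1 hx I hI)

theorem IsIdeal.sSup {S : Set (Submodule ℂ L)} (hS : ∀ I ∈ S, IsIdeal I) : IsIdeal (sSup S) where
  graded := sSup_le fun I hI => (hS I hI).graded.trans
    (sup_le_sup (inf_le_inf_right _ (le_sSup hI)) (inf_le_inf_right _ (le_sSup hI)))
  left x := by
    have : SupSet.sSup S ≤ (SupSet.sSup S).comap (bracket x) :=
      sSup_le fun I hI y hy => (le_sSup hI : I ≤ SupSet.sSup S) ((hS I hI).left x y hy)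
    exact fun y hy => this hy
  right x y hx := by
    have : SupSet.sSup S ≤ (SupSet.sSup S).comap ((bracket (L := L)).flip y) :=
      sSup_le fun I hI x hx => (le_sSup hI : I ≤ SupSet.sSup S) ((hS I hI).right x y hx)
    exact this hx

/-- The quotient of a superalgebra by an ideal. -/
@[reducible] def quotientSuperalgebra (I : Submodule ℂ L) (hI : IsIdeal I) :
    Superalgebra (L ⧸ I) where
  bracket := I.liftQ
    (LinearMap.mk₂ ℂ (fun x => I.mapQ I (bracket x) (fun y hy => hI.left x y hy))
      (fun x y z => by
        obtain ⟨z, rfl⟩ := I.mkQ_surjective z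
        simp)
      (fun c x z => by
        obtain ⟨z, rfl⟩ := I.mkQ_surjective z
        simp)
      (fun x y z => by simp)
      (fun c x z => by simp))
    (fun x hx => by
      rw [LinearMap.mem_ker]
      ext z
      simpa using hI.right x z hx)
  part i := (part i).map I.mkQ
  isCompl_part := by
    constructor
    · rw [Submodule.disjoint_def]
      rintro x ⟨a, ha, rfl⟩ ⟨b, hb, e⟩
      have h : a + -b ∈ I := by
        rw [← sub_eq_add_neg, ← Submodule.Quotient.mk_eq_zero I, Submodule.Quotient.mk_sub]
        exact sub_eq_zero.2 e.symm
      simpa using (hI.mem_of_add_mem ha (neg_mem hb) h).1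
    · rw [codisjoint_iff, ← Submodule.map_sup, (isCompl_part (L := L)).sup_eq_top,
        Submodule.map_top, Submodule.range_mkQ]
  bracket_mem := by
    rintro i j _ _ ⟨x, hx, rfl⟩ ⟨y, hy, rfl⟩
    exact ⟨bracket x y, bracket_mem i j x y hx hy, by simp⟩

end Ideals

/-- The quotient of a Lie superalgebra by an ideal. -/
@[reducible] def quotientLieSuperalgebra {L : Type*} [AddCommGroup L] [Module ℂ L]
    [LieSuperalgebra L] (I : Submodule ℂ L) (hI : IsIdeal I) : LieSuperalgebra (L ⧸ I) where
  toSuperalgebra := quotientSuperalgebra I hI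
  skew := by
    rintro i j _ _ ⟨x, hx, rfl⟩ ⟨y, hy, rfl⟩
    exact congrArg I.mkQ (LieSuperalgebra.skew i j x y hx hy)
  jacobi := by
    rintro i j k _ _ _ ⟨x, hx, rfl⟩ ⟨y, hy, rfl⟩ ⟨z, hz, rfl⟩
    exact congrArg I.mkQ (LieSuperalgebra.jacobi i j k x y z hx hy hz)

/-! ### Realizations of a matrix -/

/-- A realization of an `n × n` matrix `A`: a space `𝔥` of dimension `2n - rk A` with linearly
independent `h₁, …, hₙ ∈ 𝔥` and linearly independent `α₁, …, αₙ ∈ 𝔥*` such that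
`αⱼ(hᵢ) = aᵢⱼ`. -/
structure Realization {n : ℕ} (A : Matrix (Fin n) (Fin n) ℂ)
    (𝔥 : Type*) [AddCommGroup 𝔥] [Module ℂ 𝔥] where
  finite : Module.Finite ℂ 𝔥
  finrank_add_rank : Module.finrank ℂ 𝔥 + A.rank = 2 * n
  coroot : Fin n → 𝔥
  root : Fin n → Module.Dual ℂ 𝔥
  linearIndependent_coroot : LinearIndependent ℂ coroot
  linearIndependent_root : LinearIndependent ℂ root
  root_coroot : ∀ i j, root j (coroot i) = A i j

/-! ### The Lie superalgebra `𝔤̃(A)` by generators and relations -/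

/-- The generators `Xᵢ`, `Yᵢ` and the elements of `𝔥`. -/
inductive Gen (n : ℕ) (𝔥 : Type*)
  | X (i : Fin n)
  | Y (i : Fin n)
  | H (h : 𝔥)

variable {n : ℕ} {A : Matrix (Fin n) (Fin n) ℂ} {𝔥 : Type*} [AddCommGroup 𝔥] [Module ℂ 𝔥]

/-- The parity of a generator: `p(i)` for `Xᵢ` and `Yᵢ`, and even on `𝔥`. -/
def genParity (p : Fin n → ZMod 2) : Gen n 𝔥 → ZMod 2
  | .X i => p i
  | .Y i => p i
  | .H _ => 0

/-- The parity of a nonassociative word in the generators. -/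
def wordParity (p : Fin n → ZMod 2) : FreeMagma (Gen n 𝔥) → ZMod 2
  | .of g => genParity p g
  | .mul u v => wordParity p u + wordParity p v

/-- The free nonassociative algebra on the generators, whose basis is the set of words. The parity
function `p` and the realization are parameters so that they determine the structures below. -/
@[nolint unusedArguments]
def FreeAlg (_R : Realization A 𝔥) (_p : Fin n → ZMod 2) : Type _ :=
  FreeNonUnitalNonAssocAlgebra ℂ (Gen n 𝔥)

section

variable (R : Realization A 𝔥) (p : Fin n → ZMod 2)

instance : NonUnitalNonAssocRing (FreeAlg R p) :=
  inferInstanceAs (NonUnitalNonAssocRing (FreeNonUnitalNonAssocAlgebra ℂ (Gen n 𝔥)))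

instance : Module ℂ (FreeAlg R p) :=
  inferInstanceAs (Module ℂ (FreeNonUnitalNonAssocAlgebra ℂ (Gen n 𝔥)))

instance : SMulCommClass ℂ (FreeAlg R p) (FreeAlg R p) :=
  inferInstanceAs (SMulCommClass ℂ (FreeNonUnitalNonAssocAlgebra ℂ (Gen n 𝔥))
    (FreeNonUnitalNonAssocAlgebra ℂ (Gen n 𝔥)))

instance : IsScalarTower ℂ (FreeAlg R p) (FreeAlg R p) :=
  inferInstanceAs (IsScalarTower ℂ (FreeNonUnitalNonAssocAlgebra ℂ (Gen n 𝔥))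
    (FreeNonUnitalNonAssocAlgebra ℂ (Gen n 𝔥)))

/-- A word as an element of the free nonassociative algebra. -/
def word (w : FreeMagma (Gen n 𝔥)) : FreeAlg R p :=
  MonoidAlgebra.ofMagma ℂ (FreeMagma (Gen n 𝔥)) w

/-- A generator as an element of the free nonassociative algebra. -/
def gen (g : Gen n 𝔥) : FreeAlg R p := word R p (FreeMagma.of g)

theorem word_mul (u v : FreeMagma (Gen n 𝔥)) :
    word R p u * word R p v = word R p (FreeMagma.mul u v) :=
  (map_mul (MonoidAlgebra.ofMagma ℂ (FreeMagma (Gen n 𝔥))) u v).symm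

/-- The span of the words of parity `i`. -/
def wordPart (i : ZMod 2) : Submodule ℂ (FreeAlg R p) :=
  Submodule.span ℂ (word R p '' {w | wordParity p w = i})

theorem coeff_eq_zero_of_mem_wordPart {i : ZMod 2} {x : FreeAlg R p} (hx : x ∈ wordPart R p i)
    (w : FreeMagma (Gen n 𝔥)) (hw : wordParity p w ≠ i) : MonoidAlgebra.coeff x w = 0 := by
  induction hx using Submodule.span_induction with
  | mem x hx =>
    obtain ⟨v, hv, rfl⟩ := hx
    have : v ≠ w := by
      rintro rfl
      exact hw hv
    change (Finsupp.single v (1 : ℂ)) w = 0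
    exact Finsupp.single_eq_of_ne (Ne.symm this)
  | zero => rfl
  | add x y _ _ h1 h2 =>
    change MonoidAlgebra.coeff x w + MonoidAlgebra.coeff y w = 0
    rw [h1, h2, add_zero]
  | smul c x _ h =>
    change c • MonoidAlgebra.coeff x w = 0
    rw [h, smul_zero]

theorem isCompl_wordPart : IsCompl (wordPart R p 0) (wordPart R p 1) := by
  constructor
  · rw [Submodule.disjoint_def]
    intro x h0 h1
    have h : MonoidAlgebra.coeff x = 0 := by
      ext w
      by_cases hw : wordParity p w = 0
      · exact coeff_eq_zero_of_mem_wordPart R p h1 w (by rw [hw]; decide)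
      · exact coeff_eq_zero_of_mem_wordPart R p h0 w hw
    exact congrArg MonoidAlgebra.ofCoeff h
  · rw [codisjoint_iff, eq_top_iff]
    rintro ⟨f⟩ -
    induction f using Finsupp.induction_linear with
    | zero => exact zero_mem _
    | add f g hf hg => exact add_mem hf hg
    | single w c =>
      have e : (MonoidAlgebra.ofCoeff (Finsupp.single w c) : MonoidAlgebra ℂ (FreeMagma (Gen n 𝔥)))
          = c • (word R p w : FreeAlg R p) := by
        change _ = c • MonoidAlgebra.single w (1 : ℂ)
        rw [MonoidAlgebra.smul_single, smul_eq_mul, mul_one]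
        rfl
      have hmem : (word R p w : FreeAlg R p) ∈ wordPart R p 0 ⊔ wordPart R p 1 := by
        have hi : ∀ i : ZMod 2, i = 0 ∨ i = 1 := by decide
        rcases hi (wordParity p w) with h | h
        · exact Submodule.mem_sup_left (Submodule.subset_span ⟨w, h, rfl⟩)
        · exact Submodule.mem_sup_right (Submodule.subset_span ⟨w, h, rfl⟩)
      exact e ▸ Submodule.smul_mem _ c hmem

instance : Superalgebra (FreeAlg R p) where
  bracket := LinearMap.mul ℂ (FreeAlg R p)
  part := wordPart R p
  isCompl_part := isCompl_wordPart R p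
  bracket_mem := by
    intro i j x y hx hy
    change x * y ∈ wordPart R p (i + j)
    induction hx using Submodule.span_induction with
    | zero => simp
    | add a b _ _ ha hb => exact add_mul a b y ▸ add_mem ha hb
    | smul c a _ ha => exact smul_mul_assoc c a y ▸ Submodule.smul_mem _ c ha
    | mem x hx =>
      obtain ⟨u, rfl, rfl⟩ := hx
      induction hy using Submodule.span_induction with
      | zero => simp
      | add a b _ _ ha hb => exact mul_add (word R p u) a b ▸ add_mem ha hb
      | smul c a _ ha => exact mul_smul_comm c (word R p u) a ▸ Submodule.smul_mem _ c ha
      | mem y hy =>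
        obtain ⟨v, rfl, rfl⟩ := hy
        exact Submodule.subset_span ⟨FreeMagma.mul u v, rfl, (word_mul R p u v).symm⟩

/-- The relators of `𝔤̃(A)`: super skew-symmetry and the super Jacobi identity (on words, hence by
linearity on all homogeneous elements), the linear structure of `𝔥`, and
`[h, h'] = 0`, `[Xᵢ, Yⱼ] = δᵢⱼ hᵢ`, `[h, Xᵢ] = αᵢ(h) Xᵢ`, `[h, Yᵢ] = -αᵢ(h) Yᵢ`. -/
inductive IsRelator : FreeAlg R p → Prop
  | skew (u v : FreeMagma (Gen n 𝔥)) : IsRelator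
      (word R p u * word R p v
        + koszul (wordParity p u) (wordParity p v) • (word R p v * word R p u))
  | jacobi (u v w : FreeMagma (Gen n 𝔥)) : IsRelator
      (word R p u * (word R p v * word R p w) - (word R p u * word R p v) * word R p w
        - koszul (wordParity p u) (wordParity p v) • (word R p v * (word R p u * word R p w)))
  | H_add (h h' : 𝔥) : IsRelator (gen R p (.H (h + h')) - gen R p (.H h) - gen R p (.H h'))
  | H_smul (c : ℂ) (h : 𝔥) : IsRelator (gen R p (.H (c • h)) - c • gen R p (.H h))
  | H_H (h h' : 𝔥) : IsRelator (gen R p (.H h) * gen R p (.H h'))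
  | X_Y_same (i : Fin n) :
      IsRelator (gen R p (.X i) * gen R p (.Y i) - gen R p (.H (R.coroot i)))
  | X_Y_ne (i j : Fin n) (hij : i ≠ j) : IsRelator (gen R p (.X i) * gen R p (.Y j))
  | H_X (h : 𝔥) (i : Fin n) :
      IsRelator (gen R p (.H h) * gen R p (.X i) - R.root i h • gen R p (.X i))
  | H_Y (h : 𝔥) (i : Fin n) :
      IsRelator (gen R p (.H h) * gen R p (.Y i) + R.root i h • gen R p (.Y i))

/-- The ideal generated by the relators. -/
def relIdeal : Submodule ℂ (FreeAlg R p) :=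
  sInf {I | IsIdeal I ∧ ∀ x, IsRelator R p x → x ∈ I}

theorem isIdeal_relIdeal : IsIdeal (relIdeal R p) := IsIdeal.sInf fun _ hI => hI.1

theorem IsRelator.mem {x : FreeAlg R p} (hx : IsRelator R p x) : x ∈ relIdeal R p :=
  Submodule.mem_sInf.2 fun _ hI => hI.2 x hx

theorem skew_mem {i j : ZMod 2} {x y : FreeAlg R p} (hx : x ∈ wordPart R p i)
    (hy : y ∈ wordPart R p j) : x * y + koszul i j • (y * x) ∈ relIdeal R p := by
  induction hx using Submodule.span_induction with
  | zero => simp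
  | add a b _ _ ha hb =>
    convert add_mem ha hb using 1
    simp only [add_mul, mul_add, smul_add]
    abel
  | smul c a _ ha =>
    convert Submodule.smul_mem _ c ha using 1
    simp only [smul_mul_assoc, mul_smul_comm, smul_add, smul_comm c]
  | mem x hx =>
    obtain ⟨u, rfl, rfl⟩ := hx
    induction hy using Submodule.span_induction with
    | zero => simp
    | add a b _ _ ha hb =>
      convert add_mem ha hb using 1
      simp only [add_mul, mul_add, smul_add]
      abel
    | smul c a _ ha =>
      convert Submodule.smul_mem _ c ha using 1
      simp only [smul_mul_assoc, mul_smul_comm, smul_add, smul_comm c]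
    | mem y hy =>
      obtain ⟨v, rfl, rfl⟩ := hy
      exact (IsRelator.skew u v).mem

theorem jacobi_mem {i j k : ZMod 2} {x y z : FreeAlg R p} (hx : x ∈ wordPart R p i)
    (hy : y ∈ wordPart R p j) (hz : z ∈ wordPart R p k) :
    x * (y * z) - (x * y) * z - koszul i j • (y * (x * z)) ∈ relIdeal R p := by
  induction hx using Submodule.span_induction with
  | zero => simp
  | add a b _ _ ha hb =>
    convert add_mem ha hb using 1
    simp only [add_mul, mul_add, smul_add]
    abel
  | smul c a _ ha =>
    convert Submodule.smul_mem _ c ha using 1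
    simp only [smul_mul_assoc, mul_smul_comm, smul_sub, smul_comm c]
  | mem x hx =>
    obtain ⟨u, rfl, rfl⟩ := hx
    induction hy using Submodule.span_induction with
    | zero => simp
    | add a b _ _ ha hb =>
      convert add_mem ha hb using 1
      simp only [add_mul, mul_add, smul_add]
      abel
    | smul c a _ ha =>
      convert Submodule.smul_mem _ c ha using 1
      simp only [smul_mul_assoc, mul_smul_comm, smul_sub, smul_comm c]
    | mem y hy =>
      obtain ⟨v, rfl, rfl⟩ := hy
      induction hz using Submodule.span_induction with
      | zero => simp
      | add a b _ _ ha hb =>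
        convert add_mem ha hb using 1
        simp only [mul_add, smul_add]
        abel
      | smul c a _ ha =>
        convert Submodule.smul_mem _ c ha using 1
        simp only [mul_smul_comm, smul_sub, smul_comm c]
      | mem z hz =>
        obtain ⟨w, rfl, rfl⟩ := hz
        exact (IsRelator.jacobi u v w).mem

/-- The Lie superalgebra `𝔤̃(A)` defined by the generators `Xᵢ, Yᵢ, 𝔥` and the relations above. -/
def GTilde : Type _ := FreeAlg R p ⧸ relIdeal R p

instance : AddCommGroup (GTilde R p) := inferInstanceAs (AddCommGroup (FreeAlg R p ⧸ relIdeal R p))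

instance : Module ℂ (GTilde R p) := inferInstanceAs (Module ℂ (FreeAlg R p ⧸ relIdeal R p))

instance : LieSuperalgebra (GTilde R p) where
  toSuperalgebra := quotientSuperalgebra (relIdeal R p) (isIdeal_relIdeal R p)
  skew := by
    rintro i j _ _ ⟨x, hx, rfl⟩ ⟨y, hy, rfl⟩
    rw [eq_neg_iff_add_eq_zero]
    exact (Submodule.Quotient.mk_eq_zero (relIdeal R p)).2 (skew_mem R p hx hy)
  jacobi := by
    rintro i j k _ _ _ ⟨x, hx, rfl⟩ ⟨y, hy, rfl⟩ ⟨z, hz, rfl⟩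
    rw [← sub_eq_zero, ← sub_sub]
    exact (Submodule.Quotient.mk_eq_zero (relIdeal R p)).2 (jacobi_mem R p hx hy hz)

/-- The quotient map onto `𝔤̃(A)`. -/
def toGTilde : FreeAlg R p →ₗ[ℂ] GTilde R p := (relIdeal R p).mkQ

theorem IsRelator.toGTilde_eq_zero {x : FreeAlg R p} (hx : IsRelator R p x) :
    toGTilde R p x = 0 :=
  (Submodule.Quotient.mk_eq_zero (relIdeal R p)).2 hx.mem

/-- The canonical linear map `𝔥 → 𝔤̃(A)`. -/
def cartanTilde : 𝔥 →ₗ[ℂ] GTilde R p where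
  toFun h := toGTilde R p (gen R p (.H h))
  map_add' h h' := by
    rw [← sub_eq_zero, ← sub_sub, ← map_sub, ← map_sub]
    exact (IsRelator.H_add h h').toGTilde_eq_zero
  map_smul' c h := by
    rw [RingHom.id_apply, ← sub_eq_zero, ← map_smul, ← map_sub]
    exact (IsRelator.H_smul c h).toGTilde_eq_zero

/-! ### The contragredient Lie superalgebra `𝔤(A)` -/

/-- `r(A)`: the maximal ideal of `𝔤̃(A)` intersecting `𝔥` trivially, that is, the sum of all
ideals intersecting `𝔥` trivially. -/
def maxIdeal : Submodule ℂ (GTilde R p) :=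
  sSup {I | IsIdeal I ∧ Disjoint I (LinearMap.range (cartanTilde R p))}

theorem isIdeal_maxIdeal : IsIdeal (maxIdeal R p) := IsIdeal.sSup fun _ hI => hI.1

/-- The contragredient Lie superalgebra `𝔤(A) = 𝔤̃(A) / r(A)`. -/
def G : Type _ := GTilde R p ⧸ maxIdeal R p

instance : AddCommGroup (G R p) := inferInstanceAs (AddCommGroup (GTilde R p ⧸ maxIdeal R p))

instance : Module ℂ (G R p) := inferInstanceAs (Module ℂ (GTilde R p ⧸ maxIdeal R p))

instance : LieSuperalgebra (G R p) :=
  quotientLieSuperalgebra (maxIdeal R p) (isIdeal_maxIdeal R p)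

/-- The canonical linear map `𝔥 → 𝔤(A)`. -/
def cartan : 𝔥 →ₗ[ℂ] G R p := (maxIdeal R p).mkQ ∘ₗ cartanTilde R p

/-! ### Root spaces, the principal grading, finite growth -/

/-- The root space `𝔤_α = {x | [h, x] = α(h) x for all h ∈ 𝔥}`. -/
def rootSpace (α : Module.Dual ℂ 𝔥) : Submodule ℂ (G R p) :=
  ⨅ h : 𝔥, LinearMap.ker (bracket (cartan R p h) - α h • (LinearMap.id : G R p →ₗ[ℂ] G R p))

/-- The component `𝔤_m` of the principal grading: the sum of the root spaces `𝔤_α` with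
`α = ∑ cᵢ αᵢ`, `cᵢ ∈ ℤ`, of height `∑ cᵢ = m`. -/
def principalPart (m : ℤ) : Submodule ℂ (G R p) :=
  ⨆ (c : Fin n → ℤ) (_ : ∑ i, c i = m), rootSpace R p (∑ i, c i • R.root i)

/-- `𝔤(A)` is of finite growth: `dim 𝔤_m` is bounded by a polynomial in `|m|`. -/
def HasFiniteGrowth : Prop :=
  ∃ C d : ℕ, ∀ m : ℤ,
    Module.rank ℂ (principalPart R p m) ≤ ((C * (m.natAbs + 1) ^ d : ℕ) : Cardinal)

end

/-! ### Matrix conditions and odd reflections -/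

/-- `A` has no zero rows. -/
def NoZeroRows (A : Matrix (Fin n) (Fin n) ℂ) : Prop := ∀ i, ∃ j, A i j ≠ 0

/-- `A` is indecomposable: the index set is not a disjoint union of non-empty `J`, `K` with
`aⱼₖ = aₖⱼ = 0` for all `j ∈ J`, `k ∈ K`. -/
def Indecomposable (A : Matrix (Fin n) (Fin n) ℂ) : Prop :=
  ¬ ∃ J K : Set (Fin n), J.Nonempty ∧ K.Nonempty ∧ Disjoint J K ∧ J ∪ K = Set.univ ∧
    ∀ j ∈ J, ∀ k ∈ K, A j k = 0 ∧ A k j = 0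

/-- The four matrix conditions implied by integrability. -/
structure IntegrabilityConditions (A : Matrix (Fin n) (Fin n) ℂ) (p : Fin n → ZMod 2) : Prop where
  diag : ∀ i, A i i = 0 ∨ A i i = 2
  odd_of_diag_zero : ∀ i, A i i = 0 → p i = 1
  offDiag : ∀ i, A i i = 2 → ∀ j, j ≠ i → ∃ m : ℤ, m ≤ 0 ∧ A i j = 2 ^ (p i).val * (m : ℂ)
  zero_of_transpose : ∀ i j, A i j = 0 → A j i ≠ 0 → A i i = 0

/-- The conditions hold after rescaling the rows, i.e. for `D A` with `D` invertible diagonal. -/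
def IntegrabilityConditionsUpToRescaling (A : Matrix (Fin n) (Fin n) ℂ) (p : Fin n → ZMod 2) :
    Prop :=
  ∃ d : Fin n → ℂ, (∀ i, d i ≠ 0) ∧ IntegrabilityConditions (Matrix.diagonal d * A) p

/-- `i ≠ k`, and `aᵢₖ` or `aₖᵢ` is nonzero. -/
def Linked (A : Matrix (Fin n) (Fin n) ℂ) (k i : Fin n) : Prop :=
  i ≠ k ∧ (A i k ≠ 0 ∨ A k i ≠ 0)

open Classical in
/-- Coordinates in `α₁, …, αₙ` of the reflected simple root
`α'_j = r_k(α_j)`, for the odd reflection at `α_k`. -/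
def reflectedRoot (A : Matrix (Fin n) (Fin n) ℂ) (k j : Fin n) : Fin n → ℂ :=
  if j = k then -Pi.single k 1
  else if Linked A k j then Pi.single j 1 + Pi.single k 1
  else Pi.single j 1

open Classical in
/-- Coordinates in `h₁, …, hₙ` of the reflected coroot `h'_i = [X'_i, Y'_i]`. -/
def reflectedCoroot (A : Matrix (Fin n) (Fin n) ℂ) (p : Fin n → ZMod 2) (k i : Fin n) :
    Fin n → ℂ :=
  if i = k then Pi.single k 1
  else if Linked A k i then
    (-1 : ℂ) ^ (p i).val • (A i k • Pi.single k 1 + A k i • Pi.single i 1)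
  else Pi.single i 1

/-- The reflected matrix `a'ᵢⱼ = α'_j(h'_i)`. -/
def oddReflection (A : Matrix (Fin n) (Fin n) ℂ) (p : Fin n → ZMod 2) (k : Fin n) :
    Matrix (Fin n) (Fin n) ℂ :=
  Matrix.of fun i j =>
    ∑ r, ∑ s, reflectedCoroot A p k i r * A r s * reflectedRoot A k j s

open Classical in
/-- The parities of the reflected simple roots `α'_i`. -/
def reflectedParity (A : Matrix (Fin n) (Fin n) ℂ) (p : Fin n → ZMod 2) (k : Fin n) :
    Fin n → ZMod 2 :=
  fun i => if Linked A k i then p i + p k else p i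

/-- `OddReflected A p A' p'`: the matrix `A'`, with parity function `p'`, is obtained from `A`, `p`
by a (possibly empty) sequence of odd reflections at isotropic simple roots (`a_kk = 0`,
`p(k) = 1`), regular or singular. Rows may be rescaled at any stage. -/
inductive OddReflected (A : Matrix (Fin n) (Fin n) ℂ) (p : Fin n → ZMod 2) :
    Matrix (Fin n) (Fin n) ℂ → (Fin n → ZMod 2) → Prop
  | refl : OddReflected A p A p
  | reflect {B : Matrix (Fin n) (Fin n) ℂ} {q : Fin n → ZMod 2} (h : OddReflected A p B q)
      (k : Fin n) (hk : B k k = 0) (hq : q k = 1) :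
      OddReflected A p (oddReflection B q k) (reflectedParity B q k)
  | rescale {B : Matrix (Fin n) (Fin n) ℂ} {q : Fin n → ZMod 2} (h : OddReflected A p B q)
      (d : Fin n → ℂ) (hd : ∀ i, d i ≠ 0) : OddReflected A p (Matrix.diagonal d * B) q

/-- `A` is admissible: every matrix obtained from `A` by a sequence of odd reflections, including
`A` itself, satisfies the integrability conditions after rescaling of its rows. -/
def IsAdmissible (A : Matrix (Fin n) (Fin n) ℂ) (p : Fin n → ZMod 2) : Prop :=
  ∀ (A' : Matrix (Fin n) (Fin n) ℂ) (p' : Fin n → ZMod 2), OddReflected A p A' p' →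
    IntegrabilityConditionsUpToRescaling A' p'

end Contragredient

end

noncomputable section

namespace Contragredient

open Superalgebra

local infixr:75 " ⋄ " => Superalgebra.bracket

/-! ### Calculus in Lie superalgebras -/

/-! Each of the conditions 2, 3 and 4, when it fails, produces an infinite root string, and such a
string already forces growth faster than any polynomial.

Let `α_i` be even and put `e_m = (ad X_i)^m X_j`, `f_m = (ad Y_i)^m Y_j`. An `sl₂`-type computation,
valid for every value of `a_ii`, shows that `[f_m, e_m]` is a multiple of `a_ij h_j + m a_ji h_i`,
and that the multiple is nonzero as soon as no `a_ij + s a_ii / 2` with `s ≥ 1` vanishes. Since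
`[f_s, e_t] = 0` for `|s - t| ≥ 2`, the strings of even index behave like infinitely many Chevalley
generators. Applied to a suitable vector `v`, the products of the `e_{2t}` over subsets of `N`
indices are `2^N` linearly independent words of length `O(N²)` (`nested_independent`,
`not_polyGrowth_of_family`). The only analytic input is that the scalars met when the factors are
stripped off are nonzero once the indices are large (`exists_nonvanishing`). An odd `α_i` with `a_ii
≠ 0` is replaced by the even root `2α_i` (`IsChevalley.double`), which is where the factor
`2^{q(i)}` comes from. The outcome is `IsChevalley.integrabilityConditions`: it needs only nonzero
generators satisfying the Chevalley relations, a matrix without zero rows, and polynomial growth.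

It remains to keep these hypotheses through odd reflections. The reflected generators are `Y_k`,
`[X_i, X_k]` and `X_i`. They satisfy the relations of the reflected matrix provided that `[X_j, X_k]
= [Y_j, Y_k] = 0` whenever `a_jk = a_kj = 0`. This is arranged by passing to the subalgebra
generated by the `X_i`, `Y_i` and dividing by the largest graded submodule stable under them inside
the nonzero degrees (`IsGradedChevalley.exists_reduced`). A grading with linearly independent
degrees of the `X_i` ensures that the required brackets die and that the generators survive. Being
abstract, the argument treats regular and singular reflections alike.

Finally `𝔤(A)` itself has to fit this framework, the main point being `X_i ≠ 0`, that is, `𝔥` embeds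
in `𝔤(A)`. The embedding into `𝔤̃(A)` comes from Verma-type modules of arbitrary highest weight
(`cartanTilde_injective`). It survives in the quotient because every ideal meeting `𝔥` trivially
lies in the nonzero part of the principal grading (`IsCartanSystem.ideal_le_nonzeroPart`). -/

theorem koszul_zero_left (j : ZMod 2) : koszul 0 j = 1 := by simp [koszul]

theorem koszul_zero_right (j : ZMod 2) : koszul j 0 = 1 := by simp [koszul]

theorem koszul_self_mul (i j : ZMod 2) : koszul i j * koszul i j = 1 := by
  rw [koszul, ← pow_add, ← two_mul, pow_mul]
  simp

theorem koszul_ne_zero (i j : ZMod 2) : koszul i j ≠ 0 := by simp [koszul]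

theorem koszul_comm (i j : ZMod 2) : koszul i j = koszul j i := by simp [koszul, mul_comm]

theorem koszul_one_one : koszul 1 1 = -1 := by simp [koszul, ZMod.val_one]

theorem zmod_two_add_self (i : ZMod 2) : i + i = 0 := by revert i; decide

theorem zmod_two_eq (i : ZMod 2) : i = 0 ∨ i = 1 := by revert i; decide

section Lie

variable {L : Type*} [AddCommGroup L] [Module ℂ L] [LieSuperalgebra L]

theorem exists_part_add (z : L) : ∃ a ∈ part (L := L) 0, ∃ b ∈ part (L := L) 1, a + b = z :=
  Submodule.mem_sup.1 ((isCompl_part (L := L)).sup_eq_top ▸ Submodule.mem_top (x := z))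

theorem jac {i j : ZMod 2} {x y : L} (hx : x ∈ part i) (hy : y ∈ part j) (z : L) :
    x ⋄ y ⋄ z = (x ⋄ y) ⋄ z + koszul i j • y ⋄ x ⋄ z := by
  obtain ⟨a, ha, b, hb, rfl⟩ := exists_part_add z
  simp only [map_add, LieSuperalgebra.jacobi i j _ x y _ hx hy ha,
    LieSuperalgebra.jacobi i j _ x y _ hx hy hb, smul_add]
  abel

theorem skew {i j : ZMod 2} {x y : L} (hx : x ∈ part i) (hy : y ∈ part j) :
    x ⋄ y = -(koszul i j • y ⋄ x) := LieSuperalgebra.skew i j x y hx hy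

theorem jac_even {x : L} (hx : x ∈ part 0) (y z : L) :
    x ⋄ y ⋄ z = (x ⋄ y) ⋄ z + y ⋄ x ⋄ z := by
  obtain ⟨a, ha, b, hb, rfl⟩ := exists_part_add y
  simp only [map_add, LinearMap.add_apply, jac hx ha, jac hx hb, koszul_zero_left, one_smul]
  abel

theorem skew_even {x : L} (hx : x ∈ part 0) (y : L) : x ⋄ y = -(y ⋄ x) := by
  obtain ⟨a, ha, b, hb, rfl⟩ := exists_part_add y
  simp only [map_add, LinearMap.add_apply, skew hx ha, skew hx hb, koszul_zero_left, one_smul,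
    neg_add]

theorem skew_even' {x : L} (hx : x ∈ part 0) (y : L) : y ⋄ x = -(x ⋄ y) := by
  rw [skew_even hx, neg_neg]

theorem bracket_self_even {x : L} (hx : x ∈ part 0) : x ⋄ x = 0 := by
  have h := skew_even hx x
  have h2 : (2 : ℂ) • x ⋄ x = 0 := by
    rw [two_smul]
    nth_rw 1 [h]
    simp
  simpa using h2

/-! ### Words and growth -/

/-- `Word S l x`: up to a scalar, `x` is a bracket word of length at most `l` in elements of `S`. -/
inductive Word (S : Set L) : ℕ → L → Prop
  | gen {x : L} (hx : x ∈ S) : Word S 1 x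
  | mul {a b : ℕ} {x y : L} (hx : Word S a x) (hy : Word S b y) : Word S (a + b) (x ⋄ y)
  | smul {a : ℕ} {x : L} (c : ℂ) (hx : Word S a x) : Word S a (c • x)
  | mono {a b : ℕ} {x : L} (hab : a ≤ b) (hx : Word S a x) : Word S b x

theorem Word.trans {S T : Set L} {k l : ℕ} {x : L} (hT : ∀ y ∈ T, Word S k y) (hx : Word T l x) :
    Word S (k * l) x := by
  induction hx with
  | gen hx => simpa using hT _ hx
  | mul _ _ h1 h2 => rw [mul_add]; exact h1.mul h2
  | smul c _ h => exact h.smul c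
  | mono hab _ h => exact h.mono (Nat.mul_le_mul_left k hab)

/-- The number of linearly independent words of length at most `m` in `S` is bounded by a
polynomial in `m`. -/
def PolyGrowth (S : Set L) : Prop :=
  ∃ C d : ℕ, ∀ (m k : ℕ) (v : Fin k → L), LinearIndependent ℂ v → (∀ i, Word S m (v i)) →
    k ≤ C * (m + 1) ^ d

/-- Rewriting words in the old generators multiplies lengths by at most `k`, which only changes the
constant. This carries polynomial growth to reflected, rescaled or doubled generators. -/
theorem PolyGrowth.of_word {S T : Set L} (hS : PolyGrowth S) {k : ℕ}
    (hT : ∀ y ∈ T, Word S k y) : PolyGrowth T := by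
  obtain ⟨C, d, h⟩ := hS
  refine ⟨C * (k + 1) ^ d, d, fun m r v hv hw => ?_⟩
  refine (h (k * m) r v hv fun i => (hw i).trans hT).trans ?_
  rw [mul_assoc, ← mul_pow]
  gcongr
  nlinarith

theorem exists_poly_lt_two_pow (C d e K : ℕ) : ∃ N : ℕ, C * (K * (N + 1) ^ e + 1) ^ d < 2 ^ N := by
  have h1 : ∀ N : ℕ, C * (K * (N + 1) ^ e + 1) ^ d ≤ (C * (K + 1) ^ d) * (N + 1) ^ (e * d) := by
    intro N
    rw [mul_assoc, pow_mul, ← mul_pow]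
    gcongr
    have : 1 ≤ (N + 1) ^ e := Nat.one_le_pow _ _ (by omega)
    nlinarith
  have h2 := tendsto_pow_const_div_const_pow_of_one_lt (e * d) (r := (2 : ℝ)) (by norm_num)
  -- The limit is read at `N + 1`, so the comparison is with `2^(N+1)`; the factor 2 pays for this,
  -- and the `+ 1` keeps the denominator positive when `C = 0`.
  have h3 : (0 : ℝ) < 1 / (2 * (C * (K + 1) ^ d) + 1) := by positivity
  obtain ⟨M, hM⟩ := ((h2.eventually (gt_mem_nhds h3)).and (Filter.eventually_ge_atTop 1)).exists
  obtain ⟨hM, hM1⟩ := hM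
  obtain ⟨N, rfl⟩ : ∃ N, M = N + 1 := ⟨M - 1, by omega⟩
  refine ⟨N, (h1 N).trans_lt ?_⟩
  rw [div_lt_div_iff₀ (by positivity) (by positivity)] at hM
  have : (((N + 1) ^ (e * d) * (2 * (C * (K + 1) ^ d) + 1) : ℕ) : ℝ) < ((2 ^ (N + 1) : ℕ) : ℝ) := by
    push_cast at hM ⊢
    linarith
  have h4 : (N + 1) ^ (e * d) * (2 * (C * (K + 1) ^ d) + 1) < 2 ^ (N + 1) := by exact_mod_cast this
  have h5 : 0 < (N + 1) ^ (e * d) := by positivity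
  rw [pow_succ] at h4
  nlinarith

/-! ### A superpolynomial family of words -/

/-- The nested bracket of the `E t`, `t ∈ S ∩ {0, …, N - 1}`, and `v`, with `t` decreasing from left
to right. -/
def nested (E : ℕ → L) (v : L) : ℕ → Finset ℕ → L
  | 0, _ => v
  | N + 1, S => if N ∈ S then E N ⋄ nested E v N S else nested E v N S

variable {E F : ℕ → L} {v : L} {q r : ZMod 2} {b : ℕ → ℕ → ℂ} {c : ℕ → ℂ}

theorem nested_insert (N M : ℕ) (hM : N ≤ M) (S : Finset ℕ) :
    nested E v N (insert M S) = nested E v N S := by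
  induction N with
  | zero => rfl
  | succ N ih => simp [nested, ih (by omega), show N ≠ M by omega]

/-- Only indices below `N` occur in the nested word, so `F s` supercommutes with every factor and
kills `v`. -/
theorem bracket_nested_of_le (hE : ∀ t, E t ∈ part q) (hF : ∀ t, F t ∈ part q)
    (hFE : ∀ s t, s ≠ t → F s ⋄ E t = 0) (hFv : ∀ s, F s ⋄ v = 0) (N s : ℕ) (hs : N ≤ s)
    (S : Finset ℕ) : F s ⋄ nested E v N S = 0 := by
  induction N with
  | zero => exact hFv s
  | succ N ih =>
    by_cases h : N ∈ S
    · simp [nested, h, jac (hF s) (hE N), ih (by omega), hFE s N (by omega)]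
    · simpa [nested, h] using ih (by omega)

/-- `[F s, E s]` is even, hence acts as an ordinary derivation, and its eigenvalues on the factors
add up. -/
theorem bracket_bracket_nested (hE : ∀ t, E t ∈ part q) (hF : ∀ t, F t ∈ part q)
    (hb : ∀ s t, (F s ⋄ E s) ⋄ E t = b s t • E t) (hc : ∀ s, (F s ⋄ E s) ⋄ v = c s • v)
    (N s : ℕ) (S : Finset ℕ) :
    (F s ⋄ E s) ⋄ nested E v N S
      = (c s + ∑ t ∈ (Finset.range N).filter (· ∈ S), b s t) • nested E v N S := by
  induction N with
  | zero => simp [nested, hc]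
  | succ N ih =>
    have hD : F s ⋄ E s ∈ part 0 := by
      simpa [zmod_two_add_self] using bracket_mem _ _ _ _ (hF s) (hE s)
    by_cases h : N ∈ S
    · rw [Finset.range_add_one, Finset.filter_insert, if_pos h, Finset.sum_insert (by simp)]
      simp only [nested, h, if_true]
      rw [jac_even hD, hb, ih]
      simp only [map_smul, LinearMap.smul_apply, ← add_smul]
      congr 1
      ring
    · rw [Finset.range_add_one, Finset.filter_insert, if_neg h]
      simpa only [nested, h, if_false] using ih

theorem nested_word {T : Set L} {K l : ℕ} (hE : ∀ t, Word T (K * (t + 1)) (E t)) (hv : Word T l v)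
    (N : ℕ) (S : Finset ℕ) : Word T (l + K * N ^ 2) (nested E v N S) := by
  induction N with
  | zero => exact hv.mono (by omega)
  | succ N ih =>
    by_cases h : N ∈ S
    · simp only [nested, h, if_true]
      refine ((hE N).mul ih).mono ?_
      nlinarith [Nat.zero_le (K * N)]
    · simp only [nested, h, if_false]
      refine ih.mono ?_
      gcongr
      omega

/-- Strip off the largest index: `F N` kills the words without `E N` and sends `E N ⋄ w` to a
nonzero multiple of `w`. A relation therefore splits into two relations of level `N`. -/
theorem nested_independent (hE : ∀ t, E t ∈ part q) (hF : ∀ t, F t ∈ part q)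
    (hFE : ∀ s t, s ≠ t → F s ⋄ E t = 0) (hFv : ∀ s, F s ⋄ v = 0)
    (hb : ∀ s t, (F s ⋄ E s) ⋄ E t = b s t • E t) (hc : ∀ s, (F s ⋄ E s) ⋄ v = c s • v)
    (hne : ∀ s S, S ⊆ Finset.range s → c s + ∑ t ∈ S, b s t ≠ 0) (hv : v ≠ 0) (N : ℕ)
    (g : Finset ℕ → ℂ)
    (hg : ∑ S ∈ (Finset.range N).powerset, g S • nested E v N S = 0) :
    ∀ S ∈ (Finset.range N).powerset, g S = 0 := by
  induction N generalizing g with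
  | zero => simpa [nested, hv] using hg
  | succ N ih =>
    have hN : ∀ S ∈ (Finset.range N).powerset, N ∉ S := fun S hS h => by
      have := Finset.mem_powerset.1 hS h
      simp at this
    rw [Finset.range_add_one, Finset.sum_powerset_insert (by simp)] at hg
    have e1 : ∑ S ∈ (Finset.range N).powerset, g S • nested E v (N + 1) S
        = ∑ S ∈ (Finset.range N).powerset, g S • nested E v N S :=
      Finset.sum_congr rfl fun S hS => by simp [nested, hN S hS]
    have e2 : ∑ S ∈ (Finset.range N).powerset, g (insert N S) • nested E v (N + 1) (insert N S)
        = ∑ S ∈ (Finset.range N).powerset, g (insert N S) • E N ⋄ nested E v N S :=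
      Finset.sum_congr rfl fun S hS => by simp [nested, nested_insert N N le_rfl]
    rw [e1, e2] at hg
    have h2 := congrArg (bracket (F N)) hg
    simp only [map_add, map_sum, map_smul, map_zero,
      bracket_nested_of_le hE hF hFE hFv N N le_rfl, smul_zero, Finset.sum_const_zero, zero_add,
      jac (hF N) (hE N), bracket_bracket_nested hE hF hb hc, add_zero, smul_smul] at h2
    have h3 : ∀ S ∈ (Finset.range N).powerset, g (insert N S) = 0 := by
      intro S hS
      have := ih _ h2 S hS
      refine (mul_eq_zero.1 this).resolve_right (hne N _ ?_)
      exact Finset.filter_subset _ _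
    have h4 : ∑ S ∈ (Finset.range N).powerset, g S • nested E v N S = 0 := by
      rw [← hg, left_eq_add]
      exact Finset.sum_eq_zero fun S hS => by rw [h3 S hS, zero_smul]
    have h5 := ih _ h4
    intro S hS
    rw [Finset.range_add_one, Finset.mem_powerset] at hS
    by_cases hNS : N ∈ S
    · rw [← Finset.insert_erase hNS]
      refine h3 _ (Finset.mem_powerset.2 ?_)
      rwa [← Finset.subset_insert_iff]
    · exact h5 S (Finset.mem_powerset.2 ((Finset.subset_insert_iff_of_notMem hNS).1 hS))

/-- A family `E`, `F` that behaves like infinitely many Chevalley generators with suitably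
nonvanishing Cartan matrix forces growth faster than any polynomial. -/
theorem not_polyGrowth_of_family {T : Set L} {K l : ℕ} (hE : ∀ t, E t ∈ part q)
    (hF : ∀ t, F t ∈ part q)
    (hFE : ∀ s t, s ≠ t → F s ⋄ E t = 0) (hFv : ∀ s, F s ⋄ v = 0)
    (hb : ∀ s t, (F s ⋄ E s) ⋄ E t = b s t • E t) (hc : ∀ s, (F s ⋄ E s) ⋄ v = c s • v)
    (hne : ∀ s S, S ⊆ Finset.range s → c s + ∑ t ∈ S, b s t ≠ 0) (hv : v ≠ 0)
    (hEw : ∀ t, Word T (K * (t + 1)) (E t)) (hvw : Word T l v) : ¬ PolyGrowth T := by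
  rintro ⟨C, d, h⟩
  -- The words have length at most `l + K N² ≤ (l + K)(N + 1)²`, and there are `2^N` of them.
  obtain ⟨N, hN⟩ := exists_poly_lt_two_pow C d 2 (l + K)
  have hli : LinearIndependent ℂ
      (fun S : (Finset.range N).powerset => nested E v N (S : Finset ℕ)) := by
    rw [Fintype.linearIndependent_iff]
    intro g hg S
    classical
    have := nested_independent hE hF hFE hFv hb hc hne hv N
      (fun S => if hS : S ∈ (Finset.range N).powerset then g ⟨S, hS⟩ else 0) (by
        rw [← hg, ← Finset.sum_coe_sort (Finset.range N).powerset]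
        exact Finset.sum_congr rfl fun S _ => by simp only [S.2, dif_pos])
    simpa only [S.2, dif_pos] using this S S.2
  have hcard : Fintype.card (Finset.range N).powerset = 2 ^ N := by simp
  have e := (Fintype.equivFinOfCardEq hcard).symm
  have := h (l + K * N ^ 2) (2 ^ N) _ (hli.comp e e.injective)
    fun i => nested_word hEw hvw N _
  refine absurd (this.trans ?_) (not_le.2 hN)
  gcongr
  nlinarith [Nat.zero_le (l * N), Nat.zero_le (K * N), Nat.zero_le (l * N ^ 2)]

end Lie

/-! ### Chevalley generators -/

section Chevalley

variable {L : Type*} [AddCommGroup L] [Module ℂ L] [LieSuperalgebra L] {n : ℕ}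

/-- `X`, `Y` satisfy the relations of the Chevalley generators of `𝔤̃(A)`. -/
structure IsChevalley (A : Matrix (Fin n) (Fin n) ℂ) (p : Fin n → ZMod 2) (X Y : Fin n → L) :
    Prop where
  X_mem : ∀ i, X i ∈ part (p i)
  Y_mem : ∀ i, Y i ∈ part (p i)
  X_Y : ∀ i j, i ≠ j → X i ⋄ Y j = 0
  H_X : ∀ i j, (X i ⋄ Y i) ⋄ X j = A i j • X j
  H_Y : ∀ i j, (X i ⋄ Y i) ⋄ Y j = -(A i j • Y j)

variable {A : Matrix (Fin n) (Fin n) ℂ} {p : Fin n → ZMod 2} {X Y : Fin n → L}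

namespace IsChevalley

theorem H_mem (hc : IsChevalley A p X Y) (i : Fin n) : X i ⋄ Y i ∈ part 0 := by
  simpa [zmod_two_add_self] using bracket_mem _ _ _ _ (hc.X_mem i) (hc.Y_mem i)

theorem X_H (hc : IsChevalley A p X Y) (i j : Fin n) : X j ⋄ X i ⋄ Y i = -(A i j • X j) := by
  rw [skew_even' (hc.H_mem i), hc.H_X]

theorem Y_H (hc : IsChevalley A p X Y) (i j : Fin n) : Y j ⋄ X i ⋄ Y i = A i j • Y j := by
  rw [skew_even' (hc.H_mem i), hc.H_Y, neg_neg]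

theorem Y_X (hc : IsChevalley A p X Y) (i j : Fin n) (hij : i ≠ j) : Y i ⋄ X j = 0 := by
  rw [skew (hc.Y_mem i) (hc.X_mem j), hc.X_Y j i hij.symm, smul_zero, neg_zero]

theorem Y_X_same (hc : IsChevalley A p X Y) (i : Fin n) :
    Y i ⋄ X i = -(koszul (p i) (p i) • X i ⋄ Y i) := skew (hc.Y_mem i) (hc.X_mem i)

/-- The Chevalley involution. -/
theorem swap (hc : IsChevalley A p X Y) :
    IsChevalley A p Y (fun i => koszul (p i) (p i) • X i) where
  X_mem := hc.Y_mem
  Y_mem i := Submodule.smul_mem _ _ (hc.X_mem i)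
  X_Y i j hij := by rw [map_smul, hc.Y_X i j hij, smul_zero]
  -- The Koszul sign on `X i` makes the new coroot exactly `-[X i, Y i]`, so the Cartan matrix is
  -- unchanged.
  H_X i j := by
    simp [hc.Y_X_same, smul_smul, koszul_self_mul, hc.H_Y]
  H_Y i j := by
    simp [hc.Y_X_same, smul_smul, koszul_self_mul, hc.H_X, mul_comm]

end IsChevalley

/-! ### Strings through a simple root in the direction of an even simple root -/

/-- `(ad x)^m v`. -/
def rootString (x v : L) (m : ℕ) : L := (bracket x)^[m] v

theorem rootString_zero (x v : L) : rootString x v 0 = v := rfl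

theorem rootString_succ (x v : L) (m : ℕ) : rootString x v (m + 1) = x ⋄ rootString x v m :=
  Function.iterate_succ_apply' _ _ _

theorem rootString_smul (x v : L) (c : ℂ) (m : ℕ) :
    rootString x (c • v) m = c • rootString x v m := by
  induction m with
  | zero => rfl
  | succ m ih => rw [rootString_succ, ih, map_smul, rootString_succ]

theorem rootString_word {T : Set L} {x v : L} (hx : x ∈ T) (hv : v ∈ T) (m : ℕ) :
    Word T (m + 1) (rootString x v m) := by
  induction m with
  | zero => exact .gen hv
  | succ m ih =>
    rw [rootString_succ, add_comm (m + 1)]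
    exact (Word.gen hx).mul ih

theorem rootString_mem {x v : L} {r : ZMod 2} (hx : x ∈ part 0) (hv : v ∈ part r) (m : ℕ) :
    rootString x v m ∈ part r := by
  induction m with
  | zero => exact hv
  | succ m ih =>
    rw [rootString_succ]
    simpa using bracket_mem _ _ _ _ hx ih

/-- The product of the numbers `(t + 2) (l + a (t + 1) / 2)`, `t < m`. -/
def stringCoeff (a l : ℂ) (m : ℕ) : ℂ := ∏ t ∈ Finset.range m, ((t + 2) * (l + a * (t + 1) / 2))

/-- The factor with `s = 0`, which is `l` itself, does not enter the product. Hence the criterion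
remains usable when `a_ij = 0`, as condition 4 requires. -/
theorem stringCoeff_ne_zero {a l : ℂ} (h : ∀ s : ℕ, 1 ≤ s → l + a * s / 2 ≠ 0) (m : ℕ) :
    stringCoeff a l m ≠ 0 := by
  refine Finset.prod_ne_zero_iff.2 fun t _ => mul_ne_zero ?_ ?_
  · exact_mod_cast (by omega : t + 2 ≠ 0)
  · simpa using h (t + 1) (by omega)

namespace IsChevalley

variable {i j : Fin n}

theorem H_string (hc : IsChevalley A p X Y) (r : Fin n) (m : ℕ) :
    (X r ⋄ Y r) ⋄ rootString (X i) (X j) m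
      = (A r j + m * A r i) • rootString (X i) (X j) m := by
  induction m with
  | zero => simp [rootString_zero, hc.H_X]
  | succ m ih =>
    rw [rootString_succ, jac_even (hc.H_mem r), hc.H_X, ih]
    simp only [map_smul, LinearMap.smul_apply, ← add_smul]
    congr 1
    push_cast
    ring

theorem Y_string_zero (hc : IsChevalley A p X Y) (hij : i ≠ j) :
    Y i ⋄ rootString (X i) (X j) 0 = 0 := hc.Y_X i j hij

/-- The `sl₂` computation, written without normalising `A i i`; for `A i i = 0` it is the Heisenberg
case. -/
theorem Y_string_succ (hc : IsChevalley A p X Y) (hij : i ≠ j) (hi : p i = 0) (m : ℕ) :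
    Y i ⋄ rootString (X i) (X j) (m + 1)
      = -(((m + 1) * (A i j + m * A i i / 2)) • rootString (X i) (X j) m) := by
  have hY : Y i ∈ part 0 := hi ▸ hc.Y_mem i
  induction m with
  | zero =>
    rw [rootString_succ, jac_even hY, hc.Y_string_zero hij, map_zero, add_zero, hc.Y_X_same, hi]
    simp [koszul_zero_left, rootString_zero, hc.H_X]
  | succ m ih =>
    rw [rootString_succ, jac_even hY, ih, hc.Y_X_same, hi, koszul_zero_left, one_smul, map_neg,
      LinearMap.neg_apply, hc.H_string, map_neg, map_smul, ← rootString_succ, ← neg_add,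
      ← add_smul]
    congr 2
    push_cast
    ring

theorem X_string_succ (hc : IsChevalley A p X Y) (hij : i ≠ j) (hi : p i = 0) (m : ℕ) :
    X i ⋄ rootString (Y i) (Y j) (m + 1)
      = -(((m + 1) * (A i j + m * A i i / 2)) • rootString (Y i) (Y j) m) := by
  simpa [hi, koszul_zero_left] using hc.swap.Y_string_succ hij hi m

/-- The two formulas feed each other: moving one `ad X_i` across by the Leibniz rule raises the
first string, and moving one `ad Y_i` then raises the second. -/
theorem string_bracket (hc : IsChevalley A p X Y) (hij : i ≠ j) (hi : p i = 0) (m : ℕ) :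
    rootString (X i) (X j) (m + 1) ⋄ rootString (Y i) (Y j) m
        = -((A j i * stringCoeff (A i i) (A i j) m) • X i) ∧
      rootString (X i) (X j) (m + 1) ⋄ rootString (Y i) (Y j) (m + 1)
        = stringCoeff (A i i) (A i j) m •
          (A i j • X j ⋄ Y j + ((m + 1) * A j i) • X i ⋄ Y i) := by
  have hX : X i ∈ part 0 := hi ▸ hc.X_mem i
  have hY : Y i ∈ part 0 := hi ▸ hc.Y_mem i
  have hl : ∀ u w : L, (X i ⋄ u) ⋄ w = X i ⋄ u ⋄ w - u ⋄ X i ⋄ w := fun u w => by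
    rw [jac_even hX u w, add_sub_cancel_right]
  have hr : ∀ u w : L, u ⋄ Y i ⋄ w = Y i ⋄ u ⋄ w - (Y i ⋄ u) ⋄ w := fun u w => by
    rw [jac_even hY u w, add_sub_cancel_left]
  have hYX : Y i ⋄ X i = -(X i ⋄ Y i) := by
    rw [hc.Y_X_same, hi, koszul_zero_left, one_smul]
  induction m with
  | zero =>
    have h1 : rootString (X i) (X j) 1 ⋄ rootString (Y i) (Y j) 0 = -(A j i • X i) := by
      rw [rootString_succ, rootString_zero, rootString_zero, hl, hc.X_Y i j hij, map_zero,
        sub_zero, hc.X_H]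
    constructor
    · simpa [stringCoeff] using h1
    · rw [rootString_succ (Y i), hr, zero_add, h1, hc.Y_string_succ hij hi, rootString_zero,
        rootString_zero]
      simp [stringCoeff, hYX]
      abel
  | succ m ih =>
    obtain ⟨h1, h2⟩ := ih
    have hQ : stringCoeff (A i i) (A i j) (m + 1) = stringCoeff (A i i) (A i j) m *
        ((m + 2) * (A i j + A i i * (m + 1) / 2)) := Finset.prod_range_succ _ _
    have h3 : rootString (X i) (X j) (m + 1 + 1) ⋄ rootString (Y i) (Y j) (m + 1)
        = -((A j i * stringCoeff (A i i) (A i j) (m + 1)) • X i) := by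
      rw [rootString_succ, hl, h2, hc.X_string_succ hij hi, hQ]
      simp only [map_neg, map_smul, h1, map_add, hc.X_H, smul_neg, smul_smul, ← neg_add, ← add_smul, neg_neg,
        sub_eq_add_neg]
      congr 2
      ring
    refine ⟨h3, ?_⟩
    rw [rootString_succ (Y i), hr, h3, hc.Y_string_succ hij hi, hQ]
    simp only [map_neg, map_smul, LinearMap.neg_apply, LinearMap.smul_apply, h2, hYX, smul_neg, neg_neg, sub_neg_eq_add]
    push_cast
    module

/-- The bracket would have weight a multiple `-(2 + d)` of `α_i`. Without a root decomposition at
hand, this is computed: with index difference one the bracket is a multiple of `Y i`, and a further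
`ad Y_i` kills it because `Y i` is even. -/
theorem string_bracket_eq_zero (hc : IsChevalley A p X Y) (hij : i ≠ j) (hi : p i = 0)
    (m d : ℕ) : rootString (X i) (X j) m ⋄ rootString (Y i) (Y j) (m + 2 + d) = 0 := by
  have hY : Y i ∈ part 0 := hi ▸ hc.Y_mem i
  have hX : X i ∈ part 0 := hi ▸ hc.X_mem i
  have hr : ∀ u w : L, u ⋄ Y i ⋄ w = Y i ⋄ u ⋄ w - (Y i ⋄ u) ⋄ w := fun u w => by
    rw [jac_even hY u w, add_sub_cancel_left]
  have h1 : ∀ m, ∃ c : ℂ, rootString (X i) (X j) m ⋄ rootString (Y i) (Y j) (m + 1)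
      = c • Y i := by
    intro m
    -- The Chevalley involution turns the formula giving a multiple of `X i` into one giving a
    -- multiple of `Y i`.
    have h := (hc.swap.string_bracket hij hi m).1
    have e : rootString (koszul (p i) (p i) • X i) (koszul (p j) (p j) • X j) m
        = koszul (p j) (p j) • rootString (X i) (X j) m := by
      simp only [hi, koszul_zero_left, one_smul]
      exact rootString_smul _ _ _ _
    rw [e, map_smul, ← neg_smul] at h
    rw [skew (rootString_mem hX (hc.X_mem j) m) (rootString_mem hY (hc.Y_mem j) (m + 1)), h]
    exact ⟨_, (neg_smul _ _).symm⟩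
  induction m generalizing d with
  | zero =>
    induction d with
    | zero =>
      obtain ⟨c, hc1⟩ := h1 0
      rw [add_zero, rootString_succ, hr, hc.Y_string_zero hij, hc1, map_smul,
        bracket_self_even hY]
      simp
    | succ d ih =>
      rw [← add_assoc, rootString_succ, hr, ih, hc.Y_string_zero hij]
      simp
  | succ m ih =>
    have h2 : ∀ d, (Y i ⋄ rootString (X i) (X j) (m + 1)) ⋄
        rootString (Y i) (Y j) (m + 2 + d) = 0 := fun d => by
      rw [hc.Y_string_succ hij hi, map_neg, LinearMap.neg_apply, map_smul, LinearMap.smul_apply,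
        ih, smul_zero, neg_zero]
    induction d with
    | zero =>
      obtain ⟨c, hc1⟩ := h1 (m + 1)
      have := h2 0
      rw [add_zero] at this ⊢
      rw [rootString_succ (Y i), hr, hc1, map_smul, bracket_self_even hY, this]
      simp
    | succ d ihd =>
      have := h2 (d + 1)
      rw [show m + 2 + (d + 1) = m + 1 + 2 + d by omega] at this
      rw [← add_assoc, rootString_succ (Y i), hr, ihd, this]
      simp

theorem string_bracket_eq_zero' (hc : IsChevalley A p X Y) (hij : i ≠ j) (hi : p i = 0)
    (m d : ℕ) : rootString (Y i) (Y j) m ⋄ rootString (X i) (X j) (m + 2 + d) = 0 := by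
  have h := hc.swap.string_bracket_eq_zero hij hi m d
  have e : rootString (koszul (p i) (p i) • X i) (koszul (p j) (p j) • X j) (m + 2 + d)
      = koszul (p j) (p j) • rootString (X i) (X j) (m + 2 + d) := by
    simp only [hi, koszul_zero_left, one_smul]
    exact rootString_smul _ _ _ _
  rw [e, map_smul] at h
  exact (smul_eq_zero.1 h).resolve_left (koszul_ne_zero _ _)

/-- Neighbouring strings may bracket to nonzero multiples of `X i` or `Y i`. Distinct even indices
differ by at least two, which avoids this. -/
theorem string_bracket_even_index (hc : IsChevalley A p X Y) (hij : i ≠ j) (hi : p i = 0)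
    (s t : ℕ) (hst : s ≠ t) :
    rootString (Y i) (Y j) (2 * s) ⋄ rootString (X i) (X j) (2 * t) = 0 := by
  rcases lt_or_gt_of_ne hst with h | h
  · obtain ⟨d, hd⟩ := Nat.exists_eq_add_of_le (show 2 * s + 2 ≤ 2 * t by omega)
    rw [hd]
    exact hc.string_bracket_eq_zero' hij hi _ _
  · obtain ⟨d, hd⟩ := Nat.exists_eq_add_of_le (show 2 * t + 2 ≤ 2 * s by omega)
    have hX : X i ∈ part 0 := hi ▸ hc.X_mem i
    have hY : Y i ∈ part 0 := hi ▸ hc.Y_mem i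
    rw [hd, skew (rootString_mem hY (hc.Y_mem j) _) (rootString_mem hX (hc.X_mem j) _),
      hc.string_bracket_eq_zero hij hi]
    simp

/-- `[f_m, e_m]` for the strings `e_m = (ad Xᵢ)^m Xⱼ` and `f_m = (ad Yᵢ)^m Yⱼ`. -/
theorem string_coroot (hc : IsChevalley A p X Y) (hij : i ≠ j) (hi : p i = 0) (m : ℕ)
    (hm : 1 ≤ m) :
    rootString (Y i) (Y j) m ⋄ rootString (X i) (X j) m
      = (-koszul (p j) (p j) * stringCoeff (A i i) (A i j) (m - 1)) •
          (A i j • X j ⋄ Y j + (m * A j i) • X i ⋄ Y i) := by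
  have hX : X i ∈ part 0 := hi ▸ hc.X_mem i
  have hY : Y i ∈ part 0 := hi ▸ hc.Y_mem i
  obtain ⟨m, rfl⟩ : ∃ k, m = k + 1 := ⟨m - 1, by omega⟩
  rw [skew (rootString_mem hY (hc.Y_mem j) _) (rootString_mem hX (hc.X_mem j) _),
    (hc.string_bracket hij hi m).2, smul_smul, neg_mul, neg_smul, Nat.add_sub_cancel]
  push_cast
  rfl

end IsChevalley

end Chevalley

/-! ### Infinite root strings contradict polynomial growth -/

section Growth

variable {L : Type*} [AddCommGroup L] [Module ℂ L] [LieSuperalgebra L] {n : ℕ}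

/-- Here `l, μ, a, d` stand for `a_ij, a_ji, a_ii, a_jj`. The expression is the value of `l h_j + m
μ h_i` on a sum of `r` weights `α_j + m_t α_i` with `∑ m_t = σ`. For `a = 0` the real part decides,
after division by `lμ`; for `a ≠ 0` the term in `σ` dominates; for `μ = 0` only `r l d` is left. -/
theorem exists_nonvanishing (l μ a d : ℂ)
    (h : (μ ≠ 0 ∧ (l ≠ 0 ∨ a ≠ 0)) ∨ (μ = 0 ∧ l ≠ 0 ∧ d ≠ 0)) :
    ∃ T : ℕ, ∀ m r σ : ℕ, T ≤ m → 1 ≤ r → r * T ≤ σ →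
      (r : ℂ) * (l * d + l * μ * m) + μ * (l + a * m) * σ ≠ 0 := by
  rcases h with ⟨hμ, h⟩ | ⟨rfl, hl, hd⟩
  · by_cases ha : a = 0
    · subst ha
      have hl : l ≠ 0 := by simpa using h
      obtain ⟨T, hT⟩ := exists_nat_gt ‖d / μ‖
      refine ⟨T, fun m r σ hm hr _ h0 => ?_⟩
      have h1 : (r : ℂ) * (d / μ + m) + σ = 0 := by
        have : l * μ * ((r : ℂ) * (d / μ + m) + σ) = 0 := by
          rw [← h0]
          field_simp
          ring
        exact (mul_eq_zero.1 this).resolve_left (mul_ne_zero hl hμ)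
      have h2 := congrArg Complex.re h1
      simp only [Complex.add_re, Complex.mul_re, Complex.natCast_re, Complex.natCast_im, zero_mul,
        sub_zero, Complex.zero_re] at h2
      have h3 := (abs_le.1 (Complex.abs_re_le_norm (d / μ))).1
      have h4 : (T : ℝ) ≤ m := by exact_mod_cast hm
      have h5 : (1 : ℝ) ≤ r := by exact_mod_cast hr
      have h6 : (0 : ℝ) ≤ σ := by positivity
      have h7 : 0 < (r : ℝ) * ((d / μ).re + m) := mul_pos (by linarith) (by linarith)
      linarith
    · have ha' : 0 < ‖a‖ := norm_pos_iff.2 ha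
      -- Cancellation would need `(‖a‖ m - ‖l‖) T ≤ 2 ‖l‖ m`. Since `T ≤ m`, the bound `‖a‖ T > 3‖l‖
      -- + 1` excludes it.
      obtain ⟨T, hT⟩ := exists_nat_gt (max ‖d / μ‖ ((3 * ‖l‖ + 1) / ‖a‖))
      have hT1 : ‖d / μ‖ < T := (le_max_left _ _).trans_lt hT
      have hT2 : 3 * ‖l‖ + 1 < T * ‖a‖ := (div_lt_iff₀ ha').1 ((le_max_right _ _).trans_lt hT)
      refine ⟨T, fun m r σ hm hr hσ h0 => ?_⟩
      have h1 : (l + a * m) * σ = -(r * l * (d / μ + m)) := by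
        have : μ * ((l + a * m) * σ + (r * l * (d / μ + m))) = 0 := by
          rw [← h0]
          field_simp
          ring
        exact eq_neg_of_add_eq_zero_left ((mul_eq_zero.1 this).resolve_left hμ)
      have h2 := congrArg norm h1
      rw [norm_neg, norm_mul, norm_mul, norm_mul, Complex.norm_natCast, Complex.norm_natCast] at h2
      have h3 : ‖a‖ * m ≤ ‖l + a * m‖ + ‖l‖ := by
        have := norm_sub_le (l + a * m) l
        rwa [add_sub_cancel_left, norm_mul, Complex.norm_natCast] at this
      have h4 : ‖d / μ + m‖ ≤ ‖d / μ‖ + m := by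
        simpa using norm_add_le (d / μ) (m : ℂ)
      have hm' : (T : ℝ) ≤ m := by exact_mod_cast hm
      have hr' : (1 : ℝ) ≤ r := by exact_mod_cast hr
      have hσ' : (r : ℝ) * T ≤ σ := by exact_mod_cast hσ
      have hl := norm_nonneg l
      have hT0 : (0 : ℝ) < T := (norm_nonneg _).trans_lt hT1
      have h5 : (0 : ℝ) ≤ ‖a‖ * m - ‖l‖ := by nlinarith
      have h6 : (‖a‖ * m - ‖l‖) * (r * T) ≤ ‖l + a * m‖ * σ := by
        gcongr
        linarith
      have h7 : r * ‖l‖ * ‖d / μ + m‖ ≤ r * ‖l‖ * (2 * m) := by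
        gcongr
        linarith
      have h8 : (‖a‖ * m - ‖l‖) * T ≤ ‖l‖ * (2 * m) := by
        have : r * ((‖a‖ * m - ‖l‖) * T) ≤ r * (‖l‖ * (2 * m)) := by linarith
        exact le_of_mul_le_mul_left this (by linarith)
      nlinarith
  · exact ⟨0, fun m r σ _ hr _ => by simp [hl, hd, show r ≠ 0 by omega]⟩

variable {A : Matrix (Fin n) (Fin n) ℂ} {p : Fin n → ZMod 2} {X Y : Fin n → L} {i j : Fin n}

namespace IsChevalley

theorem string_coroot_apply (hc : IsChevalley A p X Y) (hij : i ≠ j) (hi : p i = 0) (m : ℕ)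
    (hm : 1 ≤ m) {w : L} {x y : ℂ} (hx : (X j ⋄ Y j) ⋄ w = x • w)
    (hy : (X i ⋄ Y i) ⋄ w = y • w) :
    (rootString (Y i) (Y j) m ⋄ rootString (X i) (X j) m) ⋄ w
      = (-koszul (p j) (p j) * stringCoeff (A i i) (A i j) (m - 1)
          * (A i j * x + m * A j i * y)) • w := by
  rw [hc.string_coroot hij hi m hm]
  simp only [map_smul, map_add, LinearMap.smul_apply, LinearMap.add_apply, hx, hy, smul_smul,
    ← add_smul]

/-- If the string vanished, `a_ij h_j + m a_ji h_i` would annihilate every `X r`. For `a_ji ≠ 0`,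
testing on `X i` contradicts the hypothesis at `s = 2m`; for `a_ji = 0`, row `j` would be zero. -/
theorem string_ne_zero (hc : IsChevalley A p X Y) (hX : ∀ i, X i ≠ 0) (hij : i ≠ j)
    (hi : p i = 0) (hs : ∀ s : ℕ, 1 ≤ s → A i j + A i i * s / 2 ≠ 0)
    (hne : A i j ≠ 0 ∨ A j i ≠ 0) (hrow : ∃ k, A j k ≠ 0) (m : ℕ) (hm : 1 ≤ m) :
    rootString (X i) (X j) m ≠ 0 := by
  intro h0
  have h1 : ∀ r, A i j * A j r + m * A j i * A i r = 0 := by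
    intro r
    have := hc.string_coroot_apply hij hi m hm (hc.H_X j r) (hc.H_X i r)
    rw [h0, map_zero, map_zero, LinearMap.zero_apply, eq_comm] at this
    refine (mul_eq_zero.1 ((smul_eq_zero.1 this).resolve_right (hX r))).resolve_left ?_
    exact mul_ne_zero (neg_ne_zero.2 (koszul_ne_zero _ _)) (stringCoeff_ne_zero hs _)
  by_cases hμ : A j i = 0
  · obtain ⟨k, hk⟩ := hrow
    have := h1 k
    rw [hμ, mul_zero, zero_mul, add_zero] at this
    have hl := hne.resolve_right (not_not.2 hμ)
    exact (mul_ne_zero hl hk) this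
  · have h2 := hs (2 * m) (by omega)
    have h3 : A j i * (A i j + A i i * (2 * m : ℕ) / 2) = 0 := by
      rw [← h1 i]
      push_cast
      ring
    exact (mul_ne_zero hμ h2) h3

theorem string_Y_bracket_X (hc : IsChevalley A p X Y) {k : Fin n} (hi : p i = 0) (hik : i ≠ k)
    (hjk : j ≠ k) (m : ℕ) : rootString (Y i) (Y j) m ⋄ X k = 0 := by
  have hY : Y i ∈ part 0 := hi ▸ hc.Y_mem i
  induction m with
  | zero => exact hc.Y_X _ _ hjk
  | succ m ih =>
    have := jac_even hY (rootString (Y i) (Y j) m) (X k)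
    rw [ih, hc.Y_X _ _ hik, map_zero, map_zero, add_zero] at this
    rw [rootString_succ, ← this]

/-- The strings `e_{2t}`, `f_{2t}` serve as the family in `not_polyGrowth_of_family`. If `a_ji =
a_jj = 0`, their coroots kill every string, so `v` must be some other generator; otherwise `v` is
itself a string. -/
theorem not_polyGrowth_of_even (hc : IsChevalley A p X Y) (hX : ∀ i, X i ≠ 0) (hij : i ≠ j)
    (hi : p i = 0) (hs : ∀ s : ℕ, 1 ≤ s → A i j + A i i * s / 2 ≠ 0)
    (hne : A i j ≠ 0 ∨ A j i ≠ 0) (hrow : ∃ k, A j k ≠ 0) :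
    ¬ PolyGrowth (Set.range X ∪ Set.range Y) := by
  have hX0 : X i ∈ part 0 := hi ▸ hc.X_mem i
  have hY0 : Y i ∈ part 0 := hi ▸ hc.Y_mem i
  have hw : ∀ T t : ℕ, Word (Set.range X ∪ Set.range Y) ((2 * T + 3) * (t + 1))
      (rootString (X i) (X j) (2 * (t + 1 + T))) := fun T t =>
    (rootString_word (Set.mem_union_left _ (Set.mem_range_self i)) (Set.mem_union_left _ (Set.mem_range_self j)) _).mono (by nlinarith)
  have hE : ∀ m, rootString (X i) (X j) m ∈ part (p j) := rootString_mem hX0 (hc.X_mem j)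
  have hF : ∀ m, rootString (Y i) (Y j) m ∈ part (p j) := rootString_mem hY0 (hc.Y_mem j)
  have hκ : ∀ m, -koszul (p j) (p j) * stringCoeff (A i i) (A i j) m ≠ 0 := fun m =>
    mul_ne_zero (neg_ne_zero.2 (koszul_ne_zero _ _)) (stringCoeff_ne_zero hs _)
  have hb := fun (m : ℕ) (hm : 1 ≤ m) (l : ℕ) =>
    hc.string_coroot_apply hij hi m hm (hc.H_string (i := i) (j := j) j l) (hc.H_string i l)
  by_cases h : A j i = 0 ∧ A j j = 0
  · obtain ⟨hμ, hd⟩ := h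
    have hl := hne.resolve_right (not_not.2 hμ)
    obtain ⟨k, hk⟩ := hrow
    have hjk : j ≠ k := fun h => hk (h ▸ hd)
    have hik : i ≠ k := fun h => hk (h ▸ hμ)
    -- All coroots are multiples of `h_j` and act by zero on the strings. Only the action on `X k`,
    -- nonzero because `a_jk ≠ 0`, contributes to the scalars.
    refine not_polyGrowth_of_family (K := 2 * 0 + 3)
      (E := fun t => rootString (X i) (X j) (2 * (t + 1 + 0)))
      (F := fun t => rootString (Y i) (Y j) (2 * (t + 1 + 0))) (v := X k)
      (fun t => hE _) (fun t => hF _)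
      (fun s t hst => hc.string_bracket_even_index hij hi _ _ (by omega))
      (fun s => hc.string_Y_bracket_X hi hik hjk _)
      (fun s t => hb _ (by omega) _)
      (fun s => hc.string_coroot_apply hij hi _ (by omega) (hc.H_X j k) (hc.H_X i k)) ?_ (hX k)
      (hw 0) (.gen (Set.mem_union_left _ (Set.mem_range_self k)))
    intro s S _
    simp [hμ, hd, hl, hk, stringCoeff_ne_zero hs, koszul_ne_zero]
  · have hnv : (A j i ≠ 0 ∧ (A i j ≠ 0 ∨ A i i ≠ 0)) ∨ (A j i = 0 ∧ A i j ≠ 0 ∧ A j j ≠ 0) := by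
      by_cases hμ : A j i = 0
      · exact .inr ⟨hμ, hne.resolve_right (not_not.2 hμ), fun hd => h ⟨hμ, hd⟩⟩
      · refine .inl ⟨hμ, ?_⟩
        by_contra! h0
        exact hs 1 le_rfl (by simp [h0.1, h0.2])
    obtain ⟨T, hT⟩ := exists_nonvanishing _ _ _ _ hnv
    -- Starting beyond `T` makes every string index, including that of `v`, at least `T`, which
    -- yields both bounds needed in `exists_nonvanishing`.
    refine not_polyGrowth_of_family (K := 2 * (T + 1) + 3)
      (E := fun t => rootString (X i) (X j) (2 * (t + 1 + (T + 1))))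
      (F := fun t => rootString (Y i) (Y j) (2 * (t + 1 + (T + 1))))
      (v := rootString (X i) (X j) (2 * (T + 1)))
      (fun t => hE _) (fun t => hF _)
      (fun s t hst => hc.string_bracket_even_index hij hi _ _ (by omega))
      (fun s => hc.string_bracket_even_index hij hi _ _ (by omega))
      (fun s t => hb _ (by omega) _) (fun s => hb _ (by omega) _) ?_
      (hc.string_ne_zero hX hij hi hs hne hrow _ (by omega))
      (hw (T + 1)) (rootString_word (Set.mem_union_left _ (Set.mem_range_self i)) (Set.mem_union_left _ (Set.mem_range_self j)) _)
    intro s S _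
    rw [← Finset.mul_sum, ← mul_add]
    refine mul_ne_zero (hκ _) ?_
    have hσ : (S.card + 1) * T ≤ 2 * (T + 1) + ∑ t ∈ S, 2 * (t + 1 + (T + 1)) := by
      have : S.card * T ≤ ∑ t ∈ S, 2 * (t + 1 + (T + 1)) := by
        rw [← smul_eq_mul]
        exact Finset.card_nsmul_le_sum _ _ _ fun t _ => by omega
      nlinarith
    have := hT (2 * (s + 1 + (T + 1))) (S.card + 1) _ (by omega) (by omega) hσ
    convert this using 1
    have e : ∀ l : ℕ, A i j * (A j j + l * A j i)
          + (2 * (s + 1 + (T + 1)) : ℕ) * A j i * (A i j + l * A i i)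
        = (A i j * A j j + A i j * A j i * (2 * (s + 1 + (T + 1)) : ℕ))
          + A j i * (A i j + A i i * (2 * (s + 1 + (T + 1)) : ℕ)) * l := fun l => by ring
    have key : ∀ (x y : ℂ) (f : ℕ → ℕ) (l : ℕ), x + y * l + ∑ t ∈ S, (x + y * f t)
        = (S.card + 1 : ℕ) * x + y * (l + ∑ t ∈ S, f t : ℕ) := fun x y f l => by
      rw [Finset.sum_add_distrib, Finset.sum_const, ← Finset.mul_sum, nsmul_eq_mul]
      push_cast
      ring
    simp only [e]
    exact key _ _ (fun t => 2 * (t + 1 + (T + 1))) _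

/-! ### Reduction of odd non-isotropic simple roots to even ones -/

/-- The rescaling factors of the Cartan matrix when `αᵢ` is replaced by `2αᵢ`. -/
def doubledMatrix (A : Matrix (Fin n) (Fin n) ℂ) (i : Fin n) : Matrix (Fin n) (Fin n) ℂ :=
  Matrix.of fun r s => (if r = i then 1 / 2 else 1) * A r s * (if s = i then 2 else 1)

theorem bracket_bracket_self {x y : L} (hx : x ∈ part 1) :
    (x ⋄ x) ⋄ y = (2 : ℂ) • x ⋄ x ⋄ y := by
  have := jac hx hx y
  rw [koszul_one_one, neg_one_smul, ← sub_eq_add_neg, eq_sub_iff_add_eq] at this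
  rw [two_smul, this]

theorem bracket_self_Y (hc : IsChevalley A p X Y) (hi : p i = 1) :
    X i ⋄ Y i ⋄ Y i = -((2 * A i i) • Y i) := by
  rw [jac (hc.X_mem i) (hc.Y_mem i), hc.Y_H, hc.H_Y, hi, koszul_one_one]
  module

/-- Since `[[X_i, X_i], [Y_i, Y_i]] = -4 a_ii h_i`, the factor `-1 / (8 a_ii)` makes the coroot of
`2α_i` equal to `h_i / 2`. The diagonal entry is thereby preserved. -/
theorem double (hc : IsChevalley A p X Y) (hi : p i = 1) (ha : A i i ≠ 0) :
    IsChevalley (doubledMatrix A i) (Function.update p i 0) (Function.update X i (X i ⋄ X i))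
      (Function.update Y i ((-(1 / (8 * A i i))) • Y i ⋄ Y i)) := by
  have hX : X i ∈ part 1 := hi ▸ hc.X_mem i
  have hY : Y i ∈ part 1 := hi ▸ hc.Y_mem i
  have hEF : (X i ⋄ X i) ⋄ Y i ⋄ Y i = (-4 * A i i) • X i ⋄ Y i := by
    rw [bracket_bracket_self hX, hc.bracket_self_Y hi]
    simp only [map_neg, map_smul]
    module
  have hH : ∀ r, Function.update X i (X i ⋄ X i) r ⋄
      Function.update Y i ((-(1 / (8 * A i i))) • Y i ⋄ Y i) r
      = (if r = i then (1 / 2 : ℂ) else 1) • X r ⋄ Y r := by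
    intro r
    by_cases hr : r = i
    · subst hr
      simp only [Function.update_self, map_smul, hEF, if_true, smul_smul]
      congr 1
      field_simp
      norm_num
    · simp [hr]
  refine ⟨fun r => ?_, fun r => ?_, fun r s hrs => ?_, fun r s => ?_, fun r s => ?_⟩
  · by_cases hr : r = i
    · subst hr
      simpa [hi, zmod_two_add_self] using bracket_mem _ _ _ _ hX hX
    · simpa [hr] using hc.X_mem r
  · by_cases hr : r = i
    · subst hr
      rw [Function.update_self, Function.update_self]
      refine Submodule.smul_mem _ _ ?_
      simpa [zmod_two_add_self] using bracket_mem _ _ _ _ hY hY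
    · simpa [hr] using hc.Y_mem r
  · by_cases hr : r = i
    · subst hr
      simp [hrs.symm, bracket_bracket_self hX, hc.X_Y r s hrs]
    · by_cases hs : s = i
      · subst hs
        simp [hr, jac (hc.X_mem r) hY, hc.X_Y r s hrs]
      · simp [hr, hs, hc.X_Y r s hrs]
  · rw [hH, map_smul, LinearMap.smul_apply]
    have h : (X r ⋄ Y r) ⋄ Function.update X i (X i ⋄ X i) s
        = (A r s * if s = i then 2 else 1) • Function.update X i (X i ⋄ X i) s := by
      by_cases hs : s = i
      · subst hs
        simp only [Function.update_self, jac_even (hc.H_mem r), hc.H_X, if_true, map_smul,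
          LinearMap.smul_apply]
        module
      · simp [hs, hc.H_X]
    rw [h, smul_smul, doubledMatrix, Matrix.of_apply, mul_assoc]
  · rw [hH, map_smul, LinearMap.smul_apply]
    have h : (X r ⋄ Y r) ⋄ Function.update Y i ((-(1 / (8 * A i i))) • Y i ⋄ Y i) s
        = -((A r s * if s = i then 2 else 1) •
          Function.update Y i ((-(1 / (8 * A i i))) • Y i ⋄ Y i) s) := by
      by_cases hs : s = i
      · subst hs
        simp only [Function.update_self, map_smul, jac_even (hc.H_mem r), hc.H_Y, if_true,
          map_neg, LinearMap.neg_apply, LinearMap.smul_apply]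
        module
      · simp [hs, hc.H_Y]
    rw [h, smul_neg, smul_smul, doubledMatrix, Matrix.of_apply, mul_assoc]

/-- Reduces to the even case for `2α_i`. Doubling halves `a_ij` but keeps `a_ii`, so the excluded
zeros become `a_ij = -s a_ii`. The square `[X_i, X_i]` is nonzero because otherwise `h_i = 0`,
against `[h_i, X_i] = a_ii X_i ≠ 0`. -/
theorem not_polyGrowth_of_odd (hc : IsChevalley A p X Y) (hX : ∀ i, X i ≠ 0) (hij : i ≠ j)
    (hi : p i = 1) (ha : A i i ≠ 0) (hs : ∀ s : ℕ, 1 ≤ s → A i j + A i i * s ≠ 0)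
    (hne : A i j ≠ 0 ∨ A j i ≠ 0) (hrow : ∃ k, A j k ≠ 0) :
    ¬ PolyGrowth (Set.range X ∪ Set.range Y) := by
  have hc' := hc.double hi ha
  intro hP
  have hX' : ∀ r, Function.update X i (X i ⋄ X i) r ≠ 0 := by
    intro r
    by_cases hr : r = i
    · subst hr
      rw [Function.update_self]
      intro h0
      have h := hc'.H_X r r
      have h2 := hc'.H_X r j
      rw [Function.update_self, h0, map_zero, LinearMap.zero_apply, map_zero,
        LinearMap.zero_apply] at h2
      have h3 : X r ⋄ Y r = 0 := by
        have h4 : (X r ⋄ X r) ⋄ Y r ⋄ Y r = (-4 * A r r) • X r ⋄ Y r := by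
          rw [bracket_bracket_self (hi ▸ hc.X_mem r), hc.bracket_self_Y hi]
          simp only [map_neg, map_smul]
          module
        rw [h0, map_zero, LinearMap.zero_apply, eq_comm] at h4
        exact (smul_eq_zero.1 h4).resolve_left (mul_ne_zero (by norm_num) ha)
      have h5 := hc.H_X r r
      rw [h3, map_zero, LinearMap.zero_apply, eq_comm] at h5
      exact (smul_ne_zero ha (hX r)) h5
    · simpa [hr] using hX r
  refine hc'.not_polyGrowth_of_even hX' hij (by simp) ?_ ?_ ?_ (hP.of_word (k := 2) ?_)
  · intro s h1 h0
    refine hs s h1 ?_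
    simp only [doubledMatrix, Matrix.of_apply, if_true, if_neg hij.symm] at h0
    linear_combination 2 * h0
  · refine hne.imp (fun h => ?_) (fun h => ?_)
    · simpa [doubledMatrix, hij.symm] using h
    · simpa [doubledMatrix, hij.symm] using h
  · obtain ⟨k, hk⟩ := hrow
    refine ⟨k, ?_⟩
    by_cases hki : k = i <;> simp [doubledMatrix, hij.symm, hk, hki]
    exact hki ▸ hk
  · rintro _ (⟨r, rfl⟩ | ⟨r, rfl⟩)
    · by_cases hr : r = i
      · subst hr
        rw [Function.update_self]
        exact (Word.gen (Set.mem_union_left _ (Set.mem_range_self r))).mul (Word.gen (Set.mem_union_left _ (Set.mem_range_self r)))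
      · rw [Function.update_of_ne hr]
        exact (Word.gen (Set.mem_union_left _ (Set.mem_range_self r))).mono (by norm_num)
    · by_cases hr : r = i
      · subst hr
        rw [Function.update_self]
        exact ((Word.gen (Set.mem_union_right _ (Set.mem_range_self r))).mul (Word.gen (Set.mem_union_right _ (Set.mem_range_self r)))).smul _
      · rw [Function.update_of_ne hr]
        exact (Word.gen (Set.mem_union_right _ (Set.mem_range_self r))).mono (by norm_num)

/-! ### Polynomial growth implies the integrability conditions -/

/-- After rows with `a_ii ≠ 0` are scaled to have diagonal entry 2, a failure of any of the
conditions 2, 3, 4 supplies a pair `i, j` to which the even or the odd string criterion applies. -/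
theorem integrabilityConditions (hc : IsChevalley A p X Y) (hX : ∀ i, X i ≠ 0)
    (hrows : NoZeroRows A) (hP : PolyGrowth (Set.range X ∪ Set.range Y)) :
    IntegrabilityConditionsUpToRescaling A p := by
  classical
  refine ⟨fun i => if A i i = 0 then 1 else 2 / A i i, fun i => ?_, ?_⟩
  · by_cases h : A i i = 0 <;> simp [h]
  have hB : ∀ i j, (Matrix.diagonal (fun i => if A i i = 0 then 1 else 2 / A i i) * A) i j
      = (if A i i = 0 then 1 else 2 / A i i) * A i j := fun i j => by
    rw [Matrix.diagonal_mul]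
  have hd : ∀ i, (if A i i = 0 then (1 : ℂ) else 2 / A i i) ≠ 0 := fun i => by
    by_cases h : A i i = 0 <;> simp [h]
  have hdiag : ∀ i, (if A i i = 0 then (1 : ℂ) else 2 / A i i) * A i i = 2 → A i i ≠ 0 := by
    intro i h h0
    simp [h0] at h
  refine ⟨fun i => ?_, fun i h => ?_, fun i h j hji => ?_, fun i j h1 h2 => ?_⟩
  · rw [hB]
    by_cases h : A i i = 0 <;> simp [h]
  · rw [hB, mul_eq_zero] at h
    have ha := h.resolve_left (hd i)
    refine (zmod_two_eq (p i)).resolve_left fun hi => ?_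
    obtain ⟨j, hj⟩ := hrows i
    have hij : i ≠ j := fun e => hj (e ▸ ha)
    -- With `a_ii = 0` every string factor equals `a_ij ≠ 0`.
    exact hc.not_polyGrowth_of_even hX hij hi (by simp [ha, hj]) (.inl hj) (hrows j) hP
  · rw [hB] at h ⊢
    have ha := hdiag i h
    rw [if_neg ha]
    rcases zmod_two_eq (p i) with hi | hi
    · by_contra! hcon
      have hs : ∀ s : ℕ, A i j + A i i * s / 2 ≠ 0 := by
        intro s h0
        refine hcon (-s) (by simp) ?_
        rw [hi]
        push_cast
        field_simp
        simp only [ZMod.val_zero, pow_zero]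
        linear_combination 2 * h0
      refine hc.not_polyGrowth_of_even hX hji.symm hi (fun s _ => hs s) (.inl ?_) (hrows j) hP
      simpa using hs 0
    · by_contra! hcon
      have hs : ∀ s : ℕ, A i j + A i i * s ≠ 0 := by
        intro s h0
        refine hcon (-s) (by simp) ?_
        rw [hi]
        push_cast
        field_simp
        simp only [ZMod.val_one, pow_one]
        linear_combination 2 * h0
      refine hc.not_polyGrowth_of_odd hX hji.symm hi ha (fun s _ => hs s) (.inl ?_) (hrows j) hP
      simpa using hs 0
  · rw [hB, mul_eq_zero] at h1 ⊢
    rw [hB] at h2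
    have h1' := h1.resolve_left (hd i)
    have h2' := right_ne_zero_of_mul h2
    right
    by_contra ha
    have hij : i ≠ j := fun e => h2' (e ▸ h1')
    rcases zmod_two_eq (p i) with hi | hi
    -- With `a_ij = 0` the factors are `s a_ii / 2`, nonzero exactly because only `s ≥ 1` is
    -- required.
    · refine hc.not_polyGrowth_of_even hX hij hi (fun s hs => ?_) (.inr h2') (hrows j) hP
      have : (s : ℂ) ≠ 0 := by exact_mod_cast (by omega : s ≠ 0)
      simp [h1', ha, this]
    · refine hc.not_polyGrowth_of_odd hX hij hi ha (fun s hs => ?_) (.inr h2') (hrows j) hP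
      have : (s : ℂ) ≠ 0 := by exact_mod_cast (by omega : s ≠ 0)
      simp [h1', ha, this]

end IsChevalley

end Growth

/-! ### Subquotients of Lie superalgebras -/

section Subquotient

universe u

variable {L : Type u} [AddCommGroup L] [Module ℂ L] [LieSuperalgebra L]

theorem part_unique {a b a' b' : L} (ha : a ∈ part (L := L) 0) (hb : b ∈ part (L := L) 1)
    (ha' : a' ∈ part (L := L) 0) (hb' : b' ∈ part (L := L) 1) (h : a + b = a' + b') :
    a = a' ∧ b = b' := by
  have h0 : a - a' = b' - b := by
    rw [sub_eq_sub_iff_add_eq_add, h, add_comm]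
  have h1 : a - a' = 0 := (Submodule.disjoint_def.1 (isCompl_part (L := L)).disjoint) _
    (sub_mem ha ha') (h0 ▸ sub_mem hb' hb)
  have h2 : b' - b = 0 := h0 ▸ h1
  exact ⟨sub_eq_zero.1 h1, (sub_eq_zero.1 h2).symm⟩

/-- A submodule compatible with the decomposition into even and odd parts. -/
def IsGraded (P : Submodule ℂ L) : Prop := P ≤ (P ⊓ part 0) ⊔ (P ⊓ part 1)

theorem IsGraded.exists_add {P : Submodule ℂ L} (hP : IsGraded P) {x : L} (hx : x ∈ P) :
    ∃ a ∈ P, ∃ b ∈ P, a ∈ part (L := L) 0 ∧ b ∈ part (L := L) 1 ∧ a + b = x := by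
  obtain ⟨a, ha, b, hb, e⟩ := Submodule.mem_sup.1 (hP hx)
  exact ⟨a, ha.1, b, hb.1, ha.2, hb.2, e⟩

theorem isGraded_span {s : Set L} (hs : ∀ x ∈ s, ∃ i, x ∈ part (L := L) i) :
    IsGraded (Submodule.span ℂ s) := by
  refine Submodule.span_le.2 fun x hx => ?_
  obtain ⟨i, hi⟩ := hs x hx
  have hx' := Submodule.subset_span (R := ℂ) hx
  rcases zmod_two_eq i with rfl | rfl
  · exact Submodule.mem_sup_left ⟨hx', hi⟩
  · exact Submodule.mem_sup_right ⟨hx', hi⟩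

theorem IsGraded.sSup {s : Set (Submodule ℂ L)} (hs : ∀ P ∈ s, IsGraded P) :
    IsGraded (sSup s) :=
  sSup_le fun I hI => (hs I hI).trans
    (sup_le_sup (inf_le_inf_right _ (le_sSup hI)) (inf_le_inf_right _ (le_sSup hI)))

/-- The Lie superalgebra structure on a graded subalgebra. -/
@[reducible] def subLieSuperalgebra (M : Submodule ℂ L) (hM : IsGraded M)
    (hmul : ∀ x ∈ M, ∀ y ∈ M, x ⋄ y ∈ M) : LieSuperalgebra M where
  bracket := LinearMap.mk₂ ℂ (fun x y => ⟨(x : L) ⋄ (y : L), hmul _ x.2 _ y.2⟩)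
    (fun x y z => Subtype.ext (by simp)) (fun c x y => Subtype.ext (by simp))
    (fun x y z => Subtype.ext (by simp)) (fun c x y => Subtype.ext (by simp))
  part i := (part i).comap M.subtype
  isCompl_part := by
    constructor
    · rw [Submodule.disjoint_def]
      intro x h0 h1
      exact Subtype.ext ((Submodule.disjoint_def.1 (isCompl_part (L := L)).disjoint) x h0 h1)
    · rw [codisjoint_iff, eq_top_iff]
      rintro ⟨x, hx⟩ -
      obtain ⟨a, ha, b, hb, ha0, hb1, rfl⟩ := hM.exists_add hx
      exact Submodule.mem_sup.2 ⟨⟨a, ha⟩, ha0, ⟨b, hb⟩, hb1, rfl⟩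
  bracket_mem i j x y hx hy := bracket_mem i j (x : L) (y : L) hx hy
  skew i j x y hx hy := Subtype.ext (LieSuperalgebra.skew i j (x : L) (y : L) hx hy)
  jacobi i j k x y z hx hy hz :=
    Subtype.ext (LieSuperalgebra.jacobi i j k (x : L) (y : L) (z : L) hx hy hz)

/-- The quotient is `M / (M ∩ J)`; `J` need neither lie in `M` nor be an ideal of `L`. Stability
under left brackets by `M` suffices, since super skew-symmetry on homogeneous components supplies
the other side. -/
theorem exists_subquotient (M J : Submodule ℂ L) (hM : IsGraded M)
    (hmul : ∀ x ∈ M, ∀ y ∈ M, x ⋄ y ∈ M) (hJ : IsGraded J)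
    (hMJ : ∀ x ∈ M, ∀ y ∈ J, x ⋄ y ∈ J) :
    ∃ (L' : Type u) (_ : AddCommGroup L') (_ : Module ℂ L') (_ : LieSuperalgebra L')
      (f : M →ₗ[ℂ] L'), Function.Surjective f ∧ (∀ x : M, f x = 0 ↔ (x : L) ∈ J) ∧
      (∀ x y : M, f x ⋄ f y = f ⟨(x : L) ⋄ (y : L), hmul _ x.2 _ y.2⟩) ∧
      ∀ (i : ZMod 2) (x : M), (x : L) ∈ part i → f x ∈ part (L := L') i := by
  let _ := subLieSuperalgebra M hM hmul
  have hdec : ∀ x ∈ M, x ∈ J → ∃ a b : L, a ∈ M ∧ b ∈ M ∧ a ∈ J ∧ b ∈ J ∧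
      a ∈ part (L := L) 0 ∧ b ∈ part (L := L) 1 ∧ a + b = x := by
    intro x hx hxJ
    obtain ⟨a, ha, b, hb, ha0, hb1, rfl⟩ := hM.exists_add hx
    obtain ⟨a', ha', b', hb', ha0', hb1', e⟩ := hJ.exists_add hxJ
    obtain ⟨rfl, rfl⟩ := part_unique ha0 hb1 ha0' hb1' e.symm
    exact ⟨a, b, ha, hb, ha', hb', ha0, hb1, rfl⟩
  have hI : IsIdeal (J.comap M.subtype) := by
    refine ⟨fun x hx => ?_, fun x y hy => hMJ _ x.2 _ hy, fun x y hx => ?_⟩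
    · obtain ⟨x, hxM⟩ := x
      obtain ⟨a, b, ha, hb, haJ, hbJ, ha0, hb1, rfl⟩ := hdec x hxM hx
      exact Submodule.mem_sup.2 ⟨⟨a, ha⟩, ⟨haJ, ha0⟩, ⟨b, hb⟩, ⟨hbJ, hb1⟩, rfl⟩
    · change (x : L) ⋄ (y : L) ∈ J
      obtain ⟨a, b, ha, hb, haJ, hbJ, ha0, hb1, e⟩ := hdec x x.2 hx
      obtain ⟨c, hc, d, hd, hc0, hd1, e'⟩ := hM.exists_add y.2
      rw [← e, ← e']
      simp only [map_add, LinearMap.add_apply]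
      refine add_mem (add_mem ?_ ?_) (add_mem ?_ ?_)
      · rw [skew ha0 hc0]
        exact neg_mem (Submodule.smul_mem _ _ (hMJ _ hc _ haJ))
      · rw [skew hb1 hc0]
        exact neg_mem (Submodule.smul_mem _ _ (hMJ _ hc _ hbJ))
      · rw [skew ha0 hd1]
        exact neg_mem (Submodule.smul_mem _ _ (hMJ _ hd _ haJ))
      · rw [skew hb1 hd1]
        exact neg_mem (Submodule.smul_mem _ _ (hMJ _ hd _ hbJ))
  refine ⟨M ⧸ J.comap M.subtype, inferInstance, inferInstance, quotientLieSuperalgebra _ hI,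
    (J.comap M.subtype).mkQ, Submodule.mkQ_surjective _, fun x => ?_, fun x y => rfl,
    fun i x hx => ⟨x, hx, rfl⟩⟩
  rw [Submodule.mkQ_apply, Submodule.Quotient.mk_eq_zero]
  rfl

end Subquotient

/-! ### Graded systems of Chevalley generators -/

section Graded

universe u w

variable {L : Type u} [AddCommGroup L] [Module ℂ L] [LieSuperalgebra L] {n : ℕ}
  {Γ : Type w} [AddCommGroup Γ]

/-- Chevalley generators of polynomial growth which are homogeneous for a grading by a group `Γ`,
the degrees `z` of the `X i` being linearly independent. -/
structure IsGradedChevalley (A : Matrix (Fin n) (Fin n) ℂ) (p : Fin n → ZMod 2)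
    (X Y : Fin n → L) (W : Γ → Submodule ℂ L) (z : Fin n → Γ) : Prop
    extends IsChevalley A p X Y where
  X_ne : ∀ i, X i ≠ 0
  polyGrowth : PolyGrowth (Set.range X ∪ Set.range Y)
  bracket_W : ∀ a b x y, x ∈ W a → y ∈ W b → x ⋄ y ∈ W (a + b)
  X_W : ∀ i, X i ∈ W (z i)
  Y_W : ∀ i, Y i ∈ W (-z i)
  disjoint_W : Disjoint (W 0) (⨆ (g) (_ : g ≠ 0), W g)
  linearIndependent : LinearIndependent ℤ z

/-- A graded submodule stable under all `X i` and `Y i` and contained in the sum of the components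
of nonzero degree. -/
structure IsNull (X Y : Fin n → L) (W : Γ → Submodule ℂ L) (P : Submodule ℂ L) : Prop where
  graded : IsGraded P
  le : P ≤ ⨆ (g) (_ : g ≠ 0), W g
  X_mem : ∀ i, ∀ x ∈ P, X i ⋄ x ∈ P
  Y_mem : ∀ i, ∀ x ∈ P, Y i ⋄ x ∈ P

/-- The largest null submodule. -/
def nullRadical (X Y : Fin n → L) (W : Γ → Submodule ℂ L) : Submodule ℂ L :=
  sSup {P | IsNull X Y W P}

theorem isNull_nullRadical (X Y : Fin n → L) (W : Γ → Submodule ℂ L) :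
    IsNull X Y W (nullRadical X Y W) where
  graded := IsGraded.sSup fun _ hP => hP.graded
  le := sSup_le fun _ hP => hP.le
  X_mem i := by
    have : nullRadical X Y W ≤ (nullRadical X Y W).comap (bracket (X i)) :=
      sSup_le fun P hP x hx => (le_sSup hP : P ≤ nullRadical X Y W) (hP.X_mem i x hx)
    exact fun x hx => this hx
  Y_mem i := by
    have : nullRadical X Y W ≤ (nullRadical X Y W).comap (bracket (Y i)) :=
      sSup_le fun P hP x hx => (le_sSup hP : P ≤ nullRadical X Y W) (hP.Y_mem i x hx)
    exact fun x hx => this hx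

/-- The elements obtained from `x` by repeated brackets with the `X i`. -/
inductive Orbit (X : Fin n → L) (x : L) : L → Prop
  | base : Orbit X x x
  | step (i : Fin n) {y : L} (hy : Orbit X x y) : Orbit X x (X i ⋄ y)

variable {A : Matrix (Fin n) (Fin n) ℂ} {p : Fin n → ZMod 2} {X Y : Fin n → L}
  {W : Γ → Submodule ℂ L} {z : Fin n → Γ}

/-- A lowest weight vector argument: if all `Y i` kill `x` and all `h_i` scale it, commuting `Y j`
past the `X i` shows that the span of the `X`-orbit is already stable under the `Y j`. Its degrees
lie in `γ + ∑ ℕ z_i`, which avoids 0. -/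
theorem IsChevalley.isNull_orbit (hc : IsChevalley A p X Y)
    (hW : ∀ a b x y, x ∈ W a → y ∈ W b → x ⋄ y ∈ W (a + b)) (hX : ∀ i, X i ∈ W (z i))
    {x : L} {r : ZMod 2} {γ : Γ} (hx : x ∈ part r) (hxW : x ∈ W γ)
    (hγ : ∀ c : Fin n → ℕ, γ + ∑ i, c i • z i ≠ 0) (hY : ∀ i, Y i ⋄ x = 0)
    (hH : ∀ i, ∃ t : ℂ, (X i ⋄ Y i) ⋄ x = t • x) :
    IsNull X Y W (Submodule.span ℂ {y | Orbit X x y}) := by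
  have hpart : ∀ y, Orbit X x y → ∃ s, y ∈ part (L := L) s := by
    intro y hy
    induction hy with
    | base => exact ⟨r, hx⟩
    | step i _ ih =>
      obtain ⟨s, hs⟩ := ih
      exact ⟨_, bracket_mem _ _ _ _ (hc.X_mem i) hs⟩
  have hwt : ∀ y, Orbit X x y → ∃ c : Fin n → ℕ, y ∈ W (γ + ∑ i, c i • z i) := by
    intro y hy
    induction hy with
    | base => exact ⟨0, by simpa using hxW⟩
    | step i _ ih =>
      obtain ⟨c, hc⟩ := ih
      refine ⟨c + Pi.single i 1, ?_⟩
      convert hW _ _ _ _ (hX i) hc using 2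
      simp only [Pi.add_apply, add_smul, Finset.sum_add_distrib]
      rw [Fintype.sum_eq_single (a := i) (f := fun j => (Pi.single i 1 : Fin n → ℕ) j • z j)
        (fun j hj => by simp [hj])]
      simp only [Pi.single_eq_same, one_smul]
      abel
  have hHy : ∀ y, Orbit X x y → ∀ j, ∃ t : ℂ, (X j ⋄ Y j) ⋄ y = t • y := by
    intro y hy j
    induction hy with
    | base => exact hH j
    | step i _ ih =>
      obtain ⟨t, ht⟩ := ih
      refine ⟨A j i + t, ?_⟩
      rw [jac_even (hc.H_mem j), hc.H_X, ht, map_smul, map_smul, LinearMap.smul_apply, add_smul]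
  have hYy : ∀ y, Orbit X x y → ∀ j, Y j ⋄ y ∈ Submodule.span ℂ {y | Orbit X x y} := by
    intro y hy j
    induction hy with
    | base => rw [hY]; exact zero_mem _
    | step i hy ih =>
      rw [jac (hc.Y_mem j) (hc.X_mem i)]
      refine add_mem ?_ (Submodule.smul_mem _ _ ?_)
      · by_cases hij : j = i
        · subst hij
          obtain ⟨t, ht⟩ := hHy _ hy j
          rw [hc.Y_X_same, map_neg, map_smul, LinearMap.neg_apply, LinearMap.smul_apply, ht]
          exact neg_mem (Submodule.smul_mem _ _ (Submodule.smul_mem _ _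
            (Submodule.subset_span hy)))
        · rw [hc.Y_X j i hij, map_zero, LinearMap.zero_apply]
          exact zero_mem _
      · have : Submodule.span ℂ {y | Orbit X x y} ≤
            (Submodule.span ℂ {y | Orbit X x y}).comap (bracket (X i)) :=
          Submodule.span_le.2 fun y hy => Submodule.subset_span (Orbit.step i hy)
        exact this ih
  refine ⟨isGraded_span hpart, Submodule.span_le.2 fun y hy => ?_, fun i => ?_, fun i => ?_⟩
  · obtain ⟨c, hc⟩ := hwt y hy
    exact Submodule.mem_iSup_of_mem _ (Submodule.mem_iSup_of_mem (hγ c) hc)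
  · exact (Submodule.span_le.2 fun y hy => Submodule.subset_span (Orbit.step i hy) :
      Submodule.span ℂ {y | Orbit X x y} ≤
        (Submodule.span ℂ {y | Orbit X x y}).comap (bracket (X i)))
  · exact (Submodule.span_le.2 fun y hy => hYy y hy i :
      Submodule.span ℂ {y | Orbit X x y} ≤
        (Submodule.span ℂ {y | Orbit X x y}).comap (bracket (Y i)))

/-- By independence the coefficient of `z j` could be compared with 0, and it is at least 1. -/
theorem degree_sum_ne_zero (hz : LinearIndependent ℤ z) (j k : Fin n) (c : Fin n → ℕ) :
    z j + z k + ∑ i, c i • z i ≠ 0 := by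
  intro h
  have h1 := Fintype.linearIndependent_iff.1 hz
    (fun i => (c i : ℤ) + (Pi.single j 1 : Fin n → ℤ) i + (Pi.single k 1 : Fin n → ℤ) i) (by
      simp only [add_smul, Finset.sum_add_distrib]
      rw [Fintype.sum_eq_single (a := j) (f := fun i => (Pi.single j 1 : Fin n → ℤ) i • z i)
        (fun i hi => by simp [hi]),
        Fintype.sum_eq_single (a := k) (f := fun i => (Pi.single k 1 : Fin n → ℤ) i • z i)
        (fun i hi => by simp [hi])]
      simp only [Pi.single_eq_same, one_smul, natCast_zsmul]
      rw [← h]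
      abel) j
  simp only [Pi.single_eq_same] at h1
  have h2 : (0 : ℤ) ≤ (Pi.single k 1 : Fin n → ℤ) j := by
    by_cases hjk : j = k <;> simp [hjk]
  omega

/-- When both entries vanish, `[X j, X k]` is killed by every `Y r`, hence generates a null
submodule. The case `j = k` is included and handles `[X_k, X_k]` for isotropic `α_k`. -/
theorem IsChevalley.X_X_mem_nullRadical (hc : IsChevalley A p X Y)
    (hW : ∀ a b x y, x ∈ W a → y ∈ W b → x ⋄ y ∈ W (a + b)) (hX : ∀ i, X i ∈ W (z i))
    (hz : LinearIndependent ℤ z) (j k : Fin n) (hjk : A j k = 0) (hkj : A k j = 0) :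
    ∃ P, IsNull X Y W P ∧ X j ⋄ X k ∈ P := by
  refine ⟨_, hc.isNull_orbit hW hX (bracket_mem _ _ _ _ (hc.X_mem j) (hc.X_mem k))
    (hW _ _ _ _ (hX j) (hX k)) (degree_sum_ne_zero hz j k) (fun r => ?_) (fun r => ?_),
    Submodule.subset_span Orbit.base⟩
  · have h1 : (Y r ⋄ X j) ⋄ X k = 0 := by
      by_cases h : r = j
      · subst h
        simp [hc.Y_X_same, hc.H_X, hjk]
      · simp [hc.Y_X r j h]
    have h2 : X j ⋄ Y r ⋄ X k = 0 := by
      by_cases h : r = k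
      · subst h
        simp [hc.Y_X_same, hc.X_H, hkj]
      · simp [hc.Y_X r k h]
    rw [jac (hc.Y_mem r) (hc.X_mem j), h1, h2, smul_zero, add_zero]
  · refine ⟨A r j + A r k, ?_⟩
    rw [jac_even (hc.H_mem r), hc.H_X, hc.H_X, map_smul, map_smul, LinearMap.smul_apply, add_smul]

theorem IsGradedChevalley.H_ne (hc : IsGradedChevalley A p X Y W z) (hA : NoZeroRows A)
    (i : Fin n) : X i ⋄ Y i ≠ 0 := by
  intro h
  obtain ⟨j, hj⟩ := hA i
  have := hc.H_X i j
  rw [h, map_zero, LinearMap.zero_apply, eq_comm] at this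
  exact (smul_ne_zero hj (hc.X_ne j)) this

theorem Word.mem_part (hc : IsChevalley A p X Y) {l : ℕ} {x : L}
    (hx : Word (Set.range X ∪ Set.range Y) l x) : ∃ i, x ∈ part (L := L) i := by
  induction hx with
  | gen hx =>
    rcases hx with ⟨i, rfl⟩ | ⟨i, rfl⟩
    · exact ⟨_, hc.X_mem i⟩
    · exact ⟨_, hc.Y_mem i⟩
  | mul _ _ h1 h2 =>
    obtain ⟨i, hi⟩ := h1
    obtain ⟨j, hj⟩ := h2
    exact ⟨_, bracket_mem _ _ _ _ hi hj⟩
  | smul c _ h =>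
    obtain ⟨i, hi⟩ := h
    exact ⟨i, Submodule.smul_mem _ c hi⟩
  | mono _ _ h => exact h

theorem Word.bracket_mem_of_isNull (hc : IsChevalley A p X Y) {P : Submodule ℂ L}
    (hP : IsNull X Y W P) {l : ℕ} {x : L} (hx : Word (Set.range X ∪ Set.range Y) l x) :
    ∀ y ∈ P, x ⋄ y ∈ P := by
  induction hx with
  | gen hx =>
    rcases hx with ⟨i, rfl⟩ | ⟨i, rfl⟩
    · exact hP.X_mem i
    · exact hP.Y_mem i
  | @mul _ _ a b ha hb h1 h2 =>
    intro y hy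
    obtain ⟨i, hi⟩ := ha.mem_part hc
    obtain ⟨j, hj⟩ := hb.mem_part hc
    rw [eq_sub_of_add_eq (jac hi hj y).symm]
    exact sub_mem (h1 _ (h2 _ hy)) (Submodule.smul_mem _ _ (h2 _ (h1 _ hy)))
  | smul c _ h =>
    intro y hy
    rw [map_smul, LinearMap.smul_apply]
    exact Submodule.smul_mem _ _ (h y hy)
  | mono _ _ h => exact h

/-- The span of all words. -/
def wordSpan (S : Set L) : Submodule ℂ L := Submodule.span ℂ {x | ∃ l, Word S l x}

theorem bracket_mem_wordSpan (S : Set L) (x : L) (hx : x ∈ wordSpan S) (y : L)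
    (hy : y ∈ wordSpan S) : x ⋄ y ∈ wordSpan S := by
  induction hx using Submodule.span_induction with
  | zero => simp
  | add a b _ _ ha hb => simpa using add_mem ha hb
  | smul c a _ ha => simpa using Submodule.smul_mem _ c ha
  | mem x hx =>
    obtain ⟨a, ha⟩ := hx
    have : wordSpan S ≤ (wordSpan S).comap (bracket x) :=
      Submodule.span_le.2 fun y ⟨b, hb⟩ => Submodule.subset_span ⟨_, ha.mul hb⟩
    exact this hy

theorem Word.mem_wordSpan {S : Set L} {l : ℕ} {x : L} (hx : Word S l x) : x ∈ wordSpan S :=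
  Submodule.subset_span ⟨l, hx⟩

/-- Words lift along `f` without change of length, and lifts of independent vectors are independent.
-/
theorem PolyGrowth.of_surjective {L' : Type u} [AddCommGroup L'] [Module ℂ L'] [LieSuperalgebra L']
    {S : Set L} {T : Set L'} {f : wordSpan S →ₗ[ℂ] L'}
    (hf : ∀ x y : wordSpan S,
      f x ⋄ f y = f ⟨(x : L) ⋄ (y : L), bracket_mem_wordSpan S _ x.2 _ y.2⟩)
    (hT : ∀ y ∈ T, ∃ (x : L) (hx : Word S 1 x), f ⟨x, hx.mem_wordSpan⟩ = y)
    (hS : PolyGrowth S) : PolyGrowth T := by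
  obtain ⟨C, d, h⟩ := hS
  refine ⟨C, d, fun m k v hv hw => ?_⟩
  have hlift : ∀ (l : ℕ) (y : L'), Word T l y →
      ∃ (x : L) (hx : Word S l x), f ⟨x, hx.mem_wordSpan⟩ = y := by
    intro l y hy
    induction hy with
    | gen hy => exact hT _ hy
    | mul _ _ h1 h2 =>
      obtain ⟨x, hx, rfl⟩ := h1
      obtain ⟨y, hy, rfl⟩ := h2
      exact ⟨_, hx.mul hy, (hf ⟨x, hx.mem_wordSpan⟩ ⟨y, hy.mem_wordSpan⟩).symm⟩
    | smul c _ h =>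
      obtain ⟨x, hx, rfl⟩ := h
      exact ⟨_, hx.smul c, (map_smul f c ⟨x, hx.mem_wordSpan⟩)⟩
    | mono hab _ h =>
      obtain ⟨x, hx, rfl⟩ := h
      exact ⟨_, hx.mono hab, rfl⟩
  choose x hx hfx using fun i => hlift m (v i) (hw i)
  refine h m k x ?_ hx
  have h1 : LinearIndependent ℂ (fun i => (⟨x i, (hx i).mem_wordSpan⟩ : wordSpan S)) := by
    refine LinearIndependent.of_comp f ?_
    convert hv using 1
    exact funext hfx
  exact h1.map' (wordSpan S).subtype (Submodule.ker_subtype _)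

/-- Passing to the subalgebra generated by the `X i` and `Y i` and dividing out the null radical,
one may assume that `[X j, X k] = 0` and `[Y j, Y k] = 0` whenever `A j k = A k j = 0`. -/
theorem IsGradedChevalley.exists_reduced (hc : IsGradedChevalley A p X Y W z) (hA : NoZeroRows A) :
    ∃ (L' : Type u) (_ : AddCommGroup L') (_ : Module ℂ L') (_ : LieSuperalgebra L')
      (X' Y' : Fin n → L') (W' : Γ → Submodule ℂ L'), IsGradedChevalley A p X' Y' W' z ∧
      (∀ j k, A j k = 0 → A k j = 0 → X' j ⋄ X' k = 0) ∧
      ∀ j k, A j k = 0 → A k j = 0 → Y' j ⋄ Y' k = 0 := by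
  set S := Set.range X ∪ Set.range Y with hS
  have hch := hc.toIsChevalley
  have hJ := isNull_nullRadical X Y W
  have hXw : ∀ i, Word S 1 (X i) := fun i => .gen (Set.mem_union_left _ (Set.mem_range_self i))
  have hYw : ∀ i, Word S 1 (Y i) := fun i => .gen (Set.mem_union_right _ (Set.mem_range_self i))
  obtain ⟨L', i1, i2, i3, f, -, hker, hf, hpart⟩ := exists_subquotient (wordSpan S)
    (nullRadical X Y W) (isGraded_span fun x ⟨l, hx⟩ => hx.mem_part hch)
    (bracket_mem_wordSpan S) hJ.graded (fun x hx y hy => by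
      have : wordSpan S ≤ (nullRadical X Y W).comap (bracket.flip y) :=
        Submodule.span_le.2 fun x ⟨l, hx⟩ => hx.bracket_mem_of_isNull hch hJ y hy
      exact this hx)
  have hXX : ∀ j k, A j k = 0 → A k j = 0 → X j ⋄ X k ∈ nullRadical X Y W := by
    intro j k h1 h2
    obtain ⟨P, hP, hx⟩ := hch.X_X_mem_nullRadical hc.bracket_W hc.X_W hc.linearIndependent j k h1 h2
    exact (le_sSup hP : P ≤ nullRadical X Y W) hx
  have hYY : ∀ j k, A j k = 0 → A k j = 0 → Y j ⋄ Y k ∈ nullRadical X Y W := by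
    intro j k h1 h2
    -- The statement for the `Y`'s is the one for the `X`'s after the Chevalley involution, which
    -- negates degrees.
    have hz : LinearIndependent ℤ (fun i => -z i) := by
      exact hc.linearIndependent.map' (-LinearMap.id) (by ext x; simp)
    obtain ⟨P, hP, hx⟩ := hch.swap.X_X_mem_nullRadical hc.bracket_W hc.Y_W hz j k h1 h2
    refine (le_sSup ?_ : P ≤ nullRadical X Y W) hx
    refine ⟨hP.graded, hP.le, fun i x hx => ?_, hP.X_mem⟩
    have := hP.Y_mem i x hx
    rw [map_smul, LinearMap.smul_apply] at this
    exact (Submodule.smul_mem_iff _ (koszul_ne_zero _ _)).1 this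
  refine ⟨L', i1, i2, i3, fun i => f ⟨X i, (hXw i).mem_wordSpan⟩,
    fun i => f ⟨Y i, (hYw i).mem_wordSpan⟩,
    fun g => ((W g).comap (wordSpan S).subtype).map f, ?_, ?_, ?_⟩
  · refine { X_mem := fun i => hpart _ _ (hc.X_mem i), Y_mem := fun i => hpart _ _ (hc.Y_mem i),
             X_Y := fun i j hij => ?_, H_X := fun i j => ?_, H_Y := fun i j => ?_,
             X_ne := fun i h => ?_, polyGrowth := ?_, bracket_W := ?_,
             X_W := fun i => ⟨_, hc.X_W i, rfl⟩, Y_W := fun i => ⟨_, hc.Y_W i, rfl⟩,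
             disjoint_W := ?_, linearIndependent := hc.linearIndependent }
    · rw [hf, ← map_zero f]
      exact congrArg f (Subtype.ext (hc.X_Y i j hij))
    · rw [hf, hf, ← map_smul]
      exact congrArg f (Subtype.ext (hc.H_X i j))
    · rw [hf, hf, ← map_smul, ← map_neg]
      exact congrArg f (Subtype.ext (hc.H_Y i j))
    -- If `X i` died, `[Y i, X i]` would lie in the null radical, hence in the nonzero degrees,
    -- while having degree 0. It would vanish, contradicting `h_i ≠ 0`.
    · have h1 := hJ.le (hJ.Y_mem i _ ((hker _).1 h))
      rw [hc.Y_X_same] at h1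
      have h2 : -(koszul (p i) (p i) • X i ⋄ Y i) ∈ W 0 := by
        refine neg_mem (Submodule.smul_mem _ _ ?_)
        simpa using hc.bracket_W _ _ _ _ (hc.X_W i) (hc.Y_W i)
      have h3 := Submodule.disjoint_def.1 hc.disjoint_W _ h2 h1
      rw [neg_eq_zero] at h3
      exact smul_ne_zero (koszul_ne_zero _ _) (hc.H_ne hA i) h3
    · refine PolyGrowth.of_surjective hf ?_ hc.polyGrowth
      rintro _ (⟨i, rfl⟩ | ⟨i, rfl⟩)
      · exact ⟨_, hXw i, rfl⟩
      · exact ⟨_, hYw i, rfl⟩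
    · rintro a b _ _ ⟨x, hx, rfl⟩ ⟨y, hy, rfl⟩
      exact ⟨_, hc.bracket_W a b _ _ hx hy, (hf _ _).symm⟩
    -- The kernel lies in the nonzero degrees, so adding it to a lift does not affect disjointness
    -- from degree 0.
    · rw [Submodule.disjoint_def]
      rintro _ ⟨x, hx, rfl⟩ h
      have h1 : (⨆ (g) (_ : g ≠ 0), ((W g).comap (wordSpan S).subtype).map f)
          ≤ ((⨆ (g) (_ : g ≠ 0), W g).comap (wordSpan S).subtype).map f :=
        iSup₂_le fun g hg => Submodule.map_mono (Submodule.comap_mono (le_iSup₂_of_le g hg le_rfl))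
      obtain ⟨y, hy, e⟩ := h1 h
      have h2 : f (x - y) = 0 := by rw [map_sub, e, sub_self]
      have h3 := add_mem (hJ.le ((hker _).1 h2)) hy
      have h4 : (x : L) ∈ ⨆ (g) (_ : g ≠ 0), W g := by simpa using h3
      have h5 := Submodule.disjoint_def.1 hc.disjoint_W _ hx h4
      rw [show x = 0 from Subtype.ext h5, map_zero]
  · intro j k h1 h2
    rw [hf]
    exact (hker _).2 (hXX j k h1 h2)
  · intro j k h1 h2
    rw [hf]
    exact (hker _).2 (hYY j k h1 h2)

end Graded

/-! ### Odd reflections of Chevalley generators -/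

section Reflection

universe u w

variable {L : Type u} [AddCommGroup L] [Module ℂ L] [LieSuperalgebra L] {n : ℕ}
  {Γ : Type w} [AddCommGroup Γ] {A : Matrix (Fin n) (Fin n) ℂ} {p : Fin n → ZMod 2}
  {X Y : Fin n → L} {W : Γ → Submodule ℂ L} {z : Fin n → Γ}

theorem NoZeroRows.diagonal_mul (hA : NoZeroRows A) {d : Fin n → ℂ} (hd : ∀ i, d i ≠ 0) :
    NoZeroRows (Matrix.diagonal d * A) := fun i => by
  obtain ⟨j, hj⟩ := hA i
  exact ⟨j, by rw [Matrix.diagonal_mul]; exact mul_ne_zero (hd i) hj⟩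

theorem IsGradedChevalley.rescale (hc : IsGradedChevalley A p X Y W z) (d : Fin n → ℂ) :
    IsGradedChevalley (Matrix.diagonal d * A) p X (fun i => d i • Y i) W z where
  X_mem := hc.X_mem
  Y_mem i := Submodule.smul_mem _ _ (hc.Y_mem i)
  X_Y i j hij := by rw [map_smul, hc.X_Y i j hij, smul_zero]
  H_X i j := by
    rw [map_smul, map_smul, LinearMap.smul_apply, hc.H_X, smul_smul, Matrix.diagonal_mul]
  H_Y i j := by
    simp only [map_smul, LinearMap.smul_apply, hc.H_Y, Matrix.diagonal_mul]
    module
  X_ne := hc.X_ne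
  polyGrowth := hc.polyGrowth.of_word (k := 1) (by
    rintro _ (⟨i, rfl⟩ | ⟨i, rfl⟩)
    · exact .gen (Set.mem_union_left _ (Set.mem_range_self i))
    · exact .smul _ (.gen (Set.mem_union_right _ (Set.mem_range_self i))))
  bracket_W := hc.bracket_W
  X_W := hc.X_W
  Y_W i := Submodule.smul_mem _ _ (hc.Y_W i)
  disjoint_W := hc.disjoint_W
  linearIndependent := hc.linearIndependent

theorem oddReflection_apply (A : Matrix (Fin n) (Fin n) ℂ) (p : Fin n → ZMod 2) (k i j : Fin n) :
    oddReflection A p k i j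
      = ∑ r, reflectedCoroot A p k i r * ∑ s, A r s * reflectedRoot A k j s := by
  simp only [oddReflection, Matrix.of_apply, Finset.mul_sum, mul_assoc]

theorem sum_mul_reflectedRoot (A : Matrix (Fin n) (Fin n) ℂ) (k j : Fin n) (v : Fin n → ℂ) :
    ∑ s, v s * reflectedRoot A k j s
      = open Classical in if j = k then -v k else if Linked A k j then v j + v k else v j := by
  unfold reflectedRoot
  split_ifs <;> simp [Pi.single_apply, mul_add, Finset.sum_add_distrib]

/-- The reflected roots recover all `α_s`, so a zero row means that every `α_s` kills `h'_i`. In the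
linked case, evaluation at `α_k` gives `a_ki a_ik = 0`, because `a_kk = 0`. So `h'_i` is a nonzero
multiple of `h_k` or `h_i`, whose row is nonzero. -/
theorem NoZeroRows.oddReflection (hA : NoZeroRows A) (p : Fin n → ZMod 2) (k : Fin n)
    (hk : A k k = 0) : NoZeroRows (oddReflection A p k) := by
  classical
  intro i
  by_contra! h
  have h1 : ∀ j, ∑ s, (∑ r, reflectedCoroot A p k i r * A r s) * reflectedRoot A k j s = 0 := by
    intro j
    rw [← h j, oddReflection_apply]
    simp only [Finset.sum_mul, Finset.mul_sum, mul_assoc]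
    exact Finset.sum_comm
  have hvk : ∑ r, reflectedCoroot A p k i r * A r k = 0 := by
    have := h1 k
    rw [sum_mul_reflectedRoot, if_pos rfl] at this
    exact neg_eq_zero.1 this
  have hv : ∀ s, ∑ r, reflectedCoroot A p k i r * A r s = 0 := by
    intro s
    have := h1 s
    rw [sum_mul_reflectedRoot, hvk] at this
    by_cases hsk : s = k
    · rw [hsk, hvk]
    · rw [if_neg hsk, add_zero, ite_self] at this
      exact this
  by_cases hik : i = k
  · obtain ⟨j, hj⟩ := hA k
    have := hv j
    simp [reflectedCoroot, hik, Pi.single_apply] at this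
    exact hj this
  · by_cases hl : Linked A k i
    · have h2 : ∀ s, A i k * A k s + A k i * A i s = 0 := by
        intro s
        have := hv s
        simp only [reflectedCoroot, hik, hl, if_false, if_true, Pi.smul_apply, Pi.add_apply,
          smul_eq_mul, mul_assoc, ← Finset.mul_sum] at this
        have h3 := (mul_eq_zero.1 this).resolve_left (by simp)
        simpa [Pi.single_apply, add_mul, Finset.sum_add_distrib] using h3
      have h3 : A k i * A i k = 0 := by simpa [hk] using h2 k
      rcases mul_eq_zero.1 h3 with h4 | h4
      · have h5 := hl.2.resolve_right (not_not.2 h4)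
        obtain ⟨j, hj⟩ := hA k
        have := h2 j
        rw [h4, zero_mul, add_zero] at this
        exact mul_ne_zero h5 hj this
      · have h5 := hl.2.resolve_left (not_not.2 h4)
        obtain ⟨j, hj⟩ := hA i
        have := h2 j
        rw [h4, zero_mul, zero_add] at this
        exact mul_ne_zero h5 hj this
    · obtain ⟨j, hj⟩ := hA i
      have := hv j
      simp [reflectedCoroot, hik, hl, Pi.single_apply] at this
      exact hj this

open Classical in
/-- The generators `X'_i`, respectively `Y'_i`, of the odd reflection at `α_k`. -/
def reflectedGen (A : Matrix (Fin n) (Fin n) ℂ) (k : Fin n) (X Y : Fin n → L) (i : Fin n) : L :=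
  if i = k then Y k else if Linked A k i then X i ⋄ X k else X i

open Classical in
/-- The degrees of the reflected generators. -/
def reflectedDegree (A : Matrix (Fin n) (Fin n) ℂ) (k : Fin n) (z : Fin n → Γ) (i : Fin n) : Γ :=
  if i = k then -z k else if Linked A k i then z i + z k else z i

/-- Every reflected degree is `z_i + c_i z_k` with `c_k = -2`. A relation thus first kills the
coefficients with `i ≠ k`, and then leaves `-g_k = 0`. -/
theorem linearIndependent_reflectedDegree (hz : LinearIndependent ℤ z) (k : Fin n) :
    LinearIndependent ℤ (reflectedDegree A k z) := by
  classical
  set c : Fin n → ℤ := fun i => if i = k then -2 else if Linked A k i then 1 else 0 with hc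
  have e : ∀ i, reflectedDegree A k z i = z i + c i • z k := by
    intro i
    by_cases hik : i = k
    · subst hik
      simp only [reflectedDegree, hc, if_true]
      module
    · by_cases hl : Linked A k i <;> simp [reflectedDegree, hc, hik, hl]
  rw [Fintype.linearIndependent_iff] at hz ⊢
  intro g hg
  have h1 := hz (fun i => g i + (Pi.single k (∑ j, g j * c j) : Fin n → ℤ) i) (by
    rw [← hg]
    simp only [e, smul_add, add_smul, Finset.sum_add_distrib, smul_smul, ← Finset.sum_smul]
    congr 1
    rw [Fintype.sum_eq_single k fun i hi => by simp [hi], Pi.single_eq_same])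
  have h2 : ∀ i, i ≠ k → g i = 0 := fun i hi => by simpa [hi] using h1 i
  have h3 : g k = 0 := by
    have := h1 k
    simp only [Pi.single_eq_same] at this
    rw [Fintype.sum_eq_single k fun i hi => by simp [h2 i hi]] at this
    simp [hc] at this
    omega
  intro i
  by_cases hi : i = k
  · rw [hi, h3]
  · exact h2 i hi

/-- For odd `x`, `(ad x)² = ad [x, x] / 2`. -/
theorem bracket_sq_zero {x u : L} {r : ZMod 2} (hx : x ∈ part 1) (h : x ⋄ x = 0)
    (hu : u ∈ part r) : x ⋄ u ⋄ x = 0 ∧ (u ⋄ x) ⋄ x = 0 := by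
  have h1 : x ⋄ x ⋄ u = 0 := by
    have := IsChevalley.bracket_bracket_self (y := u) hx
    rw [h, map_zero, LinearMap.zero_apply, eq_comm] at this
    exact (smul_eq_zero.1 this).resolve_left two_ne_zero
  have h2 : x ⋄ u ⋄ x = 0 := by
    rw [skew hu hx, map_neg, map_smul, h1, smul_zero, neg_zero]
  exact ⟨h2, by rw [skew (bracket_mem _ _ _ _ hu hx) hx, h2, smul_zero, neg_zero]⟩

namespace IsChevalley

variable {k : Fin n}

theorem H_reflectedGen (hc : IsChevalley A p X Y) (r j : Fin n) :
    (X r ⋄ Y r) ⋄ reflectedGen A k X Y j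
      = (∑ s, A r s * reflectedRoot A k j s) • reflectedGen A k X Y j := by
  rw [sum_mul_reflectedRoot]
  unfold reflectedGen
  split_ifs
  · rw [hc.H_Y, neg_smul]
  · rw [jac_even (hc.H_mem r), hc.H_X, hc.H_X, map_smul, map_smul, LinearMap.smul_apply, add_smul]
  · rw [hc.H_X]

theorem H_reflectedGen' (hc : IsChevalley A p X Y) (r j : Fin n) :
    (X r ⋄ Y r) ⋄ reflectedGen A k Y X j
      = -((∑ s, A r s * reflectedRoot A k j s) • reflectedGen A k Y X j) := by
  rw [sum_mul_reflectedRoot]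
  unfold reflectedGen
  split_ifs
  · rw [hc.H_X, neg_smul, neg_neg]
  · rw [jac_even (hc.H_mem r), hc.H_Y, hc.H_Y, map_neg, map_neg, map_smul, map_smul,
      LinearMap.neg_apply, LinearMap.smul_apply, add_smul, neg_add]
  · rw [hc.H_Y]

theorem Y_bracket_X_X (hc : IsChevalley A p X Y) {i : Fin n} (hik : i ≠ k) :
    Y k ⋄ X i ⋄ X k = (koszul (p k) (p i) * koszul (p k) (p k) * A k i) • X i ∧
    Y i ⋄ X i ⋄ X k = (koszul (p i) (p i) * -A i k) • X k := by
  constructor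
  · rw [jac (hc.Y_mem k) (hc.X_mem i), hc.Y_X k i hik.symm, hc.Y_X_same, map_zero,
      LinearMap.zero_apply, zero_add, map_neg, map_smul, hc.X_H]
    module
  · rw [jac (hc.Y_mem i) (hc.X_mem i), hc.Y_X i k hik, map_zero, smul_zero, add_zero,
      hc.Y_X_same, map_neg, map_smul, LinearMap.neg_apply, LinearMap.smul_apply, hc.H_X]
    module

/-- This computation is the source of the formula for `h'_i`, including the sign `(-1)^{p(i)}`. -/
theorem bracket_linked (hc : IsChevalley A p X Y) {i : Fin n} (hik : i ≠ k) (hk : p k = 1) :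
    (X i ⋄ X k) ⋄ Y i ⋄ Y k
      = (-1 : ℂ) ^ (p i).val • (A i k • X k ⋄ Y k + A k i • X i ⋄ Y i) := by
  have hX := bracket_mem _ _ _ _ (hc.X_mem i) (hc.X_mem k)
  obtain ⟨h1, h2⟩ := hc.Y_bracket_X_X hik
  have e1 := jac (hc.Y_mem i) (hc.Y_mem k) (X i ⋄ X k)
  rw [h1, h2] at e1
  rw [skew hX (bracket_mem _ _ _ _ (hc.Y_mem i) (hc.Y_mem k)), eq_sub_of_add_eq e1.symm]
  simp only [map_smul, hc.Y_X_same, hk]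
  rcases zmod_two_eq (p i) with hi | hi
  · simp only [hi, koszul_zero_left, koszul_zero_right, koszul_one_one, zero_add, ZMod.val_zero]
    module
  · simp only [hi, koszul_one_one, zmod_two_add_self, koszul_zero_left, ZMod.val_one]
    module

theorem bracket_reflectedGen (hc : IsChevalley A p X Y) (hk : p k = 1) (i : Fin n) :
    reflectedGen A k X Y i ⋄ reflectedGen A k Y X i
      = ∑ r, reflectedCoroot A p k i r • X r ⋄ Y r := by
  unfold reflectedGen reflectedCoroot
  split_ifs with hik hl
  · rw [hc.Y_X_same, hk, koszul_one_one, neg_one_smul, neg_neg]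
    simp [Pi.single_apply, ite_smul]
  · rw [hc.bracket_linked hik hk]
    simp [Pi.single_apply, add_smul, mul_smul, smul_add, ite_smul, Finset.sum_add_distrib]
  · simp [Pi.single_apply, ite_smul]

/-- The only place where reducedness is used. When `i` or `j` equals `k`, two `X`'s or two `Y`'s are
bracketed: an unlinked pair vanishes by assumption, a linked one because `[X_k, X_k] = [Y_k, Y_k] =
0`. The remaining cases follow from `[Y_j, X_i] = 0` and the Jacobi identity. -/
theorem bracket_reflectedGen_ne (hc : IsChevalley A p X Y) (hk : p k = 1) (hkk : A k k = 0)
    (hXX : ∀ j k, A j k = 0 → A k j = 0 → X j ⋄ X k = 0)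
    (hYY : ∀ j k, A j k = 0 → A k j = 0 → Y j ⋄ Y k = 0) (i j : Fin n) (hij : i ≠ j) :
    reflectedGen A k X Y i ⋄ reflectedGen A k Y X j = 0 := by
  have hun : ∀ i, i ≠ k → ¬ Linked A k i → A i k = 0 ∧ A k i = 0 := fun i hi hl => by
    by_contra h
    exact hl ⟨hi, by tauto⟩
  unfold reflectedGen
  by_cases hik : i = k
  · subst hik
    rw [if_pos rfl, if_neg hij.symm]
    split_ifs with hl
    · exact (bracket_sq_zero (hk ▸ hc.Y_mem i) (hYY i i hkk hkk) (hc.Y_mem j)).1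
    · exact hYY i j (hun j hij.symm hl).2 (hun j hij.symm hl).1
  rw [if_neg hik]
  by_cases hjk : j = k
  · subst hjk
    rw [if_pos rfl]
    split_ifs with hl
    · exact (bracket_sq_zero (hk ▸ hc.X_mem j) (hXX j j hkk hkk) (hc.X_mem i)).2
    · exact hXX i j (hun i hij hl).1 (hun i hij hl).2
  rw [if_neg hjk]
  have h1 : Y j ⋄ X i ⋄ X k = 0 := by
    rw [jac (hc.Y_mem j) (hc.X_mem i), hc.Y_X j i hij.symm, hc.Y_X j k hjk, map_zero, map_zero,
      LinearMap.zero_apply, smul_zero, add_zero]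
  have hX := bracket_mem _ _ _ _ (hc.X_mem i) (hc.X_mem k)
  split_ifs with hi hj hj
  · rw [skew hX (bracket_mem _ _ _ _ (hc.Y_mem j) (hc.Y_mem k)),
      eq_sub_of_add_eq (jac (hc.Y_mem j) (hc.Y_mem k) (X i ⋄ X k)).symm,
      (hc.Y_bracket_X_X hik).1, h1, map_smul, hc.Y_X j i hij.symm]
    simp
  · rw [skew hX (hc.Y_mem j), h1, smul_zero, neg_zero]
  · rw [jac (hc.X_mem i) (hc.Y_mem j), hc.X_Y i j hij, hc.X_Y i k hik, map_zero, map_zero,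
      LinearMap.zero_apply, smul_zero, add_zero]
  · exact hc.X_Y i j hij

theorem reflectedGen_mem {q : Fin n → ZMod 2} (hX : ∀ i, X i ∈ part (q i))
    (hY : ∀ i, Y i ∈ part (q i)) (i : Fin n) :
    reflectedGen A k X Y i ∈ part (reflectedParity A q k i) := by
  unfold reflectedGen reflectedParity
  by_cases hik : i = k
  · subst hik
    rw [if_pos rfl, if_neg fun h => h.1 rfl]
    exact hY i
  · rw [if_neg hik]
    split_ifs
    · exact bracket_mem _ _ _ _ (hX i) (hX k)
    · exact hX i

theorem reflectedGen_word {S : Set L} (hX : ∀ i, X i ∈ S) (hY : ∀ i, Y i ∈ S) (i : Fin n) :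
    Word S 2 (reflectedGen A k X Y i) := by
  unfold reflectedGen
  split_ifs
  · exact (Word.gen (hY k)).mono one_le_two
  · exact (Word.gen (hX i)).mul (Word.gen (hX k))
  · exact (Word.gen (hX i)).mono one_le_two

end IsChevalley

theorem IsGradedChevalley.reflect (hc : IsGradedChevalley A p X Y W z) (hA : NoZeroRows A)
    (hXX : ∀ j k, A j k = 0 → A k j = 0 → X j ⋄ X k = 0)
    (hYY : ∀ j k, A j k = 0 → A k j = 0 → Y j ⋄ Y k = 0) (k : Fin n) (hkk : A k k = 0)
    (hk : p k = 1) :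
    IsGradedChevalley (oddReflection A p k) (reflectedParity A p k) (reflectedGen A k X Y)
      (reflectedGen A k Y X) W (reflectedDegree A k z) where
  X_mem := IsChevalley.reflectedGen_mem hc.X_mem hc.Y_mem
  Y_mem := IsChevalley.reflectedGen_mem hc.Y_mem hc.X_mem
  X_Y := hc.bracket_reflectedGen_ne hk hkk hXX hYY
  H_X i j := by
    rw [hc.bracket_reflectedGen hk, oddReflection_apply, map_sum, LinearMap.sum_apply,
      Finset.sum_smul]
    refine Finset.sum_congr rfl fun r _ => ?_
    rw [map_smul, LinearMap.smul_apply, hc.H_reflectedGen, smul_smul]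
  H_Y i j := by
    rw [hc.bracket_reflectedGen hk, oddReflection_apply, map_sum, LinearMap.sum_apply,
      Finset.sum_smul, ← Finset.sum_neg_distrib]
    refine Finset.sum_congr rfl fun r _ => ?_
    rw [map_smul, LinearMap.smul_apply, hc.H_reflectedGen', smul_neg, smul_smul]
  X_ne i h := by
    unfold reflectedGen at h
    split_ifs at h with hik hl
    · exact hc.H_ne hA k (by rw [h, map_zero])
    -- `Y k` and `Y i` send `[X_i, X_k]` to multiples of `X i` and `X k` with coefficients `±a_ki`
    -- and `±a_ik`. Linkage makes one of them nonzero, so the singular case needs no separate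
    -- treatment.
    · obtain ⟨h1, h2⟩ := hc.Y_bracket_X_X hik
      rw [h, map_zero, eq_comm] at h1 h2
      have h3 := (smul_eq_zero.1 h1).resolve_right (hc.X_ne i)
      have h4 := (smul_eq_zero.1 h2).resolve_right (hc.X_ne k)
      simp only [mul_eq_zero, neg_eq_zero, koszul_ne_zero, false_or] at h3 h4
      exact hl.2.elim (fun h => h h4) (fun h => h h3)
    · exact hc.X_ne i h
  polyGrowth := hc.polyGrowth.of_word (k := 2) (by
    have hX : ∀ i, X i ∈ Set.range X ∪ Set.range Y := fun i =>
      Set.mem_union_left _ (Set.mem_range_self i)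
    have hY : ∀ i, Y i ∈ Set.range X ∪ Set.range Y := fun i =>
      Set.mem_union_right _ (Set.mem_range_self i)
    rintro _ (⟨i, rfl⟩ | ⟨i, rfl⟩)
    · exact IsChevalley.reflectedGen_word hX hY i
    · exact IsChevalley.reflectedGen_word hY hX i)
  bracket_W := hc.bracket_W
  X_W i := by
    unfold reflectedGen reflectedDegree
    split_ifs
    · exact hc.Y_W k
    · exact hc.bracket_W _ _ _ _ (hc.X_W i) (hc.X_W k)
    · exact hc.X_W i
  Y_W i := by
    unfold reflectedGen reflectedDegree
    split_ifs
    · rw [neg_neg]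
      exact hc.X_W k
    · rw [neg_add]
      exact hc.bracket_W _ _ _ _ (hc.Y_W i) (hc.Y_W k)
    · exact hc.Y_W i
  disjoint_W := hc.disjoint_W
  linearIndependent := linearIndependent_reflectedDegree hc.linearIndependent k

/-- The algebra is allowed to change along the sequence: each reflection can create new pairs with
`a_jk = a_kj = 0`, so the reduction is repeated before every reflection. -/
theorem IsGradedChevalley.exists_oddReflected (hc : IsGradedChevalley A p X Y W z)
    (hA : NoZeroRows A) {A' : Matrix (Fin n) (Fin n) ℂ} {p' : Fin n → ZMod 2}
    (h : OddReflected A p A' p') :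
    NoZeroRows A' ∧ ∃ (L' : Type u) (_ : AddCommGroup L') (_ : Module ℂ L')
      (_ : LieSuperalgebra L') (X' Y' : Fin n → L') (W' : Γ → Submodule ℂ L') (z' : Fin n → Γ),
      IsGradedChevalley A' p' X' Y' W' z' := by
  induction h with
  | refl => exact ⟨hA, L, _, _, _, X, Y, W, z, hc⟩
  | reflect _ k hkk hk ih =>
    obtain ⟨hB, L', _, _, _, X', Y', W', z', hc'⟩ := ih
    obtain ⟨L'', i1, i2, i3, X'', Y'', W'', hc'', hXX, hYY⟩ := hc'.exists_reduced hB
    exact ⟨hB.oddReflection _ k hkk, L'', i1, i2, i3, _, _, _, _,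
      hc''.reflect hB hXX hYY k hkk hk⟩
  | rescale _ d hd ih =>
    obtain ⟨hB, L', i1, i2, i3, X', Y', W', z', hc'⟩ := ih
    exact ⟨hB.diagonal_mul hd, L', i1, i2, i3, _, _, _, _, hc'.rescale d⟩

theorem IsGradedChevalley.isAdmissible (hc : IsGradedChevalley A p X Y W z)
    (hA : NoZeroRows A) : IsAdmissible A p := by
  intro A' p' h
  obtain ⟨hA', L', i1, i2, i3, X', Y', W', z', hc'⟩ := hc.exists_oddReflected hA h
  exact hc'.integrabilityConditions hc'.X_ne hA' hc'.polyGrowth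

end Reflection

/-! ### Representations of `𝔤̃(A)` -/

section Representation

variable {n : ℕ} {A : Matrix (Fin n) (Fin n) ℂ} {𝔥 : Type*} [AddCommGroup 𝔥] [Module ℂ 𝔥]
  (R : Realization A 𝔥) (p : Fin n → ZMod 2)

theorem koszul_add_right (i j k : ZMod 2) : koszul i (j + k) = koszul i j * koszul i k := by
  rcases zmod_two_eq i with rfl | rfl <;> rcases zmod_two_eq j with rfl | rfl <;>
    rcases zmod_two_eq k with rfl | rfl <;>
    simp [koszul_zero_left, koszul_zero_right, koszul_one_one, zmod_two_add_self]

theorem koszul_add_left (i j k : ZMod 2) : koszul (i + j) k = koszul i k * koszul j k := by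
  rw [koszul_comm, koszul_add_right, koszul_comm k, koszul_comm k]

variable {E : Type*} [Ring E] [Algebra ℂ E] (ρ : Gen n 𝔥 → E)

/-- The images `ρ g` of the generators in an associative algebra satisfy the relations of `𝔤̃(A)`
for supercommutators. -/
structure IsRep (ρ : Gen n 𝔥 → E) : Prop where
  H_add : ∀ h h', ρ (.H (h + h')) = ρ (.H h) + ρ (.H h')
  H_smul : ∀ (c : ℂ) h, ρ (.H (c • h)) = c • ρ (.H h)
  H_H : ∀ h h', ρ (.H h) * ρ (.H h') = ρ (.H h') * ρ (.H h)
  X_Y : ∀ i j, ρ (.X i) * ρ (.Y j) - koszul (p i) (p j) • (ρ (.Y j) * ρ (.X i))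
    = if i = j then ρ (.H (R.coroot i)) else 0
  H_X : ∀ h i, ρ (.H h) * ρ (.X i) - ρ (.X i) * ρ (.H h) = R.root i h • ρ (.X i)
  H_Y : ∀ h i, ρ (.H h) * ρ (.Y i) - ρ (.Y i) * ρ (.H h) = -(R.root i h • ρ (.Y i))

/-- The action of the words in the generators. -/
def wordRep : FreeMagma (Gen n 𝔥) → E
  | .of g => ρ g
  | .mul u v => wordRep u * wordRep v
      - koszul (wordParity p u) (wordParity p v) • (wordRep v * wordRep u)

/-- The linear extension of `wordRep`. -/
def freeRep : FreeAlg R p →ₗ[ℂ] E :=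
  Finsupp.linearCombination ℂ (wordRep p ρ) ∘ₗ
    (MonoidAlgebra.coeffLinearEquiv (S := ℂ) (M := FreeMagma (Gen n 𝔥)) ℂ).toLinearMap

theorem freeRep_word (w : FreeMagma (Gen n 𝔥)) :
    freeRep R p ρ (word R p w) = wordRep p ρ w := by
  change Finsupp.linearCombination ℂ (wordRep p ρ) (Finsupp.single w 1) = _
  simp

theorem freeRep_mul {i j : ZMod 2} {x y : FreeAlg R p} (hx : x ∈ wordPart R p i)
    (hy : y ∈ wordPart R p j) :
    freeRep R p ρ (x * y) = freeRep R p ρ x * freeRep R p ρ y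
      - koszul i j • (freeRep R p ρ y * freeRep R p ρ x) := by
  induction hx using Submodule.span_induction with
  | zero => simp
  | add a b _ _ ha hb =>
    simp only [add_mul, mul_add, map_add, ha, hb, smul_add]
    abel
  | smul c a _ ha =>
    simp only [smul_mul_assoc, mul_smul_comm, map_smul, ha, smul_sub, smul_comm c]
  | mem x hx =>
    obtain ⟨u, rfl, rfl⟩ := hx
    induction hy using Submodule.span_induction with
    | zero => simp
    | add a b _ _ ha hb =>
      simp only [add_mul, mul_add, map_add, ha, hb, smul_add]
      abel
    | smul c a _ ha =>
      simp only [smul_mul_assoc, mul_smul_comm, map_smul, ha, smul_sub, smul_comm c]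
    | mem y hy =>
      obtain ⟨v, rfl, rfl⟩ := hy
      rw [word_mul, freeRep_word, freeRep_word, freeRep_word, wordRep]

/-- The graded kernel of `freeRep`. -/
def repIdeal : Submodule ℂ (FreeAlg R p) :=
  (LinearMap.ker (freeRep R p ρ) ⊓ wordPart R p 0)
    ⊔ (LinearMap.ker (freeRep R p ρ) ⊓ wordPart R p 1)

theorem mem_repIdeal {i : ZMod 2} {x : FreeAlg R p} (hx : x ∈ wordPart R p i)
    (h : freeRep R p ρ x = 0) : x ∈ repIdeal R p ρ := by
  rcases zmod_two_eq i with rfl | rfl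
  · exact Submodule.mem_sup_left ⟨h, hx⟩
  · exact Submodule.mem_sup_right ⟨h, hx⟩

theorem exists_wordPart_add (x : FreeAlg R p) :
    ∃ a ∈ wordPart R p 0, ∃ b ∈ wordPart R p 1, a + b = x :=
  Submodule.mem_sup.1 ((isCompl_wordPart R p).sup_eq_top ▸ Submodule.mem_top (x := x))

theorem mul_mem_wordPart {i j : ZMod 2} {x y : FreeAlg R p} (hx : x ∈ wordPart R p i)
    (hy : y ∈ wordPart R p j) : x * y ∈ wordPart R p (i + j) :=
  bracket_mem (L := FreeAlg R p) i j x y hx hy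

/-- `E` carries no grading, so `freeRep` turns products into supercommutators only for homogeneous
arguments, and its full kernel need not be graded. Both factors are therefore split into parities
first. -/
theorem isIdeal_repIdeal : IsIdeal (repIdeal R p ρ) := by
  have hl : ∀ (i j : ZMod 2) (x y : FreeAlg R p), x ∈ wordPart R p i → y ∈ wordPart R p j →
      freeRep R p ρ y = 0 → x * y ∈ repIdeal R p ρ ∧ y * x ∈ repIdeal R p ρ :=
    fun i j x y hx hy h =>
    ⟨mem_repIdeal R p ρ (mul_mem_wordPart R p hx hy) (by rw [freeRep_mul R p ρ hx hy, h, mul_zero, zero_mul,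
        smul_zero, sub_zero]),
      mem_repIdeal R p ρ (mul_mem_wordPart R p hy hx) (by rw [freeRep_mul R p ρ hy hx, h, mul_zero, zero_mul,
        smul_zero, sub_zero])⟩
  refine ⟨sup_le ?_ ?_, fun x y hy => ?_, fun y x hy => ?_⟩
  · exact fun x hx => Submodule.mem_sup_left ⟨Submodule.mem_sup_left hx, hx.2⟩
  · exact fun x hx => Submodule.mem_sup_right ⟨Submodule.mem_sup_right hx, hx.2⟩
  · change x * y ∈ _
    obtain ⟨a, ha, b, hb, rfl⟩ := exists_wordPart_add R p x
    obtain ⟨c, hc, d, hd, rfl⟩ := Submodule.mem_sup.1 hy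
    rw [add_mul, mul_add, mul_add]
    exact add_mem (add_mem (hl _ _ _ _ ha hc.2 hc.1).1 (hl _ _ _ _ ha hd.2 hd.1).1)
      (add_mem (hl _ _ _ _ hb hc.2 hc.1).1 (hl _ _ _ _ hb hd.2 hd.1).1)
  · change y * x ∈ _
    obtain ⟨a, ha, b, hb, rfl⟩ := exists_wordPart_add R p x
    obtain ⟨c, hc, d, hd, rfl⟩ := Submodule.mem_sup.1 hy
    rw [add_mul, mul_add, mul_add]
    exact add_mem (add_mem (hl _ _ _ _ ha hc.2 hc.1).2 (hl _ _ _ _ hb hc.2 hc.1).2)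
      (add_mem (hl _ _ _ _ ha hd.2 hd.1).2 (hl _ _ _ _ hb hd.2 hd.1).2)

theorem word_mem (w : FreeMagma (Gen n 𝔥)) : word R p w ∈ wordPart R p (wordParity p w) :=
  Submodule.subset_span ⟨w, rfl, rfl⟩

theorem gen_mem (g : Gen n 𝔥) : gen R p g ∈ wordPart R p (genParity p g) :=
  word_mem R p (.of g)

theorem freeRep_gen (g : Gen n 𝔥) : freeRep R p ρ (gen R p g) = ρ g :=
  freeRep_word R p ρ (.of g)

/-- Supercommutators in an associative algebra satisfy skew-symmetry and Jacobi automatically; the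
other relators are the hypotheses on `ρ`. -/
theorem IsRelator.mem_repIdeal (hρ : IsRep R p ρ) {x : FreeAlg R p} (hx : IsRelator R p x) :
    x ∈ repIdeal R p ρ := by
  have hg := gen_mem R p
  have hH : ∀ h : 𝔥, gen R p (.H h) ∈ wordPart R p 0 := fun h => hg (.H h)
  have hX : ∀ i, gen R p (.X i) ∈ wordPart R p (p i) := fun i => hg (.X i)
  have hY : ∀ i, gen R p (.Y i) ∈ wordPart R p (p i) := fun i => hg (.Y i)
  have hm := @mul_mem_wordPart n A 𝔥 _ _ R p
  cases hx with
  | skew u v =>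
    have hu := word_mem R p u
    have hv := word_mem R p v
    refine Contragredient.mem_repIdeal R p ρ
      (add_mem (hm hu hv) (Submodule.smul_mem _ _ (add_comm (wordParity p u) _ ▸ hm hv hu))) ?_
    rw [map_add, map_smul, freeRep_mul R p ρ hu hv, freeRep_mul R p ρ hv hu, smul_sub,
      smul_smul, koszul_comm (wordParity p v), koszul_self_mul, one_smul]
    abel
  | jacobi u v w =>
    have hu := word_mem R p u
    have hv := word_mem R p v
    have hw := word_mem R p w
    refine Contragredient.mem_repIdeal R p ρ
      (i := wordParity p u + (wordParity p v + wordParity p w))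
      (sub_mem (sub_mem (hm hu (hm hv hw)) ?_) (Submodule.smul_mem _ _ ?_)) ?_
    · rw [← add_assoc]
      exact hm (hm hu hv) hw
    · rw [add_left_comm]
      exact hm hv (hm hu hw)
    · simp only [map_sub, map_smul, freeRep_mul R p ρ hu (hm hv hw),
        freeRep_mul R p ρ hv hw, freeRep_mul R p ρ (hm hu hv) hw, freeRep_mul R p ρ hu hv,
        freeRep_mul R p ρ hv (hm hu hw), freeRep_mul R p ρ hu hw, koszul_add_right,
        koszul_add_left, koszul_comm (wordParity p v) (wordParity p u), mul_sub, sub_mul, smul_sub,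
        smul_mul_assoc, mul_smul_comm, smul_smul, mul_assoc]
      have h1 := koszul_self_mul (wordParity p u) (wordParity p v)
      generalize koszul (wordParity p u) (wordParity p v) = a at *
      generalize koszul (wordParity p u) (wordParity p w) = b at *
      generalize koszul (wordParity p v) (wordParity p w) = c at *
      simp only [← mul_assoc a a, h1, one_mul]
      module
  | H_add h h' =>
    refine Contragredient.mem_repIdeal R p ρ (i := 0)
      (sub_mem (sub_mem (hH _) (hH _)) (hH _)) ?_
    simp only [map_sub, freeRep_gen, hρ.H_add]
    abel
  | H_smul c h =>
    refine Contragredient.mem_repIdeal R p ρ (i := 0)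
      (sub_mem (hH _) (Submodule.smul_mem _ _ (hH _))) ?_
    simp only [map_sub, map_smul, freeRep_gen, hρ.H_smul, sub_self]
  | H_H h h' =>
    refine Contragredient.mem_repIdeal R p ρ (hm (hH _) (hH _)) ?_
    rw [freeRep_mul R p ρ (hH _) (hH _)]
    simp only [freeRep_gen, koszul_zero_left, one_smul, hρ.H_H h h', sub_self]
  | X_Y_same i =>
    refine Contragredient.mem_repIdeal R p ρ (i := 0) (sub_mem ?_ (hH _)) ?_
    · simpa only [genParity, zmod_two_add_self] using hm (hX i) (hY i)
    · rw [map_sub, freeRep_mul R p ρ (hX _) (hY _)]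
      simp only [freeRep_gen, hρ.X_Y, if_true, sub_self]
  | X_Y_ne i j hij =>
    refine Contragredient.mem_repIdeal R p ρ (hm (hX _) (hY _)) ?_
    rw [freeRep_mul R p ρ (hX _) (hY _)]
    simp only [freeRep_gen, hρ.X_Y, if_neg hij]
  | H_X h i =>
    refine Contragredient.mem_repIdeal R p ρ (i := p i)
      (sub_mem ?_ (Submodule.smul_mem _ _ (hX _))) ?_
    · simpa only [genParity, zero_add] using hm (hH h) (hX i)
    · rw [map_sub, map_smul, freeRep_mul R p ρ (hH _) (hX _)]
      simp only [freeRep_gen, koszul_zero_left, one_smul, hρ.H_X,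
        sub_self]
  | H_Y h i =>
    refine Contragredient.mem_repIdeal R p ρ (i := p i)
      (add_mem ?_ (Submodule.smul_mem _ _ (hY _))) ?_
    · simpa only [genParity, zero_add] using hm (hH h) (hY i)
    · rw [map_add, map_smul, freeRep_mul R p ρ (hH _) (hY _)]
      simp only [freeRep_gen, koszul_zero_left, one_smul, hρ.H_Y,
        neg_add_cancel]

/-! ### A representation on a free associative algebra -/

variable (lam : Module.Dual ℂ 𝔥)

/-- The free associative algebra on `n` letters, with basis the lists of letters. -/
abbrev VermaSpace (n : ℕ) : Type := List (Fin n) →₀ ℂ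

/-- The weight of a list. -/
def listWeight : List (Fin n) → Module.Dual ℂ 𝔥
  | [] => lam
  | i :: l => listWeight l - R.root i

/-- The action of `𝔥`. -/
def vermaH (h : 𝔥) : Module.End ℂ (VermaSpace n) :=
  Finsupp.linearCombination ℂ fun l => Finsupp.single l (listWeight R lam l h)

/-- The action of `Yᵢ`. -/
def vermaY (i : Fin n) : Module.End ℂ (VermaSpace n) :=
  Finsupp.linearCombination ℂ fun l => Finsupp.single (i :: l) 1

/-- The action of `Xᵢ` on basis vectors. -/
def vermaXAux (i : Fin n) : List (Fin n) → VermaSpace n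
  | [] => 0
  -- The relation `X_i Y_j = ± Y_j X_i + δ_ij h_i` read as a recursion; the coroot acts through the
  -- weight of the tail `l`.
  | j :: l => koszul (p i) (p j) • vermaY j (vermaXAux i l)
      + if i = j then Finsupp.single l (listWeight R lam l (R.coroot i)) else 0

/-- The action of `Xᵢ`. -/
def vermaX (i : Fin n) : Module.End ℂ (VermaSpace n) :=
  Finsupp.linearCombination ℂ (vermaXAux R p lam i)

theorem vermaH_single (h : 𝔥) (l : List (Fin n)) :
    vermaH R lam h (Finsupp.single l 1) = listWeight R lam l h • Finsupp.single l 1 := by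
  simp [vermaH]

theorem vermaY_single (i : Fin n) (l : List (Fin n)) :
    vermaY i (Finsupp.single l 1) = Finsupp.single (i :: l) 1 := by
  simp [vermaY]

theorem vermaX_single (i : Fin n) (l : List (Fin n)) :
    vermaX R p lam i (Finsupp.single l 1) = vermaXAux R p lam i l := by
  simp [vermaX]

theorem vermaSpace_ext {f g : Module.End ℂ (VermaSpace n)}
    (h : ∀ l, f (Finsupp.single l 1) = g (Finsupp.single l 1)) : f = g :=
  Finsupp.lhom_ext' fun l => LinearMap.ext_ring (h l)

theorem vermaH_add (h h' : 𝔥) : vermaH R lam (h + h') = vermaH R lam h + vermaH R lam h' :=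
  vermaSpace_ext fun l => by
    simp only [LinearMap.add_apply, vermaH_single, map_add, add_smul]

theorem vermaH_smul (c : ℂ) (h : 𝔥) : vermaH R lam (c • h) = c • vermaH R lam h :=
  vermaSpace_ext fun l => by
    simp only [LinearMap.smul_apply, vermaH_single, map_smul, smul_assoc]

theorem vermaH_comm (h h' : 𝔥) :
    vermaH R lam h * vermaH R lam h' = vermaH R lam h' * vermaH R lam h :=
  vermaSpace_ext fun l => by
    simp only [Module.End.mul_apply, vermaH_single, map_smul, smul_comm (listWeight R lam l h)]

theorem vermaH_vermaY (h : 𝔥) (i : Fin n) :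
    vermaH R lam h * vermaY i - vermaY i * vermaH R lam h = -(R.root i h • vermaY i) :=
  vermaSpace_ext fun l => by
    simp only [LinearMap.sub_apply, LinearMap.neg_apply, LinearMap.smul_apply,
      Module.End.mul_apply, vermaY_single, vermaH_single, map_smul, listWeight, ← sub_smul,
      ← neg_smul]
    congr 1
    ring

theorem vermaX_vermaY (i j : Fin n) :
    vermaX R p lam i * vermaY j - koszul (p i) (p j) • (vermaY j * vermaX R p lam i)
      = if i = j then vermaH R lam (R.coroot i) else 0 :=
  vermaSpace_ext fun l => by
    simp only [LinearMap.sub_apply, LinearMap.smul_apply, Module.End.mul_apply, vermaY_single,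
      vermaX_single, vermaXAux, add_sub_cancel_left]
    split_ifs
    · rw [vermaH_single, Finsupp.smul_single_one]
    · rfl

theorem vermaH_vermaXAux (h : 𝔥) (i : Fin n) (l : List (Fin n)) :
    vermaH R lam h (vermaXAux R p lam i l)
      = (listWeight R lam l h + R.root i h) • vermaXAux R p lam i l := by
  induction l with
  | nil => simp [vermaXAux]
  | cons j l ih =>
    have h1 := LinearMap.congr_fun (vermaH_vermaY R lam h j) (vermaXAux R p lam i l)
    simp only [LinearMap.sub_apply, LinearMap.neg_apply, LinearMap.smul_apply,
      Module.End.mul_apply, ih, map_smul, sub_eq_iff_eq_add] at h1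
    have h2 : vermaH R lam h
        (if i = j then Finsupp.single l (listWeight R lam l (R.coroot i)) else 0)
        = (listWeight R lam (j :: l) h + R.root i h) •
          (if i = j then Finsupp.single l (listWeight R lam l (R.coroot i)) else 0) := by
      split_ifs with hij
      · rw [← Finsupp.smul_single_one, map_smul, vermaH_single, smul_comm, listWeight, hij]
        simp
      · simp
    rw [vermaXAux, map_add, map_smul, h1, h2, listWeight, LinearMap.sub_apply]
    module

theorem vermaH_vermaX (h : 𝔥) (i : Fin n) :
    vermaH R lam h * vermaX R p lam i - vermaX R p lam i * vermaH R lam h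
      = R.root i h • vermaX R p lam i :=
  vermaSpace_ext fun l => by
    simp only [LinearMap.sub_apply, LinearMap.smul_apply, Module.End.mul_apply, vermaX_single,
      vermaH_single, map_smul, vermaH_vermaXAux, ← sub_smul, add_sub_cancel_left]

/-- The action of the generators. -/
def genRep : Gen n 𝔥 → Module.End ℂ (VermaSpace n)
  | .X i => vermaX R p lam i
  | .Y i => vermaY i
  | .H h => vermaH R lam h

theorem isRep_genRep : IsRep R p (genRep R p lam) where
  H_add := vermaH_add R lam
  H_smul := vermaH_smul R lam
  H_H := vermaH_comm R lam
  X_Y := vermaX_vermaY R p lam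
  H_X := vermaH_vermaX R p lam
  H_Y := vermaH_vermaY R lam

/-- In the module of highest weight `lam`, an element `h` acts on the empty list by `lam h`. If `h`
dies in `𝔤̃(A)`, all functionals vanish on it. -/
theorem cartanTilde_injective : Function.Injective (cartanTilde R p) := by
  rw [injective_iff_map_eq_zero]
  intro h h0
  refine (Module.forall_dual_apply_eq_zero_iff ℂ h).1 fun lam => ?_
  have h1 : gen R p (.H h) ∈ relIdeal R p := (Submodule.Quotient.mk_eq_zero (relIdeal R p)).1 h0
  have h2 : relIdeal R p ≤ repIdeal R p (genRep R p lam) :=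
    sInf_le ⟨isIdeal_repIdeal R p (genRep R p lam), fun x hx => hx.mem_repIdeal R p _ (isRep_genRep R p lam)⟩
  have h3 : repIdeal R p (genRep R p lam) ≤ LinearMap.ker (freeRep R p (genRep R p lam)) := sup_le inf_le_left inf_le_left
  have h4 : freeRep R p (genRep R p lam) (gen R p (.H h)) = 0 := h3 (h2 h1)
  rw [freeRep_gen] at h4
  have h5 := congrArg (fun f => f (Finsupp.single [] 1) []) h4
  simpa [genRep, vermaH_single, listWeight] using h5

end Representation

/-! ### Eigenspaces for nonzero eigenvalues -/

section Eigenspaces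

variable {V : Type*} [AddCommGroup V] [Module ℂ V]

/-- The sum of the eigenspaces of an operator for the nonzero eigenvalues. -/
def nonzeroPart (f : Module.End ℂ V) : Submodule ℂ V :=
  ⨆ (μ : ℂ) (_ : μ ≠ 0), f.eigenspace μ

/-- A product of factors `X - μ` over the nonzero eigenvalues occurring in `x`. Such a polynomial
separates `x` from the kernel of `f`, where it acts by its value at 0. -/
theorem exists_polynomial_of_mem_nonzeroPart {f : Module.End ℂ V} {x : V}
    (hx : x ∈ nonzeroPart f) :
    ∃ q : Polynomial ℂ, q.eval 0 ≠ 0 ∧ Polynomial.aeval f q x = 0 := by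
  unfold nonzeroPart at hx
  induction hx using Submodule.iSup_induction' with
  | zero => exact ⟨1, by simp, by simp⟩
  | add x y _ _ h1 h2 =>
    obtain ⟨q, hq, hqx⟩ := h1
    obtain ⟨r, hr, hry⟩ := h2
    refine ⟨q * r, by simp [hq, hr], ?_⟩
    rw [map_add, mul_comm q r]
    nth_rw 2 [mul_comm r q]
    simp only [map_mul, Module.End.mul_apply, hqx, hry, map_zero, add_zero]
  | mem μ x hx =>
    by_cases hμ : μ = 0
    · simp only [hμ, ne_eq, not_true_eq_false, iSup_false, Submodule.mem_bot] at hx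
      exact ⟨1, by simp, by simp [hx]⟩
    · simp only [ne_eq, hμ, not_false_eq_true, iSup_pos] at hx
      refine ⟨Polynomial.X - Polynomial.C μ, by simpa using hμ, ?_⟩
      rw [map_sub, Polynomial.aeval_X, Polynomial.aeval_C, LinearMap.sub_apply,
        Module.End.mem_eigenspace_iff.1 hx, Module.algebraMap_end_apply, sub_self]

theorem aeval_apply_of_apply_eq_zero {f : Module.End ℂ V} {x : V} (hx : f x = 0)
    (q : Polynomial ℂ) : Polynomial.aeval f q x = q.eval 0 • x := by
  have := Module.End.aeval_apply_of_hasEigenvector (f := f) (p := q) (μ := 0) (x := x)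
  by_cases h0 : x = 0
  · simp [h0]
  · exact this ⟨Module.End.mem_eigenspace_iff.2 (by rw [hx, zero_smul]), h0⟩

theorem eq_zero_of_mem_nonzeroPart {f : Module.End ℂ V} {x : V} (hx : x ∈ nonzeroPart f)
    (h : f x = 0) : x = 0 := by
  obtain ⟨q, hq, hqx⟩ := exists_polynomial_of_mem_nonzeroPart hx
  rw [aeval_apply_of_apply_eq_zero h] at hqx
  exact (smul_eq_zero.1 hqx).resolve_left hq

end Eigenspaces

/-! ### Triangular decomposition -/

section Triangular

variable {L : Type*} [AddCommGroup L] [Module ℂ L] [LieSuperalgebra L]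
  {n : ℕ} {A : Matrix (Fin n) (Fin n) ℂ} {𝔥 : Type*} [AddCommGroup 𝔥] [Module ℂ 𝔥]

/-- The defining relations of `𝔤̃(A)`. -/
structure IsCartanSystem (R : Realization A 𝔥) (p : Fin n → ZMod 2) (η : 𝔥 →ₗ[ℂ] L)
    (X Y : Fin n → L) : Prop where
  η_mem : ∀ h, η h ∈ part 0
  X_mem : ∀ i, X i ∈ part (p i)
  Y_mem : ∀ i, Y i ∈ part (p i)
  X_Y_same : ∀ i, X i ⋄ Y i = η (R.coroot i)
  X_Y : ∀ i j, i ≠ j → X i ⋄ Y j = 0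
  η_η : ∀ h h', η h ⋄ η h' = 0
  η_X : ∀ h i, η h ⋄ X i = R.root i h • X i
  η_Y : ∀ h i, η h ⋄ Y i = -(R.root i h • Y i)

/-- Right-nested brackets of length `m` of the `X i`. -/
inductive Nest (X : Fin n → L) : ℕ → L → Prop
  | base (i : Fin n) : Nest X 1 (X i)
  | step (i : Fin n) {m : ℕ} {y : L} (hy : Nest X m y) : Nest X (m + 1) (X i ⋄ y)

/-- The span of the right-nested brackets of the `X i`. -/
def nestSpan (X : Fin n → L) : Submodule ℂ L := Submodule.span ℂ {y | ∃ m, Nest X m y}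

theorem Nest.mem {X : Fin n → L} {m : ℕ} {y : L} (h : Nest X m y) : y ∈ nestSpan X :=
  Submodule.subset_span ⟨m, h⟩

theorem bracket_mem_nestSpan (X : Fin n → L) (i : Fin n) {y : L} (hy : y ∈ nestSpan X) :
    X i ⋄ y ∈ nestSpan X := by
  have : nestSpan X ≤ (nestSpan X).comap (bracket (X i)) :=
    Submodule.span_le.2 fun y ⟨m, h⟩ => (h.step i).mem
  exact this hy

namespace IsCartanSystem

variable {R : Realization A 𝔥} {p : Fin n → ZMod 2} {η : 𝔥 →ₗ[ℂ] L} {X Y : Fin n → L}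

theorem isChevalley (hs : IsCartanSystem R p η X Y) : IsChevalley A p X Y where
  X_mem := hs.X_mem
  Y_mem := hs.Y_mem
  X_Y := hs.X_Y
  H_X i j := by rw [hs.X_Y_same, hs.η_X, R.root_coroot]
  H_Y i j := by rw [hs.X_Y_same, hs.η_Y, R.root_coroot]

theorem swap (hs : IsCartanSystem R p η X Y) :
    IsCartanSystem R p (-η) Y (fun i => koszul (p i) (p i) • X i) where
  η_mem h := neg_mem (hs.η_mem h)
  X_mem := hs.Y_mem
  Y_mem i := Submodule.smul_mem _ _ (hs.X_mem i)
  X_Y_same i := by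
    rw [map_smul, hs.isChevalley.Y_X_same, hs.X_Y_same, smul_neg, smul_smul, koszul_self_mul,
      one_smul, LinearMap.neg_apply]
  X_Y i j hij := hs.isChevalley.swap.X_Y i j hij
  η_η h h' := by simp [hs.η_η]
  η_X h i := by simp [hs.η_Y]
  η_Y h i := by simp [hs.η_X, smul_comm (R.root i h)]

theorem η_nest (hs : IsCartanSystem R p η X Y) (h : 𝔥) {m : ℕ} {y : L} (hy : Nest X m y) :
    ∃ t : ℂ, η h ⋄ y = t • y := by
  induction hy with
  | base i => exact ⟨_, hs.η_X h i⟩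
  | step i _ ih =>
    obtain ⟨t, ht⟩ := ih
    refine ⟨R.root i h + t, ?_⟩
    rw [jac_even (hs.η_mem h), hs.η_X, ht, map_smul, map_smul, LinearMap.smul_apply, add_smul]

theorem nest_eigenvalue (hs : IsCartanSystem R p η X Y) {h : 𝔥} (hh : ∀ i, R.root i h = 1)
    {m : ℕ} {y : L} (hy : Nest X m y) : 1 ≤ m ∧ η h ⋄ y = (m : ℂ) • y := by
  induction hy with
  | base i => exact ⟨le_rfl, by rw [hs.η_X, hh, Nat.cast_one]⟩
  | step i _ ih =>
    refine ⟨by omega, ?_⟩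
    rw [jac_even (hs.η_mem h), hs.η_X, ih.2, hh, one_smul, map_smul, Nat.cast_succ, add_smul,
      one_smul, add_comm]

theorem η_mem_nestSpan (hs : IsCartanSystem R p η X Y) (h : 𝔥) {y : L} (hy : y ∈ nestSpan X) :
    η h ⋄ y ∈ nestSpan X := by
  have : nestSpan X ≤ (nestSpan X).comap (bracket (η h)) :=
    Submodule.span_le.2 fun y ⟨m, hy⟩ => by
      obtain ⟨t, ht⟩ := hs.η_nest h hy
      change η h ⋄ y ∈ nestSpan X
      rw [ht]
      exact Submodule.smul_mem _ _ hy.mem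
  exact this hy

/-- Commuting `Y j` past the outermost `X i` leaves a Cartan term, which preserves the span, and a
shorter bracket. The image of `𝔥` is needed because of `[Y_i, X_i]` at the innermost letter. -/
theorem Y_nest (hs : IsCartanSystem R p η X Y) (j : Fin n) {y : L} (hy : y ∈ nestSpan X) :
    Y j ⋄ y ∈ LinearMap.range η ⊔ nestSpan X := by
  have hX : ∀ i, ∀ y ∈ LinearMap.range η ⊔ nestSpan X,
      X i ⋄ y ∈ LinearMap.range η ⊔ nestSpan X := by
    intro i y hy
    obtain ⟨_, ⟨h, rfl⟩, b, hb, rfl⟩ := Submodule.mem_sup.1 hy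
    refine Submodule.mem_sup_right ?_
    rw [map_add, skew_even' (hs.η_mem h), hs.η_X]
    exact add_mem (neg_mem (Submodule.smul_mem _ _ (Nest.base i).mem))
      (bracket_mem_nestSpan X i hb)
  have key : ∀ m y, Nest X m y → Y j ⋄ y ∈ LinearMap.range η ⊔ nestSpan X := by
    intro m y hy
    induction hy with
    | base i =>
      by_cases hij : j = i
      · subst hij
        rw [hs.isChevalley.Y_X_same, hs.X_Y_same]
        exact Submodule.mem_sup_left (neg_mem (Submodule.smul_mem _ _ ⟨_, rfl⟩))
      · rw [hs.isChevalley.Y_X j i hij]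
        exact zero_mem _
    | step i hy ih =>
      rw [jac (hs.Y_mem j) (hs.X_mem i)]
      refine add_mem ?_ (Submodule.smul_mem _ _ (hX i _ ih))
      by_cases hij : j = i
      · subst hij
        rw [hs.isChevalley.Y_X_same, hs.X_Y_same, map_neg, map_smul, LinearMap.neg_apply,
          LinearMap.smul_apply]
        exact Submodule.mem_sup_right (neg_mem (Submodule.smul_mem _ _
          (hs.η_mem_nestSpan _ hy.mem)))
      · rw [hs.isChevalley.Y_X j i hij, map_zero, LinearMap.zero_apply]
        exact zero_mem _
  have : nestSpan X ≤ (LinearMap.range η ⊔ nestSpan X).comap (bracket (Y j)) :=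
    Submodule.span_le.2 fun y ⟨m, hy⟩ => key m y hy
  exact this hy

theorem bracket_mem_triangular (hs : IsCartanSystem R p η X Y) {x : L}
    (hx : x ∈ Set.range η ∪ (Set.range X ∪ Set.range Y)) {y : L}
    (hy : y ∈ LinearMap.range η ⊔ (nestSpan X ⊔ nestSpan Y)) :
    x ⋄ y ∈ LinearMap.range η ⊔ (nestSpan X ⊔ nestSpan Y) := by
  obtain ⟨_, ⟨h, rfl⟩, c, hc, rfl⟩ := Submodule.mem_sup.1 hy
  obtain ⟨a, ha, b, hb, rfl⟩ := Submodule.mem_sup.1 hc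
  rw [map_add, map_add]
  rcases hx with ⟨h', rfl⟩ | ⟨i, rfl⟩ | ⟨i, rfl⟩
  · rw [hs.η_η, zero_add]
    refine Submodule.mem_sup_right (Submodule.add_mem_sup (hs.η_mem_nestSpan _ ha) ?_)
    have := hs.swap.η_mem_nestSpan h' hb
    rw [LinearMap.neg_apply, map_neg, LinearMap.neg_apply] at this
    exact neg_mem_iff.1 this
  · refine add_mem ?_ (add_mem ?_ ?_)
    · rw [skew_even' (hs.η_mem h), hs.η_X]
      exact Submodule.mem_sup_right (Submodule.mem_sup_left
        (neg_mem (Submodule.smul_mem _ _ (Nest.base i).mem)))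
    · exact Submodule.mem_sup_right (Submodule.mem_sup_left (bracket_mem_nestSpan X i ha))
    · have h1 := hs.swap.Y_nest i hb
      rw [map_smul, LinearMap.smul_apply, Submodule.smul_mem_iff _ (koszul_ne_zero _ _),
        LinearMap.range_neg] at h1
      exact (sup_le_sup_left le_sup_right (LinearMap.range η)) h1
  · refine add_mem ?_ (add_mem ?_ ?_)
    · rw [skew_even' (hs.η_mem h), hs.η_Y, neg_neg]
      exact Submodule.mem_sup_right (Submodule.mem_sup_right
        (Submodule.smul_mem _ _ (Nest.base i).mem))
    · exact (sup_le_sup_left le_sup_left (LinearMap.range η)) (hs.Y_nest i ha)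
    · exact Submodule.mem_sup_right (Submodule.mem_sup_right (bracket_mem_nestSpan Y i hb))

/-- Membership alone is not inductive for products; stability of the triangular sum under `ad x` is
carried along and passes to brackets by Jacobi, for which homogeneity is recorded as well. -/
theorem word_mem_triangular (hs : IsCartanSystem R p η X Y) {l : ℕ} {x : L}
    (hx : Word (Set.range η ∪ (Set.range X ∪ Set.range Y)) l x) :
    (∃ i, x ∈ part (L := L) i) ∧ x ∈ LinearMap.range η ⊔ (nestSpan X ⊔ nestSpan Y) ∧
      ∀ y ∈ LinearMap.range η ⊔ (nestSpan X ⊔ nestSpan Y),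
        x ⋄ y ∈ LinearMap.range η ⊔ (nestSpan X ⊔ nestSpan Y) := by
  induction hx with
  | gen hx =>
    refine ⟨?_, ?_, fun y hy => hs.bracket_mem_triangular hx hy⟩
    · rcases hx with ⟨h, rfl⟩ | ⟨i, rfl⟩ | ⟨i, rfl⟩
      · exact ⟨_, hs.η_mem h⟩
      · exact ⟨_, hs.X_mem i⟩
      · exact ⟨_, hs.Y_mem i⟩
    · rcases hx with ⟨h, rfl⟩ | ⟨i, rfl⟩ | ⟨i, rfl⟩
      · exact Submodule.mem_sup_left ⟨h, rfl⟩
      · exact Submodule.mem_sup_right (Submodule.mem_sup_left (Nest.base i).mem)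
      · exact Submodule.mem_sup_right (Submodule.mem_sup_right (Nest.base i).mem)
  | mul _ _ h1 h2 =>
    obtain ⟨⟨i, hi⟩, -, h1⟩ := h1
    obtain ⟨⟨j, hj⟩, h2', h2⟩ := h2
    refine ⟨⟨_, bracket_mem _ _ _ _ hi hj⟩, h1 _ h2', fun y hy => ?_⟩
    rw [eq_sub_of_add_eq (jac hi hj y).symm]
    exact sub_mem (h1 _ (h2 _ hy)) (Submodule.smul_mem _ _ (h2 _ (h1 _ hy)))
  | smul c _ h =>
    obtain ⟨⟨i, hi⟩, h1, h2⟩ := h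
    refine ⟨⟨i, Submodule.smul_mem _ _ hi⟩, Submodule.smul_mem _ _ h1, fun y hy => ?_⟩
    rw [map_smul, LinearMap.smul_apply]
    exact Submodule.smul_mem _ _ (h2 y hy)
  | mono _ _ h => exact h

/-- An ideal meeting the Cartan subalgebra trivially lies in the sum of the nonzero components of
the principal grading. -/
theorem ideal_le_nonzeroPart (hs : IsCartanSystem R p η X Y)
    (hspan : wordSpan (Set.range η ∪ (Set.range X ∪ Set.range Y)) = ⊤) {h : 𝔥}
    (hh : ∀ i, R.root i h = 1) {I : Submodule ℂ L} (hI : IsIdeal I)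
    (hd : Disjoint I (LinearMap.range η)) : I ≤ nonzeroPart (bracket (η h)) := by
  have htop : LinearMap.range η ⊔ (nestSpan X ⊔ nestSpan Y) = ⊤ := by
    rw [eq_top_iff, ← hspan]
    exact Submodule.span_le.2 fun x ⟨l, hx⟩ => (hs.word_mem_triangular hx).2.1
  have hX : nestSpan X ≤ nonzeroPart (bracket (η h)) :=
    Submodule.span_le.2 fun y ⟨m, hy⟩ => by
      obtain ⟨h1, h2⟩ := hs.nest_eigenvalue hh hy
      exact Submodule.mem_iSup_of_mem (m : ℂ) (Submodule.mem_iSup_of_mem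
        (by exact_mod_cast (by omega : m ≠ 0)) (Module.End.mem_eigenspace_iff.2 h2))
  have hY : nestSpan Y ≤ nonzeroPart (bracket (η h)) :=
    Submodule.span_le.2 fun y ⟨m, hy⟩ => by
      obtain ⟨h1, h2⟩ := hs.swap.nest_eigenvalue hh hy
      rw [LinearMap.neg_apply, map_neg, LinearMap.neg_apply, neg_eq_iff_eq_neg, ← neg_smul] at h2
      exact Submodule.mem_iSup_of_mem (-m : ℂ) (Submodule.mem_iSup_of_mem
        (neg_ne_zero.2 (by exact_mod_cast (by omega : m ≠ 0)))
        (Module.End.mem_eigenspace_iff.2 h2))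
  intro x hx
  obtain ⟨_, ⟨h', rfl⟩, y, hy, rfl⟩ := Submodule.mem_sup.1 (htop ▸ Submodule.mem_top (x := x))
  have hy' := sup_le hX hY hy
  -- `q(ad h)` preserves `I`, kills the part `y`, and multiplies the Cartan part `η h'` by `q(0) ≠
  -- 0`. So `η h'` lies in `I` and must vanish.
  obtain ⟨q, hq, hqy⟩ := exists_polynomial_of_mem_nonzeroPart hy'
  have h1 : Polynomial.aeval (bracket (η h) : Module.End ℂ L) q (η h' + y) ∈ I :=
    q.aeval_apply_smul_mem_of_le_comap hx (bracket (η h) : Module.End ℂ L)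
      (fun z hz => hI.left _ z hz)
  rw [map_add, hqy, add_zero, aeval_apply_of_apply_eq_zero (hs.η_η h h')] at h1
  have h2 := (Submodule.smul_mem_iff _ hq).1 h1
  have h3 := Submodule.disjoint_def.1 hd _ h2 ⟨h', rfl⟩
  rw [h3, zero_add]
  exact hy'

end IsCartanSystem

/-- Independence of the roots gives a functional on `𝔥*` equal to 1 on each of them, and by finite
dimension it is evaluation at an element of `𝔥`. This element defines the principal grading. -/
theorem Realization.exists_root_eq_one (R : Realization A 𝔥) : ∃ h, ∀ i, R.root i h = 1 := by
  have := R.finite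
  have hli := R.linearIndependent_root
  obtain ⟨g, hg⟩ := LinearMap.exists_extend
    (Finsupp.linearCombination ℂ (fun _ : Fin n => (1 : ℂ)) ∘ₗ hli.repr)
  refine ⟨(Module.evalEquiv ℂ 𝔥).symm g, fun i => ?_⟩
  rw [Module.apply_evalEquiv_symm_apply]
  have := LinearMap.congr_fun hg ⟨R.root i, Submodule.subset_span (Set.mem_range_self i)⟩
  rw [LinearMap.comp_apply, LinearMap.comp_apply, hli.repr_eq_single i ⟨R.root i, _⟩ rfl] at this
  simpa using this

end Triangular

/-! ### The Chevalley generators of `𝔤(A)` -/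

section Contragredient

variable {n : ℕ} {A : Matrix (Fin n) (Fin n) ℂ} {𝔥 : Type*} [AddCommGroup 𝔥] [Module ℂ 𝔥]
  (R : Realization A 𝔥) (p : Fin n → ZMod 2)

/-- The generators `Xᵢ` of `𝔤̃(A)`. -/
def tildeX (i : Fin n) : GTilde R p := toGTilde R p (gen R p (.X i))

/-- The generators `Yᵢ` of `𝔤̃(A)`. -/
def tildeY (i : Fin n) : GTilde R p := toGTilde R p (gen R p (.Y i))

theorem toGTilde_mul (x y : FreeAlg R p) :
    toGTilde R p x ⋄ toGTilde R p y = toGTilde R p (x * y) := rfl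

theorem toGTilde_mem {i : ZMod 2} {x : FreeAlg R p} (hx : x ∈ wordPart R p i) :
    toGTilde R p x ∈ part (L := GTilde R p) i := ⟨x, hx, rfl⟩

theorem isCartanSystem_tilde :
    IsCartanSystem R p (cartanTilde R p) (tildeX R p) (tildeY R p) where
  η_mem h := toGTilde_mem R p (gen_mem R p (.H h))
  X_mem i := toGTilde_mem R p (gen_mem R p (.X i))
  Y_mem i := toGTilde_mem R p (gen_mem R p (.Y i))
  X_Y_same i := by
    have := (IsRelator.X_Y_same (R := R) (p := p) i).toGTilde_eq_zero
    rw [map_sub, sub_eq_zero] at this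
    exact this
  X_Y i j hij := (IsRelator.X_Y_ne (R := R) (p := p) i j hij).toGTilde_eq_zero
  η_η h h' := (IsRelator.H_H (R := R) (p := p) h h').toGTilde_eq_zero
  η_X h i := by
    have := (IsRelator.H_X (R := R) (p := p) h i).toGTilde_eq_zero
    rw [map_sub, sub_eq_zero, map_smul] at this
    exact this
  η_Y h i := by
    have := (IsRelator.H_Y (R := R) (p := p) h i).toGTilde_eq_zero
    rw [map_add, map_smul, add_eq_zero_iff_eq_neg] at this
    exact this

theorem wordSpan_tilde : wordSpan (Set.range (cartanTilde R p) ∪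
    (Set.range (tildeX R p) ∪ Set.range (tildeY R p))) = ⊤ := by
  have h1 : ∀ w, ∃ l, Word (Set.range (cartanTilde R p) ∪
      (Set.range (tildeX R p) ∪ Set.range (tildeY R p))) l (toGTilde R p (word R p w)) := by
    intro w
    induction w with
    | ih1 g =>
      refine ⟨1, .gen ?_⟩
      cases g with
      | X i => exact Set.mem_union_right _ (Set.mem_union_left _ ⟨i, rfl⟩)
      | Y i => exact Set.mem_union_right _ (Set.mem_union_right _ ⟨i, rfl⟩)
      | H h => exact Set.mem_union_left _ ⟨h, rfl⟩
    | ih2 u v hu hv =>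
      obtain ⟨a, ha⟩ := hu
      obtain ⟨b, hb⟩ := hv
      refine ⟨a + b, ?_⟩
      rw [← FreeMagma.mul_eq, ← word_mul, ← toGTilde_mul]
      exact ha.mul hb
  have h2 : ∀ i, wordPart R p i ≤ (wordSpan (Set.range (cartanTilde R p) ∪
      (Set.range (tildeX R p) ∪ Set.range (tildeY R p)))).comap (toGTilde R p) := by
    intro i
    refine Submodule.span_le.2 ?_
    rintro _ ⟨w, -, rfl⟩
    obtain ⟨l, hl⟩ := h1 w
    exact hl.mem_wordSpan
  rw [eq_top_iff]
  rintro x -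
  obtain ⟨x, rfl⟩ := (relIdeal R p).mkQ_surjective x
  obtain ⟨a, ha, b, hb, rfl⟩ := exists_wordPart_add R p x
  rw [map_add]
  exact add_mem (h2 0 ha) (h2 1 hb)

/-- The quotient map onto `𝔤(A)`. -/
def toG : GTilde R p →ₗ[ℂ] G R p := (maxIdeal R p).mkQ

theorem toG_bracket (x y : GTilde R p) : toG R p x ⋄ toG R p y = toG R p (x ⋄ y) := rfl

theorem toG_mem {i : ZMod 2} {x : GTilde R p} (hx : x ∈ part (L := GTilde R p) i) :
    toG R p x ∈ part (L := G R p) i := ⟨x, hx, rfl⟩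

theorem toG_cartanTilde (h : 𝔥) : toG R p (cartanTilde R p h) = cartan R p h := rfl

theorem toG_eq_zero {x : GTilde R p} : toG R p x = 0 ↔ x ∈ maxIdeal R p :=
  Submodule.Quotient.mk_eq_zero _

theorem isCartanSystem_G : IsCartanSystem R p (cartan R p)
    (fun i => toG R p (tildeX R p i)) (fun i => toG R p (tildeY R p i)) where
  η_mem h := toG_mem R p ((isCartanSystem_tilde R p).η_mem h)
  X_mem i := toG_mem R p ((isCartanSystem_tilde R p).X_mem i)
  Y_mem i := toG_mem R p ((isCartanSystem_tilde R p).Y_mem i)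
  X_Y_same i := by rw [toG_bracket, (isCartanSystem_tilde R p).X_Y_same, toG_cartanTilde]
  X_Y i j hij := by rw [toG_bracket, (isCartanSystem_tilde R p).X_Y i j hij, map_zero]
  η_η h h' := by
    rw [← toG_cartanTilde, ← toG_cartanTilde, toG_bracket, (isCartanSystem_tilde R p).η_η,
      map_zero]
  η_X h i := by
    rw [← toG_cartanTilde, toG_bracket, (isCartanSystem_tilde R p).η_X, map_smul]
  η_Y h i := by
    rw [← toG_cartanTilde, toG_bracket, (isCartanSystem_tilde R p).η_Y, map_neg, map_smul]

/-- The issue is that the sum of all ideals meeting `𝔥` trivially still does. Each lies in the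
nonzero part of one fixed `ad ρ`, hence so does their sum, whereas `𝔥` lies in the kernel of `ad ρ`.
-/
theorem cartan_injective : Function.Injective (cartan R p) := by
  rw [injective_iff_map_eq_zero]
  intro h h0
  obtain ⟨ρ, hρ⟩ := R.exists_root_eq_one
  have hs := isCartanSystem_tilde R p
  have h1 : cartanTilde R p h ∈ maxIdeal R p := (toG_eq_zero R p).1 h0
  have h2 : maxIdeal R p ≤ nonzeroPart (bracket (cartanTilde R p ρ)) :=
    sSup_le fun I hI => hs.ideal_le_nonzeroPart (wordSpan_tilde R p) hρ hI.1 hI.2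
  have h3 := eq_zero_of_mem_nonzeroPart (h2 h1) (hs.η_η ρ h)
  exact cartanTilde_injective R p (h3.trans (map_zero _).symm)

/-! ### Root spaces and growth of `𝔤(A)` -/

theorem mem_rootSpace {α : Module.Dual ℂ 𝔥} {x : G R p} :
    x ∈ rootSpace R p α ↔ ∀ h, cartan R p h ⋄ x = α h • x := by
  simp [rootSpace, Submodule.mem_iInf, sub_eq_zero]

theorem bracket_mem_rootSpace (α β : Module.Dual ℂ 𝔥) (x y : G R p) (hx : x ∈ rootSpace R p α)
    (hy : y ∈ rootSpace R p β) : x ⋄ y ∈ rootSpace R p (α + β) := by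
  rw [mem_rootSpace] at *
  intro h
  rw [jac_even ((isCartanSystem_G R p).η_mem h), hx, hy, map_smul, map_smul,
    LinearMap.smul_apply, LinearMap.add_apply, add_smul]

/-- The operators `ad h` commute, so their simultaneous generalised eigenspaces are independent, and
root spaces sit inside these. -/
theorem disjoint_rootSpace :
    Disjoint (rootSpace R p 0) (⨆ (α) (_ : α ≠ 0), rootSpace R p α) := by
  have hs := isCartanSystem_G R p
  have hcomm : ∀ h h' : 𝔥, Commute (bracket (cartan R p h) : Module.End ℂ (G R p))
      (bracket (cartan R p h')) := fun h h' => by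
    refine LinearMap.ext fun x => ?_
    rw [Module.End.mul_apply, Module.End.mul_apply, jac_even (hs.η_mem h), hs.η_η, map_zero,
      LinearMap.zero_apply, zero_add]
  have hind := Module.End.independent_iInf_maxGenEigenspace_of_forall_mapsTo
    (fun h : 𝔥 => (bracket (cartan R p h) : Module.End ℂ (G R p)))
    (fun h h' φ => Module.End.mapsTo_maxGenEigenspace_of_comm (hcomm h' h) φ)
  have hle : ∀ α : Module.Dual ℂ 𝔥, rootSpace R p α ≤ ⨅ h : 𝔥,
      Module.End.maxGenEigenspace (bracket (cartan R p h)) (α h) := by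
    intro α x hx
    rw [Submodule.mem_iInf]
    intro h
    exact Module.End.mem_maxGenEigenspace _ _ _ |>.2 ⟨1, by
      rw [pow_one, LinearMap.sub_apply, (mem_rootSpace R p).1 hx h]
      simp⟩
  have hd := hind (fun _ => 0)
  refine hd.mono (hle 0) (iSup₂_le fun α hα => (hle α).trans ?_)
  refine le_iSup₂_of_le (fun h => α h) (fun h0 => hα (LinearMap.ext fun h => congrFun h0 h)) le_rfl

theorem exists_rootSpace_of_word {l : ℕ} {x : G R p}
    (hx : Word (Set.range (fun i => toG R p (tildeX R p i)) ∪
      Set.range (fun i => toG R p (tildeY R p i))) l x) :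
    ∃ c : Fin n → ℤ, x ∈ rootSpace R p (∑ i, c i • R.root i) ∧ |∑ i, c i| ≤ l := by
  have hs := isCartanSystem_G R p
  induction hx with
  | gen hx =>
    rcases hx with ⟨i, rfl⟩ | ⟨i, rfl⟩
    · refine ⟨Pi.single i 1, (mem_rootSpace R p).2 fun h => ?_, by simp⟩
      rw [hs.η_X, Fintype.sum_eq_single i fun j hj => by simp [hj]]
      simp
    · refine ⟨-Pi.single i 1, (mem_rootSpace R p).2 fun h => ?_, by simp⟩
      rw [hs.η_Y, Fintype.sum_eq_single i fun j hj => by simp [hj]]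
      simp
  | mul _ _ h1 h2 =>
    obtain ⟨c, hc, hc'⟩ := h1
    obtain ⟨d, hd, hd'⟩ := h2
    refine ⟨c + d, ?_, ?_⟩
    · have := bracket_mem_rootSpace R p _ _ _ _ hc hd
      rwa [← Finset.sum_add_distrib, ← Finset.sum_congr rfl fun i _ => add_smul _ _ _] at this
    · simp only [Pi.add_apply, Finset.sum_add_distrib]
      push_cast
      exact (abs_add_le _ _).trans (add_le_add hc' hd')
  | smul t _ h =>
    obtain ⟨c, hc, hc'⟩ := h
    exact ⟨c, Submodule.smul_mem _ _ hc, hc'⟩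
  | mono hab _ h =>
    obtain ⟨c, hc, hc'⟩ := h
    exact ⟨c, hc, hc'.trans (by exact_mod_cast hab)⟩

theorem rank_biSup_le {V : Type*} [AddCommGroup V] [Module ℂ V] {ι : Type*} (s : Finset ι)
    (P : ι → Submodule ℂ V) (B : ℕ) (hB : ∀ i ∈ s, Module.rank ℂ (P i) ≤ B) :
    Module.rank ℂ (⨆ i ∈ s, P i : Submodule ℂ V) ≤ ((s.card * B : ℕ) : Cardinal) := by
  classical
  induction s using Finset.induction_on with
  | empty => simp
  | insert i s hi ih =>
    rw [Finset.iSup_insert, Finset.card_insert_of_notMem hi, add_mul, one_mul, add_comm,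
      Nat.cast_add]
    exact (Submodule.rank_add_le_rank_add_rank _ _).trans
      (add_le_add (hB i (Finset.mem_insert_self i s))
        (ih fun j hj => hB j (Finset.mem_insert_of_mem hj)))

/-- A word of length at most `m` has height between `-m` and `m`. Summing the bound over these `2m +
1 ≤ 2(m + 1)` components doubles the constant and raises the degree by one. -/
theorem polyGrowth_G (hgrowth : HasFiniteGrowth R p) :
    PolyGrowth (Set.range (fun i => toG R p (tildeX R p i)) ∪
      Set.range (fun i => toG R p (tildeY R p i))) := by
  obtain ⟨C, d, h⟩ := hgrowth
  refine ⟨2 * C, d + 1, fun m k v hv hw => ?_⟩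
  set P : Submodule ℂ (G R p) := ⨆ j ∈ Finset.Icc (-m : ℤ) m, principalPart R p j with hP
  have hmem : ∀ i, v i ∈ P := by
    intro i
    obtain ⟨c, hc, hc'⟩ := exists_rootSpace_of_word R p (hw i)
    have h1 : rootSpace R p (∑ i, c i • R.root i) ≤ principalPart R p (∑ i, c i) :=
      le_iSup₂_of_le c rfl le_rfl
    have h2 : principalPart R p (∑ i, c i) ≤ P :=
      le_iSup₂_of_le (∑ i, c i) (Finset.mem_Icc.2 (abs_le.1 hc')) le_rfl
    exact h2 (h1 hc)
  have hli : LinearIndependent ℂ (fun i => (⟨v i, hmem i⟩ : P)) :=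
    LinearIndependent.of_comp P.subtype hv
  have h1 : ((k : ℕ) : Cardinal) ≤ Module.rank ℂ P := by
    simpa using hli.cardinal_lift_le_rank
  have h2 := rank_biSup_le (Finset.Icc (-m : ℤ) m) (principalPart R p) (C * (m + 1) ^ d)
    (fun j hj => (h j).trans (by
      rw [Finset.mem_Icc] at hj
      have : j.natAbs ≤ m := by omega
      exact_mod_cast Nat.mul_le_mul_left C (Nat.pow_le_pow_left (by omega) d)))
  have h3 : k ≤ (Finset.Icc (-m : ℤ) m).card * (C * (m + 1) ^ d) := by
    exact_mod_cast h1.trans h2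
  have h4 : (Finset.Icc (-m : ℤ) m).card = 2 * m + 1 := by
    rw [Int.card_Icc]
    omega
  rw [h4] at h3
  refine h3.trans ?_
  rw [pow_succ]
  have h5 : (2 * m + 1) * (C * (m + 1) ^ d) ≤ (2 * (m + 1)) * (C * (m + 1) ^ d) :=
    Nat.mul_le_mul_right _ (by omega)
  refine h5.trans (le_of_eq ?_)
  ring

/-- The grading group is `𝔥*`, graded by root spaces. The generators are nonzero because `[X_i,
Y_i]` is the image of a nonzero coroot under an injective map. -/
theorem isGradedChevalley_G (hgrowth : HasFiniteGrowth R p) :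
    IsGradedChevalley A p (fun i => toG R p (tildeX R p i)) (fun i => toG R p (tildeY R p i))
      (rootSpace R p) R.root where
  toIsChevalley := (isCartanSystem_G R p).isChevalley
  X_ne i h := by
    have h1 := (isCartanSystem_G R p).X_Y_same i
    simp only [h, map_zero, LinearMap.zero_apply] at h1
    exact R.linearIndependent_coroot.ne_zero i
      (cartan_injective R p (h1.symm.trans (map_zero _).symm))
  polyGrowth := polyGrowth_G R p hgrowth
  bracket_W := bracket_mem_rootSpace R p
  X_W i := (mem_rootSpace R p).2 fun h => (isCartanSystem_G R p).η_X h i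
  Y_W i := (mem_rootSpace R p).2 fun h => by
    rw [(isCartanSystem_G R p).η_Y h i, LinearMap.neg_apply, neg_smul]
  disjoint_W := disjoint_rootSpace R p
  linearIndependent := R.linearIndependent_root.restrict_scalars (by
    intro a b hab
    simpa using hab)

end Contragredient

end Contragredient

end

theorem mainTheorem4 {n : ℕ} (A : Matrix (Fin n) (Fin n) ℂ) (p : Fin n → ZMod 2)
    {𝔥 : Type*} [AddCommGroup 𝔥] [Module ℂ 𝔥] (R : Contragredient.Realization A 𝔥)
    (hA : Contragredient.Indecomposable A) (hrows : Contragredient.NoZeroRows A)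
    (hgrowth : Contragredient.HasFiniteGrowth R p) :
    Contragredient.IsAdmissible A p :=
  (Contragredient.isGradedChevalley_G R p hgrowth).isAdmissible hrows
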